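/- **Theorem 3 (Detecting multilinear terms).** An algebraic circuit $C$ over $\mathbf Z[\zeta_1,\dots,\zeta_n]$ is an acyclic network of gates, each of which is a variable $\zeta_j$, an arbitrary (possibly negative) integer constant, or a sum or product of any finite number of other gates, with a designated output gate. Its size $|C|$ is the number of its gates and wires plus the total bit length of its constants, and its depth $d(C)$ is the number of wires on a longest path ending in the output gate. The polynomial $C(\zeta_1,\dots,\zeta_n)\in\mathbf Z[\zeta_1,\dots,\zeta_n]$ is the one computed at the output gate. It has a *degree-$k$ multilinear term* if some monomial of total degree $k$, in which every variable has exponent at most $1$, has a nonzero coefficient in it. There is a randomized algorithm (a single program of a random access machine with fair coin flips, whose running time is measured by the logarithmic cost criterion: each instruction is charged the bit lengths of the numbers and addresses that it handles) which, given any $n,k\ge 0$ and any algebraic circuit $C$ over $\mathbf Z[\zeta_1,\dots,\zeta_n]$, behaves as follows. 1. If $C(\zeta_1,\dots,\zeta_n)$ has no degree-$k$ multilinear term, then it never accepts. 2. If $C(\zeta_1,\dots,\zeta_n)$ has a degree-$k$ multilinear term, then it accepts with probability at least $99\%$. 3. For every outcome of the coin flips it halts within time $4.32^k\cdot|C|\cdot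 p\bigl(n+d(C)+\ell(|C|)\bigr)$, where $p$ is a fixed polynomial and $\ell(|C|)$ is the number of binary digits of $|C|$. 4. In particular, its running time is $4.32^k\cdot|C|\cdot\operatorname{poly}(n)$ on circuits whose depth and $\log|C|$ are polynomially bounded in $n$: for every polynomial $q$ there is a polynomial $p'$ such that the algorithm halts within time $4.32^k\cdot|C|\cdot p'(n)$ whenever $d(C)\le q(n)$ and $\ell(|C|)\le q(n)$. -/

import Mathlib

open MeasureTheory
open scoped ENNReal

/-! ### Algebraic circuits over `ℤ[ζ₁, …, ζₙ]` -/

/-- The gate with index `i` of an algebraic circuit in `n` variables: a variable, an arbitrary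
(possibly negative) integer constant, or a sum or product of any number of earlier gates. -/
inductive Gate (n i : ℕ) : Type
  | var (j : Fin n) : Gate n i
  | const (c : ℤ) : Gate n i
  | add (l : List (Fin i)) : Gate n i
  | mul (l : List (Fin i)) : Gate n i

/-- An algebraic circuit over `ℤ[ζ₁, …, ζₙ]`: an acyclic network of gates, listed in topological
order, with a designated output gate. -/
structure Circuit (n : ℕ) : Type where
  numGates : ℕ
  gate : (i : Fin numGates) → Gate n i
  out : Fin numGates

/-- The contribution of a gate to the size of a circuit: one for the gate, one for each of its
incoming wires, and the number of binary digits of a constant. -/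
def Gate.weight {n i : ℕ} : Gate n i → ℕ
  | .var _ => 1
  | .const c => 1 + Nat.size c.natAbs
  | .add l => 1 + l.length
  | .mul l => 1 + l.length

/-- The size `|C|`: number of gates, plus number of wires, plus total bit length of constants. -/
def Circuit.size {n : ℕ} (C : Circuit n) : ℕ := ∑ i, (C.gate i).weight

/-- The polynomial computed at gate `i`. -/
noncomputable def Circuit.polyAt {n : ℕ} (C : Circuit n) (i : ℕ) (hi : i < C.numGates) :
    MvPolynomial (Fin n) ℤ :=
  match C.gate ⟨i, hi⟩ with
  | .var j => MvPolynomial.X j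
  | .const c => MvPolynomial.C c
  | .add l => (l.map fun j : Fin i => C.polyAt j.1 (j.2.trans hi)).sum
  | .mul l => (l.map fun j : Fin i => C.polyAt j.1 (j.2.trans hi)).prod
termination_by i
decreasing_by all_goals exact j.2

/-- The polynomial `C(ζ₁, …, ζₙ)` computed by the circuit. -/
noncomputable def Circuit.poly {n : ℕ} (C : Circuit n) : MvPolynomial (Fin n) ℤ :=
  C.polyAt C.out.1 C.out.2

/-- The length (number of wires) of a longest path from an input to gate `i`. -/
def Circuit.depthAt {n : ℕ} (C : Circuit n) (i : ℕ) (hi : i < C.numGates) : ℕ :=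
  match C.gate ⟨i, hi⟩ with
  | .var _ => 0
  | .const _ => 0
  | .add l => (l.map fun j : Fin i => C.depthAt j.1 (j.2.trans hi) + 1).foldr max 0
  | .mul l => (l.map fun j : Fin i => C.depthAt j.1 (j.2.trans hi) + 1).foldr max 0
termination_by i
decreasing_by all_goals exact j.2

/-- The depth of the circuit: the length of a longest path ending in the output gate. -/
def Circuit.depth {n : ℕ} (C : Circuit n) : ℕ := C.depthAt C.out.1 C.out.2

/-- `f` has a degree-`k` multilinear term: some monomial of total degree `k`, in which every
variable has exponent at most one, has a nonzero coefficient in `f`. -/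
def HasMultilinearTerm {n : ℕ} (k : ℕ) (f : MvPolynomial (Fin n) ℤ) : Prop :=
  ∃ m : Fin n →₀ ℕ, (∀ i, m i ≤ 1) ∧ (∑ i, m i) = k ∧ f.coeff m ≠ 0

/-! ### Randomized random access machines with logarithmic cost

The machine has finitely many variables (those named in its program) and an unbounded memory
addressed by natural numbers; all of them hold natural numbers.  Programs are built from
arithmetic, indirect loads and stores, fair coin flips, conditionals and loops.  Every instruction
is charged the bit lengths of all operands and addresses that it handles. -/

/-- Arithmetic operations (`sub` is truncated subtraction, `div` is division with rounding down
and gives `0` for the divisor `0`). -/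
inductive Arith : Type
  | add
  | sub
  | mul
  | div

/-- The value of an arithmetic operation. -/
def Arith.eval : Arith → ℕ → ℕ → ℕ
  | .add, a, b => a + b
  | .sub, a, b => a - b
  | .mul, a, b => a * b
  | .div, a, b => a / b

/-- Programs of the random access machine; variables are named by natural numbers. -/
inductive Prog : Type
  /-- do nothing -/
  | skip : Prog
  /-- `x := c` -/
  | const (x c : ℕ) : Prog
  /-- `x := y o z` -/
  | arith (x : ℕ) (o : Arith) (y z : ℕ) : Prog
  /-- `x := mem[y]` -/
  | load (x y : ℕ) : Prog
  /-- `mem[x] := y` -/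
  | store (x y : ℕ) : Prog
  /-- `x :=` a fresh random bit -/
  | flip (x : ℕ) : Prog
  /-- first `P`, then `Q` -/
  | seq (P Q : Prog) : Prog
  /-- if `x ≠ 0` then `P` else `Q` -/
  | ite (x : ℕ) (P Q : Prog) : Prog
  /-- while `x ≠ 0` do `P` -/
  | loop (x : ℕ) (P : Prog) : Prog

/-- A configuration: the variables, the memory, and the number of coins flipped so far. -/
structure Config : Type where
  var : ℕ → ℕ
  mem : ℕ → ℕ
  coins : ℕ

/-- Assign the value `v` to the variable `x`. -/
def Config.setVar (s : Config) (x v : ℕ) : Config :=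
  { s with var := Function.update s.var x v }

/-- Write the value `v` to the memory cell `a`. -/
def Config.setMem (s : Config) (a v : ℕ) : Config :=
  { s with mem := Function.update s.mem a v }

/-- The charge for handling a number: its number of binary digits plus one. -/
def bitCost (a : ℕ) : ℕ := Nat.size a + 1

/-- `Exec ω P s T s'`: with coin flips `ω`, the program `P` started in the configuration `s` halts
in the configuration `s'` after time `T` (logarithmic cost). -/
inductive Exec (ω : ℕ → Bool) : Prog → Config → ℕ → Config → Prop
  | skip (s : Config) : Exec ω .skip s 1 s
  | const (x c : ℕ) (s : Config) : Exec ω (.const x c) s (bitCost c) (s.setVar x c)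
  | arith (x : ℕ) (o : Arith) (y z : ℕ) (s : Config) :
      Exec ω (.arith x o y z) s (bitCost (s.var y) + bitCost (s.var z))
        (s.setVar x (o.eval (s.var y) (s.var z)))
  | load (x y : ℕ) (s : Config) :
      Exec ω (.load x y) s (bitCost (s.var y) + bitCost (s.mem (s.var y)))
        (s.setVar x (s.mem (s.var y)))
  | store (x y : ℕ) (s : Config) :
      Exec ω (.store x y) s (bitCost (s.var x) + bitCost (s.var y))
        (s.setMem (s.var x) (s.var y))
  | flip (x : ℕ) (s : Config) :
      Exec ω (.flip x) s 1
        { s.setVar x (if ω s.coins then 1 else 0) with coins := s.coins + 1 }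
  | seq {P Q : Prog} {s s₁ s₂ : Config} {T₁ T₂ : ℕ} :
      Exec ω P s T₁ s₁ → Exec ω Q s₁ T₂ s₂ → Exec ω (.seq P Q) s (T₁ + T₂) s₂
  | ite_true {x : ℕ} {P Q : Prog} {s s₁ : Config} {T : ℕ} :
      s.var x ≠ 0 → Exec ω P s T s₁ → Exec ω (.ite x P Q) s (bitCost (s.var x) + T) s₁
  | ite_false {x : ℕ} {P Q : Prog} {s s₁ : Config} {T : ℕ} :
      s.var x = 0 → Exec ω Q s T s₁ → Exec ω (.ite x P Q) s (bitCost (s.var x) + T) s₁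
  | loop_true {x : ℕ} {P : Prog} {s s₁ s₂ : Config} {T₁ T₂ : ℕ} :
      s.var x ≠ 0 → Exec ω P s T₁ s₁ → Exec ω (.loop x P) s₁ T₂ s₂ →
      Exec ω (.loop x P) s (bitCost (s.var x) + T₁ + T₂) s₂
  | loop_false {x : ℕ} {P : Prog} {s : Config} :
      s.var x = 0 → Exec ω (.loop x P) s (bitCost (s.var x)) s

/-- The law of an infinite sequence of independent fair coin flips. -/
noncomputable def coinMeasure : Measure (ℕ → Bool) :=
  Measure.infinitePi fun _ => (PMF.uniformOfFintype Bool).toMeasure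

/-! ### The input of the machine -/

/-- A gate as a list of numbers: its kind, followed by the index of the variable, or the sign and
the absolute value of the constant, or the number and the list of the incoming gates. -/
def Gate.encode {n i : ℕ} : Gate n i → List ℕ
  | .var j => [0, j.1]
  | .const c => [1, if c < 0 then 1 else 0, c.natAbs]
  | .add l => 2 :: l.length :: l.map Fin.val
  | .mul l => 3 :: l.length :: l.map Fin.val

/-- The instance `(C, k)` as a list of numbers. -/
def Circuit.encode {n : ℕ} (C : Circuit n) (k : ℕ) : List ℕ :=
  [n, k, C.numGates, C.out.1] ++ (List.ofFn fun i => (C.gate i).encode).flatten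

/-- The initial configuration on the instance `(C, k)`: the memory holds the instance, one number
per cell, followed by zeros; all variables are zero. -/
def Circuit.init {n : ℕ} (C : Circuit n) (k : ℕ) : Config where
  var := fun _ => 0
  mem := fun a => (C.encode k).getD a 0
  coins := 0

/-- With coin flips `ω`, the program halts on `(C, k)` and accepts, that is, variable `0` has the
final value `1`.  (A halting run with any other final value rejects.) -/
def Accepts (P : Prog) {n : ℕ} (C : Circuit n) (k : ℕ) (ω : ℕ → Bool) : Prop :=
  ∃ T s, Exec ω P (C.init k) T s ∧ s.var 0 = 1

/-- With coin flips `ω`, the program halts on `(C, k)` within time at most `B`. -/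
def HaltsWithin (P : Prog) {n : ℕ} (C : Circuit n) (k : ℕ) (ω : ℕ → Bool) (B : ℝ) : Prop :=
  ∃ T s, Exec ω P (C.init k) T s ∧ (T : ℝ) ≤ B

/-! ### Reasoning about programs -/

section Framework

variable {ω : ℕ → Bool}

/-! The method is color coding combined with inclusion–exclusion over sets of colors. Color the
variables with `t = 13 * q` colors, `q = k / 10 + 1`. For a set `A` of colors, evaluate the circuit
with each variable `j` replaced by `x j * p` if its color lies in `A` and by `0` otherwise. A
monomial with color set `T` survives exactly when `T ⊆ A`. Weighted by `(-1) ^ (t - |A|)` times the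
falling factorial of `|A|` of length `t - k`, the sum over `A` annihilates all monomials of degree
at most `k` except those of degree `k` with `k` different colors, which get the factor `(t - k)!`
(`sum_color_weights`). Such monomials are multilinear. Since every variable carries a factor `p`,
monomials of degree above `k` vanish modulo `p ^ (k + 1)`. Hence the weighted sum is `p ^ k * (t -
k)! * Q(x)` modulo `p ^ (k + 1)`, where `Q` is the rainbow part of the polynomial, and it is nonzero
exactly when `p` does not divide `(t - k)! * Q(x)` (`trialSum_mod_ne_zero_iff`). Without a
multilinear term `Q = 0` for every coloring, so there are no false positives.

If there is a multilinear term, a random coloring is injective on its support with probability at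
least `1 / ((t + 1) * 271 ^ q)` (`colors_pow_le_mul_descFactorial`). One random number `x j`
supplies both the color, as its residue modulo `t`, and the value to substitute. For a fixed good
coloring, Schwartz–Zippel on the numbers with these residues makes `Q(x) ≠ 0` at least half of the
time. Finally a random `p < 2 ^ B + 1` need not be prime: it suffices that a fraction `1 / (2 * B)`
of all choices does not divide the integer in question, and the primes provide this
(`two_pow_le_mul_card_not_dvd`). Here `B` must be adapted to the size of `Q(x)`, which can be doubly
exponential in the depth. The machine therefore first computes, gate by gate, a number `u` such that
`2 ^ 2 ^ u` is a bound (`heightInterp`).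

A trial costs `2 ^ t` evaluations of the circuit on numbers of polynomial bit length, and the
inverse success probability times five is the number of trials. Per ten units of `k` the product
grows by `2 ^ 13 * 271`, which is at most `4.32 ^ 10`.

Machine level: registers are ordered by lifetime, so that one inequality `SameBelow θ` is a frame
condition. Register 0 is the verdict; 1 to 11 hold `n`, `k`, the number of gates, the output gate,
`t`, the input length, the address of the random numbers, `e`, `B`, and the constants 1 and 2; 12
counts trials; 13 to 16 hold `p`, the modulus, the running sum and `A`; those from 20 on are
scratch. -/

theorem Exec.det {P : Prog} {s s₁ s₂ : Config} {T₁ T₂ : ℕ} (h₁ : Exec ω P s T₁ s₁)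
    (h₂ : Exec ω P s T₂ s₂) : T₁ = T₂ ∧ s₁ = s₂ := by
  induction h₁ generalizing T₂ s₂ with
  | skip | const | arith | load | store | flip => cases h₂; exact ⟨rfl, rfl⟩
  | seq _ _ ih₁ ih₂ =>
    cases h₂ with
    | seq a b =>
      obtain ⟨rfl, rfl⟩ := ih₁ a
      obtain ⟨rfl, rfl⟩ := ih₂ b
      exact ⟨rfl, rfl⟩
  | ite_true h _ ih =>
    cases h₂ with
    | ite_true _ a => obtain ⟨rfl, rfl⟩ := ih a; exact ⟨rfl, rfl⟩
    | ite_false h' _ => exact absurd h' h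
  | ite_false h _ ih =>
    cases h₂ with
    | ite_false _ a => obtain ⟨rfl, rfl⟩ := ih a; exact ⟨rfl, rfl⟩
    | ite_true h' _ => exact absurd h h'
  | loop_true h _ _ ih₁ ih₂ =>
    cases h₂ with
    | loop_true _ a b =>
      obtain ⟨rfl, rfl⟩ := ih₁ a
      obtain ⟨rfl, rfl⟩ := ih₂ b
      exact ⟨rfl, rfl⟩
    | loop_false h' => exact absurd h' h
  | loop_false h =>
    cases h₂ with
    | loop_false _ => exact ⟨rfl, rfl⟩
    | loop_true h' _ _ => exact absurd h h'

/-- `WP ω P s Q`: the program `P` started in `s` halts, and its running time and its final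
configuration satisfy `Q`. -/
def WP (ω : ℕ → Bool) : Prog → Config → (ℕ → Config → Prop) → Prop
  | .skip, s, Q => Q 1 s
  | .const x c, s, Q => Q (bitCost c) (s.setVar x c)
  | .arith x o y z, s, Q =>
      Q (bitCost (s.var y) + bitCost (s.var z)) (s.setVar x (o.eval (s.var y) (s.var z)))
  | .load x y, s, Q =>
      Q (bitCost (s.var y) + bitCost (s.mem (s.var y))) (s.setVar x (s.mem (s.var y)))
  | .store x y, s, Q =>
      Q (bitCost (s.var x) + bitCost (s.var y)) (s.setMem (s.var x) (s.var y))
  | .flip x, s, Q =>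
      Q 1 { s.setVar x (if ω s.coins then 1 else 0) with coins := s.coins + 1 }
  | .seq P₁ P₂, s, Q => WP ω P₁ s fun T₁ s₁ => WP ω P₂ s₁ fun T₂ s₂ => Q (T₁ + T₂) s₂
  | .ite x P₁ P₂, s, Q =>
      (s.var x ≠ 0 → WP ω P₁ s fun T s' => Q (bitCost (s.var x) + T) s') ∧
      (s.var x = 0 → WP ω P₂ s fun T s' => Q (bitCost (s.var x) + T) s')
  | .loop x P, s, Q => ∃ T s', Exec ω (.loop x P) s T s' ∧ Q T s'

theorem WP.exec {P : Prog} {s : Config} {Q : ℕ → Config → Prop} (h : WP ω P s Q) :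
    ∃ T s', Exec ω P s T s' ∧ Q T s' := by
  induction P generalizing s Q with
  | skip => exact ⟨_, _, .skip s, h⟩
  | const => exact ⟨_, _, .const _ _ s, h⟩
  | arith => exact ⟨_, _, .arith _ _ _ _ s, h⟩
  | load => exact ⟨_, _, .load _ _ s, h⟩
  | store => exact ⟨_, _, .store _ _ s, h⟩
  | flip => exact ⟨_, _, .flip _ s, h⟩
  | seq P₁ P₂ ih₁ ih₂ =>
    obtain ⟨T₁, s₁, e₁, h₁⟩ := ih₁ h
    obtain ⟨T₂, s₂, e₂, h₂⟩ := ih₂ h₁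
    exact ⟨_, _, .seq e₁ e₂, h₂⟩
  | ite x P₁ P₂ ih₁ ih₂ =>
    by_cases hx : s.var x = 0
    · obtain ⟨T, s', e, h'⟩ := ih₂ (h.2 hx)
      exact ⟨_, _, .ite_false hx e, h'⟩
    · obtain ⟨T, s', e, h'⟩ := ih₁ (h.1 hx)
      exact ⟨_, _, .ite_true hx e, h'⟩
  | loop => exact h

theorem Exec.wp {P : Prog} {s s' : Config} {T : ℕ} (e : Exec ω P s T s')
    {Q : ℕ → Config → Prop} (h : Q T s') : WP ω P s Q := by
  induction P generalizing s s' T Q with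
  | seq P₁ P₂ ih₁ ih₂ => cases e with | seq a b => exact ih₁ a (ih₂ b h)
  | ite x P₁ P₂ ih₁ ih₂ =>
    cases e with
    | ite_true hx a => exact ⟨fun _ => ih₁ a h, fun h' => absurd h' hx⟩
    | ite_false hx a => exact ⟨fun h' => absurd hx h', fun _ => ih₂ a h⟩
  | loop => exact ⟨_, _, e, h⟩
  | _ => cases e; exact h

/-- At a loop `WP` unfolds to the existential on the right. Rewriting backwards after symbolic
execution restores a `WP` goal to which the loop rules apply. -/
theorem wp_iff {P : Prog} {s : Config} {Q : ℕ → Config → Prop} :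
    WP ω P s Q ↔ ∃ T s', Exec ω P s T s' ∧ Q T s' :=
  ⟨WP.exec, fun ⟨_, _, e, h⟩ => e.wp h⟩

theorem WP.mono {P : Prog} {s : Config} {Q Q' : ℕ → Config → Prop} (h : WP ω P s Q)
    (hQ : ∀ T s', Q T s' → Q' T s') : WP ω P s Q' := by
  obtain ⟨T, s', e, h'⟩ := h.exec
  exact e.wp (hQ _ _ h')

theorem WP.seq {P₁ P₂ : Prog} {s : Config} {Q₁ : ℕ → Config → Prop} {Q : ℕ → Config → Prop}
    (h : WP ω P₁ s Q₁) (h₂ : ∀ T₁ s₁, Q₁ T₁ s₁ → WP ω P₂ s₁ fun T₂ s₂ => Q (T₁ + T₂) s₂) :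
    WP ω (.seq P₁ P₂) s Q :=
  h.mono h₂

/-- The rule for loops with `N` iterations, where `I i` holds before iteration `i`. -/
theorem wp_loop {x : ℕ} {P : Prog} {N : ℕ} (I : ℕ → Config → Prop) (cost : ℕ → ℕ)
    (hstep : ∀ i < N, ∀ s, I i s → s.var x ≠ 0 ∧
      WP ω P s fun T s' => bitCost (s.var x) + T ≤ cost i ∧ I (i + 1) s')
    (hend : ∀ s, I N s → s.var x = 0) {s : Config} (h0 : I 0 s) :
    WP ω (.loop x P) s fun T s' => T ≤ ∑ i ∈ Finset.range N, cost i + 1 ∧ I N s' := by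
  -- Induction on the number `m` of remaining iterations, so that the first one can be peeled off.
  -- The final `+ 1` pays for the failing test, since `bitCost 0 = 1`.
  suffices H : ∀ m i s, i + m = N → I i s → ∃ T s', Exec ω (.loop x P) s T s' ∧
      T ≤ ∑ j ∈ Finset.Ico i N, cost j + 1 ∧ I N s' by
    obtain ⟨T, s', e, hT, hs⟩ := H N 0 s (zero_add N) h0
    exact e.wp ⟨by simpa using hT, hs⟩
  intro m
  induction m with
  | zero =>
    rintro i s rfl hi
    have := hend s hi
    refine ⟨_, _, .loop_false this, ?_, hi⟩
    simp [this, bitCost]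
  | succ m ih =>
    intro i s hm hi
    obtain ⟨hx, h⟩ := hstep i (by omega) s hi
    obtain ⟨T₁, s₁, e₁, hT₁, hi₁⟩ := h.exec
    obtain ⟨T₂, s₂, e₂, hT₂, hi₂⟩ := ih (i + 1) s₁ (by omega) hi₁
    refine ⟨_, _, .loop_true hx e₁ e₂, ?_, hi₂⟩
    rw [Finset.sum_eq_sum_Ico_succ_bot (by omega)]
    omega

/-- The rule for loops whose iterations have a common time bound. -/
theorem wp_loop_const {x : ℕ} {P : Prog} {N : ℕ} (I : ℕ → Config → Prop) (c : ℕ)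
    (hstep : ∀ i < N, ∀ s, I i s → s.var x ≠ 0 ∧
      WP ω P s fun T s' => bitCost (s.var x) + T ≤ c ∧ I (i + 1) s')
    (hend : ∀ s, I N s → s.var x = 0) {s : Config} (h0 : I 0 s) :
    WP ω (.loop x P) s fun T s' => T ≤ N * c + 1 ∧ I N s' := by
  simpa using wp_loop I (fun _ => c) hstep hend h0

/-! ### Updates of configurations and frame conditions -/

@[simp] theorem Config.setVar_var (s : Config) (x v y : ℕ) :
    (s.setVar x v).var y = if y = x then v else s.var y := by
  simp [Config.setVar, Function.update_apply]

@[simp] theorem Config.setVar_mem (s : Config) (x v : ℕ) : (s.setVar x v).mem = s.mem := rfl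

@[simp] theorem Config.setVar_coins (s : Config) (x v : ℕ) : (s.setVar x v).coins = s.coins := rfl

@[simp] theorem Config.setMem_var (s : Config) (a v : ℕ) : (s.setMem a v).var = s.var := rfl

@[simp] theorem Config.setMem_mem (s : Config) (a v b : ℕ) :
    (s.setMem a v).mem b = if b = a then v else s.mem b := by
  simp [Config.setMem, Function.update_apply]

@[simp] theorem Config.setMem_coins (s : Config) (a v : ℕ) : (s.setMem a v).coins = s.coins := rfl

/-- Two configurations agree on the variables below `θ`. -/
def Config.SameBelow (θ : ℕ) (s s' : Config) : Prop := ∀ x < θ, s'.var x = s.var x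

theorem Config.SameBelow.trans {θ : ℕ} {s s' s'' : Config} (h : s.SameBelow θ s')
    (h' : s'.SameBelow θ s'') : s.SameBelow θ s'' := fun x hx => (h' x hx).trans (h x hx)

@[simp] theorem Config.SameBelow.refl {θ : ℕ} (s : Config) : s.SameBelow θ s := fun _ _ => rfl

theorem Config.SameBelow.setVar {θ x v : ℕ} {s s' : Config} (h : s.SameBelow θ s') (hx : θ ≤ x) :
    s.SameBelow θ (s'.setVar x v) := fun y hy => by
  rw [setVar_var, if_neg (by omega), h y hy]

@[simp] theorem Config.sameBelow_setVar {θ x v : ℕ} {s s' : Config} (hx : θ ≤ x) :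
    s.SameBelow θ (s'.setVar x v) ↔ s.SameBelow θ s' :=
  ⟨fun h y hy => by rw [← h y hy, setVar_var, if_neg (by omega)], fun h => h.setVar hx⟩

@[simp] theorem Config.sameBelow_setMem {θ a v : ℕ} {s s' : Config} :
    s.SameBelow θ (s'.setMem a v) ↔ s.SameBelow θ s' := Iff.rfl

theorem Config.SameBelow.mono {θ θ' : ℕ} {s s' : Config} (h : s.SameBelow θ s') (hθ : θ' ≤ θ) :
    s.SameBelow θ' s' := fun x hx => h x (hx.trans_le hθ)

end Framework

/-! ### Bit lengths -/

theorem bitCost_le {a L : ℕ} (h : a < 2 ^ L) : bitCost a ≤ L + 1 := by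
  simpa [bitCost] using Nat.size_le.2 h

theorem bitCost_mono {a b : ℕ} (h : a ≤ b) : bitCost a ≤ bitCost b :=
  Nat.succ_le_succ (Nat.size_le_size h)

@[simp] theorem bitCost_zero : bitCost 0 = 1 := by simp [bitCost]

@[simp] theorem bitCost_one : bitCost 1 = 2 := by simp [bitCost]

@[simp] theorem bitCost_two : bitCost 2 = 3 := by decide

theorem bitCost_le_self (a : ℕ) : bitCost a ≤ a + 1 := bitCost_le Nat.lt_two_pow_self

theorem bitCost_add_le (a b : ℕ) : bitCost (a + b) ≤ bitCost a + bitCost b := by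
  have ha := Nat.lt_size_self a
  have hb := Nat.lt_size_self b
  suffices Nat.size (a + b) ≤ a.size + b.size + 1 by simp only [bitCost]; omega
  rw [Nat.size_le]
  have h1 : 2 ^ a.size ≤ 2 ^ (a.size + b.size) := by gcongr <;> omega
  have h2 : 2 ^ b.size ≤ 2 ^ (a.size + b.size) := by gcongr <;> omega
  rw [pow_succ]; omega

theorem bitCost_mul_le (a b : ℕ) : bitCost (a * b) ≤ bitCost a + bitCost b := by
  suffices Nat.size (a * b) ≤ a.size + b.size by simp only [bitCost]; omega
  rw [Nat.size_le, pow_add]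
  exact Nat.mul_lt_mul'' (Nat.lt_size_self a) (Nat.lt_size_self b)

theorem bitCost_sub_le (a b : ℕ) : bitCost (a - b) ≤ bitCost a := bitCost_mono (Nat.sub_le a b)

theorem bitCost_div_le (a b : ℕ) : bitCost (a / b) ≤ bitCost a := bitCost_mono (Nat.div_le_self a b)

local infixr:60 ";;" => Prog.seq

/-! ### Traversing the circuit -/

/-- An interpretation of the gates of a circuit by natural numbers. A gate with a list of incoming
wires folds `step op` over the values of its wires, starting with `op`, where `op` is `0` for sums
and `1` for products, and then applies `fin` to its number of wires and the result. -/
structure Interp where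
  var : ℕ → ℕ
  const : ℕ → ℕ → ℕ
  step : ℕ → ℕ → ℕ → ℕ
  fin : ℕ → ℕ → ℕ

/-- The value at gate `i` under an interpretation. -/
def Circuit.value (I : Interp) {n : ℕ} (C : Circuit n) (i : ℕ) (hi : i < C.numGates) : ℕ :=
  match C.gate ⟨i, hi⟩ with
  | .var j => I.var j
  | .const c => I.const (if c < 0 then 1 else 0) c.natAbs
  | .add l => I.fin l.length
      ((l.map fun j : Fin i => C.value I j.1 (j.2.trans hi)).foldl (I.step 0) 0)
  | .mul l => I.fin l.length
      ((l.map fun j : Fin i => C.value I j.1 (j.2.trans hi)).foldl (I.step 1) 1)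
termination_by i
decreasing_by all_goals exact j.2

/-- The value at gate `i` under an interpretation, and `0` if there is no such gate. -/
def Circuit.val (I : Interp) {n : ℕ} (C : Circuit n) (i : ℕ) : ℕ :=
  if hi : i < C.numGates then C.value I i hi else 0

/-! ### Addresses of the gates in the encoded input -/

section Encoding

variable {n : ℕ} (C : Circuit n)

/-- The list of numbers that encodes gate `i`. -/
def Circuit.code (i : ℕ) : List ℕ :=
  if hi : i < C.numGates then (C.gate ⟨i, hi⟩).encode else []

/-- The address of the encoding of gate `i`. -/
def Circuit.offset (i : ℕ) : ℕ := 4 + ∑ j ∈ Finset.range i, (C.code j).length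

/-- The length of the input. -/
def Circuit.len : ℕ := C.offset C.numGates

theorem Circuit.offset_succ (i : ℕ) : C.offset (i + 1) = C.offset i + (C.code i).length := by
  simp [offset, Finset.sum_range_succ, add_assoc]

theorem Circuit.offset_le_len {i : ℕ} (hi : i ≤ C.numGates) : C.offset i ≤ C.len := by
  unfold len offset
  gcongr

theorem flatten_getD {α : Type*} (f : ℕ → List α) (d : α) {i r : ℕ} :
    ∀ N, i < N → r < (f i).length →
      ((List.range N).map f).flatten.getD (∑ j ∈ Finset.range i, (f j).length + r) d =
        (f i).getD r d := by
  intro N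
  have hlen : ∀ N, ((List.range N).map f).flatten.length = ∑ j ∈ Finset.range N, (f j).length := by
    intro N
    induction N with
    | zero => simp
    | succ N ih => simp [List.range_succ, Finset.sum_range_succ, ← ih]
  induction N with
  | zero => simp
  | succ N ih =>
    intro hi hr
    rw [List.range_succ, List.map_append, List.flatten_append]
    rcases Nat.lt_succ_iff_lt_or_eq.1 hi with h | rfl
    · rw [List.getD_append, ih h hr]
      rw [hlen]
      calc _ < ∑ j ∈ Finset.range (i + 1), (f j).length := by
            rw [Finset.sum_range_succ]; omega
        _ ≤ _ := Finset.sum_le_sum_of_subset (by simpa using h)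
    · rw [List.getD_append_right _ _ _ _ (by rw [hlen]; omega), hlen]
      simp

theorem Circuit.encode_eq (k : ℕ) : C.encode k =
    [n, k, C.numGates, C.out.1] ++ ((List.range C.numGates).map C.code).flatten := by
  unfold encode
  congr 2
  apply List.ext_getElem
  · simp
  · intro i h₁ h₂
    simp at h₁
    have : (List.range C.numGates)[i]'(by simpa using h₁) = i := by simp
    rw [List.getElem_ofFn, List.getElem_map, this, code, dif_pos h₁]

theorem Circuit.encode_getD (k : ℕ) {i r : ℕ} (hi : i < C.numGates) (hr : r < (C.code i).length) :
    (C.encode k).getD (C.offset i + r) 0 = (C.code i).getD r 0 := by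
  rw [encode_eq, List.getD_append_right _ _ _ _ (by simp [offset]; omega),
    ← flatten_getD C.code 0 C.numGates hi hr]
  congr 1
  simp [offset]
  omega

theorem Circuit.sum_weight : ∑ i ∈ Finset.range C.numGates,
    (if hi : i < C.numGates then (C.gate ⟨i, hi⟩).weight else 0) = C.size := by
  rw [size, Finset.sum_range]
  simp

/-- The factor 3 is attained by the constant zero, which occupies three cells and has weight one. -/
theorem Gate.length_encode_le {n i : ℕ} (g : Gate n i) : g.encode.length ≤ 3 * g.weight := by
  cases g <;> simp [encode, weight] <;> omega

theorem Gate.one_le_weight {n i : ℕ} (g : Gate n i) : 1 ≤ g.weight := by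
  cases g <;> simp [weight]

theorem Circuit.len_le : C.len ≤ 4 + 3 * C.size := by
  rw [len, offset, ← sum_weight, Finset.mul_sum]
  gcongr with i hi
  simp at hi
  simpa [code, hi] using Gate.length_encode_le _

theorem Circuit.weight_le (i : Fin C.numGates) : (C.gate i).weight ≤ C.size :=
  Finset.single_le_sum (f := fun i => (C.gate i).weight) (fun _ _ => Nat.zero_le _)
    (Finset.mem_univ i)

theorem Circuit.numGates_le : C.numGates ≤ C.size := by
  rw [size]
  calc C.numGates = ∑ i : Fin C.numGates, 1 := by simp
    _ ≤ _ := Finset.sum_le_sum fun i _ => Gate.one_le_weight _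

end Encoding

/-- The part of `traversal` that handles the next wire. -/
def wire (step : Prog) : Prog :=
  .load 26 20 ;; .arith 20 .add 20 10 ;; .arith 26 .add 26 6 ;; .load 26 26 ;; step ;;
  .arith 27 .sub 27 10

/-- The part of `traversal` that computes the value of the next gate. -/
def evalGate (leafVar leafConst step fin : Prog) : Prog :=
  .load 23 20 ;; .arith 20 .add 20 10 ;; .load 25 20 ;; .arith 20 .add 20 10 ;;
  .ite 23
    (.arith 23 .sub 23 10 ;;
      .ite 23
        (.arith 23 .sub 23 10 ;; .arith 24 .mul 23 10 ;; .arith 27 .mul 25 10 ;;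
          .loop 27 (wire step) ;; fin)
        (.load 26 20 ;; .arith 20 .add 20 10 ;; leafConst))
    leafVar

/-- The part of `traversal` that handles the next gate. -/
def gateProg (leafVar leafConst step fin : Prog) : Prog :=
  evalGate leafVar leafConst step fin ;;
  .store 22 24 ;; .arith 22 .add 22 10 ;; .arith 21 .sub 21 10

/-- Compute the values of all gates and write them to the memory. -/
def traversal (leafVar leafConst step fin : Prog) : Prog :=
  .const 20 4 ;; .arith 22 .mul 6 10 ;; .arith 21 .mul 3 10 ;;
  .loop 21 (gateProg leafVar leafConst step fin)

/-- The configuration `s` arises from `s₀` by changing temporary variables and the cells that hold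
the values of the gates. -/
def Config.Extends (s₀ s : Config) : Prop :=
  s₀.SameBelow 20 s ∧
    ∀ a, a < s₀.var 6 ∨ s₀.var 6 + s₀.var 3 ≤ a → s.mem a = s₀.mem a

/-- The programs implement the interpretation `I`. -/
structure Implements (ω : ℕ → Bool) (n : ℕ) (s₀ : Config) (I : Interp)
    (leafVar leafConst step fin : Prog) (c L : ℕ) : Prop where
  one : s₀.var 10 = 1
  var : ∀ s, s₀.Extends s → s.var 25 < n →
    WP ω leafVar s fun T s' => T ≤ c ∧ s'.var 24 = I.var (s.var 25) ∧ s'.mem = s.mem ∧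
      s'.coins = s.coins ∧ s.SameBelow 24 s'
  const : ∀ s, s₀.Extends s → s.var 25 ≤ 1 → Nat.size (Nat.size (s.var 26)) ≤ L →
    WP ω leafConst s fun T s' => T ≤ c * (1 + Nat.size (s.var 26)) ∧
      s'.var 24 = I.const (s.var 25) (s.var 26) ∧ s'.mem = s.mem ∧
      s'.coins = s.coins ∧ s.SameBelow 24 s'
  step : ∀ s, s₀.Extends s → s.var 23 ≤ 1 → bitCost (s.var 24) ≤ L → bitCost (s.var 26) ≤ L →
    WP ω step s fun T s' => T ≤ c ∧
      s'.var 24 = I.step (s.var 23) (s.var 24) (s.var 26) ∧ s'.mem = s.mem ∧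
      s'.coins = s.coins ∧ s.SameBelow 24 s' ∧ s'.var 25 = s.var 25 ∧ s'.var 27 = s.var 27
  fin : ∀ s, s₀.Extends s → bitCost (s.var 24) ≤ L → bitCost (s.var 25) ≤ L →
    WP ω fin s fun T s' => T ≤ c ∧
      s'.var 24 = I.fin (s.var 25) (s.var 24) ∧ s'.mem = s.mem ∧
      s'.coins = s.coins ∧ s.SameBelow 24 s'
  step_le : ∀ op a v, op ≤ 1 → bitCost a ≤ L → bitCost v ≤ L → bitCost (I.step op a v) ≤ L

theorem Config.Extends.trans {s₀ s s' : Config} (h : s₀.Extends s) (h' : s.SameBelow 20 s')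
    (hm : s'.mem = s.mem) : s₀.Extends s' :=
  ⟨h.1.trans h', fun a ha => by rw [hm, h.2 a ha]⟩

/-- After `i` wires the accumulator is the fold over the first `i` values. It never outgrows `L`
bits, because `Implements.step_le` makes this bound stable under one step; so every wire has the
same cost bound. -/
theorem wires_spec {ω : ℕ → Bool} {n : ℕ} {s₀ : Config} {I : Interp}
    {leafVar leafConst step fin : Prog} {c L : ℕ}
    (H : Implements ω n s₀ I leafVar leafConst step fin c L) (hL : 3 ≤ L) {s : Config}
    (hs : s₀.Extends s) (l : List ℕ) (f : ℕ → ℕ) (hlen : s.var 27 = l.length)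
    (hop : s.var 23 ≤ 1) (hacc : bitCost (s.var 24) ≤ L)
    (hl : ∀ r (hr : r < l.length), s.mem (s.var 20 + r) = l[r])
    (hf : ∀ j ∈ l, s.mem (s₀.var 6 + j) = f j)
    (hfL : ∀ j ∈ l, bitCost (f j) ≤ L ∧ bitCost (s₀.var 6 + j) ≤ L)
    (hptr : bitCost (s.var 20 + l.length) ≤ L) :
    WP ω (.loop 27 (wire step)) s fun T s' => T ≤ l.length * (c + 14 * L) + 1 ∧
      s'.var 24 = (l.map f).foldl (I.step (s.var 23)) (s.var 24) ∧ bitCost (s'.var 24) ≤ L ∧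
      s'.mem = s.mem ∧ s'.coins = s.coins ∧ s.SameBelow 20 s' ∧
      s'.var 20 = s.var 20 + l.length ∧ s'.var 21 = s.var 21 ∧ s'.var 22 = s.var 22 ∧
      s'.var 23 = s.var 23 ∧ s'.var 25 = s.var 25 := by
  refine (wp_loop_const (N := l.length) (fun i s' =>
    s'.var 24 = ((l.take i).map f).foldl (I.step (s.var 23)) (s.var 24) ∧ bitCost (s'.var 24) ≤ L ∧
      s'.mem = s.mem ∧ s'.coins = s.coins ∧ s.SameBelow 20 s' ∧
      s'.var 20 = s.var 20 + i ∧ s'.var 21 = s.var 21 ∧ s'.var 22 = s.var 22 ∧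
      s'.var 23 = s.var 23 ∧ s'.var 25 = s.var 25 ∧ s'.var 27 = l.length - i)
      (c + 14 * L) ?_ ?_ ?_).mono ?_
  · rintro i hi s₁ ⟨h24, hb, hm, hc, hsame, h20, h21, h22, h23, h25, h27⟩
    have h10 : s₁.var 10 = 1 := by rw [hsame 10 (by norm_num), hs.1 10 (by norm_num), H.one]
    have h6 : s₁.var 6 = s₀.var 6 := by rw [hsame 6 (by norm_num), hs.1 6 (by norm_num)]
    refine ⟨by omega, ?_⟩
    have hmem : l[i] ∈ l := List.getElem_mem hi
    obtain ⟨hfL1, hfL2⟩ := hfL _ hmem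
    have e1 := hl i hi
    have e2 : s.mem (l[i] + s₀.var 6) = f l[i] := by rw [add_comm, hf _ hmem]
    simp only [wire, WP, Arith.eval, Config.setVar_var, Config.setVar_mem, h10, hm, h20, e1, h6,
      reduceIte, Nat.reduceEqDiff, e2]
    refine (H.step _ ?_ ?_ ?_ ?_).mono ?_
    · refine ⟨?_, by simpa [hm] using hs.2⟩
      intro v hv
      simp [hsame v hv, hs.1 v hv]
      grind
    · simpa [h23] using hop
    · simpa using hb
    · simpa using hfL1
    · rintro T s₂ ⟨hT, g24, gm, gc, gs, g25, g27⟩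
      simp at g24 gm gc g25 g27
      have g10 : s₂.var 10 = 1 := by rw [gs 10 (by norm_num)]; simp [h10]
      have b1 : bitCost (s.var 20 + i) ≤ L := (bitCost_mono (by omega)).trans hptr
      have b2 : bitCost (l.length - i) ≤ L := (bitCost_mono (by omega)).trans hptr
      have b3 : bitCost l[i] ≤ L := (bitCost_mono (by omega)).trans hfL2
      have b4 : bitCost (s₀.var 6) ≤ L := (bitCost_mono (by omega)).trans hfL2
      have b5 : bitCost (l[i] + s₀.var 6) ≤ L := by rwa [add_comm]
      refine ⟨?_, ?_⟩
      · simp [g27, g10, h27]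
        omega
      · simp only [Config.setVar_coins]
        have hstep : s₂.var 24 = ((l.take (i + 1)).map f).foldl (I.step (s.var 23)) (s.var 24) := by
          rw [g24, List.take_add_one, List.getElem?_eq_getElem hi]
          simp only [Option.toList_some, List.map_append, List.map_cons, List.map_nil,
            List.foldl_append, List.foldl_cons, List.foldl_nil, ← h24, h23]
        refine ⟨by simpa using hstep, ?_, by simp [gm, hm], by simp [gc, hc], ?_, ?_⟩
        · simp [g24]
          exact H.step_le _ _ _ (by omega) hb hfL1
        · intro v hv
          simp [gs v (by omega), hsame v hv]
          grind
        · have e20 := gs 20 (by norm_num)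
          have e21 := gs 21 (by norm_num)
          have e22 := gs 22 (by norm_num)
          have e23 := gs 23 (by norm_num)
          simp at e20 e21 e22 e23
          simp [e20, e21, e22, e23, g25, g27, h21, h22, h23, h25, h27, g10]
          omega
  · rintro s' h
    simp only [h, Nat.sub_self]
  · simp [hacc, hlen, Config.SameBelow.refl]
  · rintro T s' ⟨hT, h24, hb, hm, hc, hsame, h20, h21, h22, h23, h25, -⟩
    exact ⟨hT, by simpa using h24, hb, hm, hc, hsame, h20, h21, h22, h23, h25⟩

theorem Circuit.mem_code {n : ℕ} (C : Circuit n) {s : Config} {k : ℕ}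
    (hmem : ∀ a < C.len, s.mem a = (C.encode k).getD a 0) {i r : ℕ} (hi : i < C.numGates)
    (hr : r < (C.code i).length) : s.mem (C.offset i + r) = (C.code i)[r] := by
  have h1 : C.offset i + r < C.len := by
    have := C.offset_le_len (i := i + 1) hi
    rw [offset_succ] at this
    omega
  rw [hmem _ h1, C.encode_getD k hi hr, List.getD_eq_getElem _ _ hr]

theorem Circuit.code_getElem {n : ℕ} (C : Circuit n) {s₀ s : Config} {k : ℕ}
    (hs : s₀.Extends s) (h6 : s₀.var 6 = C.len)
    (hmem : ∀ a < C.len, s₀.mem a = (C.encode k).getD a 0) {i r : ℕ} (hi : i < C.numGates)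
    (hr : r < (C.code i).length) : s.mem (C.offset i + r) = (C.code i)[r] :=
  C.mem_code (fun a ha => by rw [hs.2 _ (.inl (by omega)), hmem a ha]) hi hr

theorem Circuit.value_eq_val (I : Interp) {n : ℕ} (C : Circuit n) (i : ℕ) (hi : i < C.numGates) :
    C.value I i hi = C.val I i := by simp [val, hi]

/-- Sums and products are handled together: their tags are `2 + op`, so after two decrements
register 23 holds `op`, which is also the neutral element from which the fold starts. -/
theorem evalGate_spec_wires {ω : ℕ → Bool} {n : ℕ} {s₀ : Config} {I : Interp}
    {leafVar leafConst step fin : Prog} {c L k : ℕ} {C : Circuit n}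
    (H : Implements ω n s₀ I leafVar leafConst step fin c L) (hL : 4 ≤ L)
    (h6 : s₀.var 6 = C.len)
    (hmem : ∀ a < C.len, s₀.mem a = (C.encode k).getD a 0)
    (hlen : bitCost (C.len + C.numGates) ≤ L)
    (hval : ∀ i < C.numGates, bitCost (C.val I i) ≤ L)
    {s : Config} (hs : s₀.Extends s) {i : ℕ} (hi : i < C.numGates) (h20 : s.var 20 = C.offset i)
    (hv : ∀ j < i, s.mem (s₀.var 6 + j) = C.val I j)
    {op : ℕ} (hop : op ≤ 1) (l : List (Fin i))
    (hc : C.code i = (2 + op) :: l.length :: l.map Fin.val)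
    (hval_i : C.val I i = I.fin l.length ((l.map fun j => C.val I j.1).foldl (I.step op) op)) :
    WP ω (evalGate leafVar leafConst step fin) s fun T s' => T ≤ (1 + l.length) * (c + 30 * L) ∧
      s'.var 24 = C.val I i ∧ s'.mem = s.mem ∧ s'.coins = s.coins ∧ s.SameBelow 20 s' ∧
      s'.var 20 = C.offset (i + 1) ∧ s'.var 21 = s.var 21 ∧ s'.var 22 = s.var 22 := by
  have hcode := fun r hr => C.code_getElem hs h6 hmem (r := r) hi hr
  have hoff := C.offset_succ i
  have hofflen := C.offset_le_len (i := i + 1) hi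
  have h10 : s.var 10 = 1 := by rw [hs.1 10 (by norm_num), H.one]
  have b1 : bitCost (C.offset i) ≤ L := (bitCost_mono (by omega)).trans hlen
  rw [hc] at hcode hoff
  have e0 : s.mem (C.offset i) = 2 + op := hcode 0 (by simp)
  have e1 : s.mem (C.offset i + 1) = l.length := hcode 1 (by simp)
  simp only [List.length_cons, List.length_map] at hoff
  have b2 : bitCost (C.offset i + 1) ≤ L := (bitCost_mono (by omega)).trans hlen
  have b3 : bitCost l.length ≤ L := (bitCost_mono (by omega)).trans hlen
  have b4 : bitCost (2 + op) ≤ L :=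
    (bitCost_mono (show 2 + op ≤ 3 by omega)).trans ((bitCost_le (L := 2) (by norm_num)).trans
      (by omega))
  have b5 : bitCost op ≤ L := (bitCost_mono (by omega)).trans b4
  have b6 : bitCost (1 + op) ≤ L := (bitCost_mono (by omega)).trans b4
  have e2 : 2 + op - 1 = 1 + op := by omega
  simp only [evalGate, WP, Arith.eval, h10, h20, e0, e1, Config.setVar_var, Config.setVar_mem,
    reduceIte, Nat.reduceEqDiff, e2, ne_eq, Nat.add_eq_zero_iff, OfNat.ofNat_ne_zero, false_and,
    one_ne_zero, not_false_eq_true, forall_const, false_implies, and_true, Nat.add_sub_cancel_left,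
    mul_one]
  refine (wires_spec H (by omega) (s := _) ?_ (l.map Fin.val) (C.val I) ?_ ?_ ?_ ?_ ?_ ?_ ?_).mono ?_
  · exact hs.trans (by simp) (by simp)
  · simp
  · simpa using hop
  · simpa using b5
  · intro r hr
    have := hcode (r + 1 + 1) (by simpa using hr)
    rw [List.getElem_cons_succ, List.getElem_cons_succ] at this
    rw [← this]
    simp
    congr 1
    ring
  · intro j hj
    obtain ⟨j, -, rfl⟩ := List.mem_map.1 hj
    simpa using hv j j.2
  · intro j hj
    obtain ⟨j, -, rfl⟩ := List.mem_map.1 hj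
    exact ⟨hval _ (by omega), (bitCost_mono (by omega)).trans hlen⟩
  · simpa using (bitCost_mono (by omega)).trans hlen
  · rintro T s₁ ⟨hT, g24, gb, gm, gc, gs, g20, g21, g22, g23, g25⟩
    simp at g24 gm gc g20 g21 g22 g23 g25 hT
    refine (H.fin _ ?_ gb (by rwa [g25])).mono ?_
    · exact hs.trans (Config.SameBelow.trans (by simp) gs) gm
    · rintro T' s₂ ⟨hT', k24, km, kc, ks⟩
      have k20 := ks 20 (by norm_num)
      have k21 := ks 21 (by norm_num)
      have k22 := ks 22 (by norm_num)
      refine ⟨?_, ?_, km.trans gm, kc.trans gc, ?_, ?_, k21.trans g21, k22.trans g22⟩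
      · have : l.length * (c + 14 * L) ≤ l.length * (c + 30 * L) := by gcongr; norm_num
        simp only [bitCost_one, add_mul, one_mul] at *
        omega
      · rw [k24, g24, g25, hval_i]
        simp [Function.comp_def]
      · exact Config.SameBelow.trans (.trans (by simp) gs) (ks.mono (by norm_num))
      · rw [k20, g20, hoff]
        ring

/-- The charge is proportional to the weight of the gate, not just bounded by a common maximum: a
constant pays for its own digits and a wide gate for its own wires. This keeps a traversal linear in
the size of the circuit. -/
theorem evalGate_spec {ω : ℕ → Bool} {n : ℕ} {s₀ : Config} {I : Interp}
    {leafVar leafConst step fin : Prog} {c L k : ℕ} {C : Circuit n}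
    (H : Implements ω n s₀ I leafVar leafConst step fin c L) (hL : 4 ≤ L)
    (h6 : s₀.var 6 = C.len)
    (hmem : ∀ a < C.len, s₀.mem a = (C.encode k).getD a 0)
    (hlen : bitCost (C.len + C.numGates) ≤ L)
    (hval : ∀ i < C.numGates, bitCost (C.val I i) ≤ L) (hn : bitCost n ≤ L)
    (hsize : bitCost C.size ≤ L)
    {s : Config} (hs : s₀.Extends s) {i : ℕ} (hi : i < C.numGates) (h20 : s.var 20 = C.offset i)
    (hv : ∀ j < i, s.mem (s₀.var 6 + j) = C.val I j) :
    WP ω (evalGate leafVar leafConst step fin) s fun T s' =>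
      T ≤ (C.gate ⟨i, hi⟩).weight * (c + 30 * L) ∧
      s'.var 24 = C.val I i ∧ s'.mem = s.mem ∧ s'.coins = s.coins ∧ s.SameBelow 20 s' ∧
      s'.var 20 = C.offset (i + 1) ∧ s'.var 21 = s.var 21 ∧ s'.var 22 = s.var 22 := by
  have hcode := fun r hr => C.code_getElem hs h6 hmem (r := r) hi hr
  have hoff := C.offset_succ i
  have hofflen := C.offset_le_len (i := i + 1) hi
  have h10 : s.var 10 = 1 := by rw [hs.1 10 (by norm_num), H.one]
  have hw : C.val I i = C.value I i hi := (C.value_eq_val I i hi).symm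
  rw [Circuit.value] at hw
  have b1 : bitCost (C.offset i) ≤ L := (bitCost_mono (by omega)).trans hlen
  have hc0 : C.code i = (C.gate ⟨i, hi⟩).encode := by rw [Circuit.code, dif_pos hi]
  cases hg : C.gate ⟨i, hi⟩ with
  | var j =>
    rw [hg] at hw
    have hc : C.code i = [0, j.1] := by rw [hc0, hg]; rfl
    rw [hc] at hcode hoff
    have e0 : s.mem (C.offset i) = 0 := hcode 0 (by simp)
    have e1 : s.mem (C.offset i + 1) = j := hcode 1 (by simp)
    have b2 : bitCost (C.offset i + 1) ≤ L := (bitCost_mono (by simp at hoff; omega)).trans hlen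
    have b3 : bitCost j.1 ≤ L := (bitCost_mono j.2.le).trans hn
    simp [evalGate, WP, Arith.eval, h10, h20, e0, e1, Gate.weight]
    refine (H.var _ ?_ ?_).mono ?_
    · exact hs.trans (by simp) (by simp)
    · simp
    · rintro T s' ⟨hT, g24, gm, gc, gs⟩
      have k20 := gs 20 (by norm_num)
      have k21 := gs 21 (by norm_num)
      have k22 := gs 22 (by norm_num)
      simp at g24 gm gc k20 k21 k22
      refine ⟨by omega, by rw [g24, hw], gm, gc, ?_, ?_, k21, k22⟩
      · exact Config.SameBelow.trans (by simp) (gs.mono (by norm_num))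
      · rw [k20, hoff]
        simp
  | const z =>
    rw [hg] at hw
    have hc : C.code i = [1, if z < 0 then 1 else 0, z.natAbs] := by rw [hc0, hg]; rfl
    rw [hc] at hcode hoff
    have e0 : s.mem (C.offset i) = 1 := hcode 0 (by simp)
    have e1 : s.mem (C.offset i + 1) = if z < 0 then 1 else 0 := hcode 1 (by simp)
    have e2 : s.mem (C.offset i + 1 + 1) = z.natAbs := hcode 2 (by simp)
    simp at hoff
    have b2 : bitCost (C.offset i + 1) ≤ L := (bitCost_mono (by omega)).trans hlen
    have b3 : bitCost (C.offset i + 1 + 1) ≤ L := (bitCost_mono (by omega)).trans hlen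
    have b4 : (if z < 0 then 1 else 0) ≤ 1 := by split <;> omega
    have b5 : bitCost (if z < 0 then 1 else 0) ≤ 2 := (bitCost_mono b4).trans (by simp)
    simp only [evalGate, WP, Arith.eval, h10, h20, e0, e1, e2, Config.setVar_var,
      Config.setVar_mem, reduceIte, Nat.reduceEqDiff, ne_eq, one_ne_zero, not_false_eq_true,
      forall_const, false_implies, and_true, Nat.sub_self, not_true_eq_false, true_and]
    refine (H.const _ ?_ ?_ ?_).mono ?_
    · exact hs.trans (by simp) (by simp)
    · simpa using b4
    · have h1 := C.weight_le ⟨i, hi⟩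
      rw [hg, Gate.weight] at h1
      simpa using (Nat.size_le_size (show Nat.size z.natAbs ≤ C.size by omega)).trans
        ((Nat.le_succ _).trans hsize)
    · rintro T s' ⟨hT, g24, gm, gc, gs⟩
      have k20 := gs 20 (by norm_num)
      have k21 := gs 21 (by norm_num)
      have k22 := gs 22 (by norm_num)
      simp at g24 gm gc k20 k21 k22 hT
      refine ⟨?_, by rw [g24, hw], gm, gc, ?_, ?_, k21, k22⟩
      · simp [Gate.weight]
        have h1 : bitCost z.natAbs = Nat.size z.natAbs + 1 := rfl
        have h2 : Nat.size z.natAbs ≤ Nat.size z.natAbs * L :=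
          Nat.le_mul_of_pos_right _ (by omega)
        have h3 : (1 + Nat.size z.natAbs) * (c + 30 * L) =
          c * (1 + Nat.size z.natAbs) + 30 * L + 30 * (Nat.size z.natAbs * L) := by ring
        omega
      · exact Config.SameBelow.trans (by simp) (gs.mono (by norm_num))
      · rw [k20, hoff]
  | add l =>
    rw [hg] at hw
    exact evalGate_spec_wires H hL h6 hmem hlen hval hs hi h20 hv (op := 0) (by omega) l (by rw [hc0, hg]; rfl) (by simp only [hw, C.value_eq_val])
  | mul l =>
    rw [hg] at hw
    exact evalGate_spec_wires H hL h6 hmem hlen hval hs hi h20 hv (op := 1) (by omega) l (by rw [hc0, hg]; rfl) (by simp only [hw, C.value_eq_val])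

theorem Circuit.one_le_size {n : ℕ} (C : Circuit n) : 1 ≤ C.size :=
  (Nat.one_le_iff_ne_zero.2 (by have := C.out.2; omega)).trans C.numGates_le

theorem traversal_spec {ω : ℕ → Bool} {n : ℕ} {s₀ : Config} {I : Interp}
    {leafVar leafConst step fin : Prog} {c L k : ℕ} {C : Circuit n}
    (H : Implements ω n s₀ I leafVar leafConst step fin c L) (hL : 4 ≤ L)
    (h3 : s₀.var 3 = C.numGates) (h6 : s₀.var 6 = C.len)
    (hmem : ∀ a < C.len, s₀.mem a = (C.encode k).getD a 0)
    (hlen : bitCost (C.len + C.numGates) ≤ L)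
    (hval : ∀ i < C.numGates, bitCost (C.val I i) ≤ L) (hn : bitCost n ≤ L)
    (hsize : bitCost C.size ≤ L) :
    WP ω (traversal leafVar leafConst step fin) s₀ fun T s => T ≤ C.size * (c + 50 * L) ∧
      s₀.Extends s ∧ s.coins = s₀.coins ∧ ∀ j < C.numGates, s.mem (C.len + j) = C.val I j := by
  have b4 : bitCost 4 ≤ 4 := bitCost_le (L := 3) (by norm_num)
  have b6 : bitCost C.len ≤ L := (bitCost_mono (by omega)).trans hlen
  have b3 : bitCost C.numGates ≤ L := (bitCost_mono (by omega)).trans hlen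
  simp only [traversal, WP, Arith.eval, Config.setVar_var, reduceIte, Nat.reduceEqDiff, H.one, h3,
    h6, mul_one, bitCost_one]
  rw [← wp_iff]
  -- The loop rule with unequal costs is needed here: the weights of the gates add up to `C.size`.
  refine (wp_loop (N := C.numGates) (fun i s => s₀.Extends s ∧ s.coins = s₀.coins ∧
    s.var 20 = C.offset i ∧ s.var 21 = C.numGates - i ∧ s.var 22 = C.len + i ∧
    ∀ j < i, s.mem (C.len + j) = C.val I j)
    (fun i => (if hi : i < C.numGates then (C.gate ⟨i, hi⟩).weight else 0) * (c + 40 * L))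
    ?_ ?_ ?_).mono ?_
  · rintro i hi s ⟨hs, hc, h20, h21, h22, hv⟩
    refine ⟨by omega, ?_⟩
    refine WP.seq (evalGate_spec H hL h6 hmem hlen hval hn hsize hs hi h20 (by simpa [h6] using hv)) ?_
    rintro T s₁ ⟨hT, g24, gm, gc, gs, g20, g21, g22⟩
    have h10 : s₁.var 10 = 1 := by rw [gs 10 (by norm_num), hs.1 10 (by norm_num), H.one]
    have b1 : bitCost (C.len + i) ≤ L := (bitCost_mono (by omega)).trans hlen
    have b2 : bitCost (C.numGates - i) ≤ L := (bitCost_mono (by omega)).trans hlen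
    have b5 := hval i hi
    simp only [WP, Arith.eval, Config.setVar_var, Config.setMem_var, Config.setVar_coins,
      Config.setMem_coins, reduceIte, Nat.reduceEqDiff, h10, g24, g22, g21, g20, h22, h21, gc, hc,
      bitCost_one, Config.setVar_mem, Config.setMem_mem, gm]
    refine ⟨?_, ⟨?_, ?_⟩, trivial, trivial, by omega, by omega, ?_⟩
    · rw [dif_pos hi]
      have h1 : L ≤ (C.gate ⟨i, hi⟩).weight * L :=
        Nat.le_mul_of_pos_left _ (Gate.one_le_weight (C.gate ⟨i, hi⟩))
      have h2 : (C.gate ⟨i, hi⟩).weight * (c + 40 * L) = (C.gate ⟨i, hi⟩).weight * (c + 30 * L) +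
        10 * ((C.gate ⟨i, hi⟩).weight * L) := by ring
      omega
    · exact Config.SameBelow.trans hs.1 (by simpa using gs)
    · intro a ha
      simp only [Config.setVar_mem, Config.setMem_mem, gm]
      rw [if_neg (by omega), hs.2 a ha]
    · intro j hj
      rcases Nat.lt_succ_iff_lt_or_eq.1 hj with h | rfl
      · rw [if_neg (by omega), hv j h]
      · rw [if_pos rfl]
  · rintro s ⟨-, -, -, h, -⟩
    omega
  · exact ⟨⟨by simp, by simp⟩, by simp, by simp [Circuit.offset], by simp, by simp, by simp⟩
  · rintro T s ⟨hT, hs, hc, -, -, -, hv⟩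
    refine ⟨?_, hs, hc, hv⟩
    rw [← Finset.sum_mul, C.sum_weight] at hT
    have h1 : L ≤ C.size * L := Nat.le_mul_of_pos_left _ C.one_le_size
    have h2 : C.size * (c + 50 * L) = C.size * (c + 40 * L) + 10 * (C.size * L) := by ring
    omega

/-! ### Bounding the size of the coefficients -/

/-- The interpretation that computes `u` such that `2 ^ 2 ^ u` bounds the value at a gate when the
values of the variables are bounded by `2 ^ 2 ^ e`. -/
def heightInterp (e : ℕ) : Interp where
  var _ := e
  const _ a := Nat.clog 2 (Nat.size a)
  step _ a v := max a v
  fin l a := a + Nat.size l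

def heightVar : Prog := .arith 24 .mul 8 10

/-- Repeated squaring from `2 = 2 ^ 2 ^ 0` until the constant is exceeded; the number of squarings
is the double logarithm. Register 29 holds `a + 1 - 2 ^ 2 ^ i`, which is zero exactly when `a < 2 ^
2 ^ i`. -/
def heightConst : Prog :=
  .const 24 0 ;; .const 28 2 ;; .arith 29 .add 26 10 ;; .arith 29 .sub 29 28 ;;
  .loop 29 (.arith 28 .mul 28 28 ;; .arith 24 .add 24 10 ;; .arith 29 .add 26 10 ;;
    .arith 29 .sub 29 28)

/-- With truncated subtraction, `a + (v - a)` is the maximum. -/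
def heightStep : Prog := .arith 28 .sub 26 24 ;; .arith 24 .add 24 28

/-- The number of halvings until zero is reached is the number of binary digits. -/
def heightFin : Prog :=
  .arith 28 .mul 25 10 ;; .loop 28 (.arith 28 .div 28 11 ;; .arith 24 .add 24 10)

theorem lt_two_pow_two_pow_iff (a i : ℕ) : a < 2 ^ 2 ^ i ↔ Nat.clog 2 (Nat.size a) ≤ i := by
  rw [Nat.clog_le_iff_le_pow (by norm_num), Nat.size_le]

theorem clog_two_le_size (a : ℕ) : Nat.clog 2 a ≤ Nat.size a := by
  rw [Nat.clog_le_iff_le_pow (by norm_num)]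
  exact (Nat.lt_size_self a).le

theorem heightConst_spec {ω : ℕ → Bool} {s : Config} {L : ℕ} (h10 : s.var 10 = 1) (hL : 1 ≤ L)
    (hsize : Nat.size (Nat.size (s.var 26)) ≤ L) :
    WP ω heightConst s fun T s' => T ≤ 40 * L * (1 + Nat.size (s.var 26)) ∧
      s'.var 24 = Nat.clog 2 (Nat.size (s.var 26)) ∧ s'.mem = s.mem ∧
      s'.coins = s.coins ∧ s.SameBelow 24 s' := by
  set a := s.var 26 with ha
  set w := Nat.clog 2 (Nat.size a) with hw
  have hx : bitCost a = 1 + Nat.size a := add_comm _ _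
  have hwL : w ≤ L := (clog_two_le_size _).trans hsize
  have hsz : Nat.size (Nat.size a) ≤ Nat.size a := Nat.size_le.2 Nat.lt_two_pow_self
  have hwx : w ≤ Nat.size a := (clog_two_le_size _).trans hsz
  have b1 := bitCost_add_le a 1
  simp only [heightConst, WP, Arith.eval, Config.setVar_var, reduceIte, Nat.reduceEqDiff, h10,
    ← ha, bitCost_one, bitCost_zero, bitCost_two]
  rw [← wp_iff]
  refine (wp_loop_const (N := w) (fun i s' => s'.mem = s.mem ∧ s'.coins = s.coins ∧
    s.SameBelow 24 s' ∧ s'.var 26 = a ∧ s'.var 24 = i ∧ s'.var 28 = 2 ^ 2 ^ i ∧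
    s'.var 29 = a + 1 - 2 ^ 2 ^ i) (20 * (1 + Nat.size a)) ?_ ?_ ?_).mono ?_
  · rintro i hi s' ⟨hm, hc, hs, h26, h24, h28, h29⟩
    have h10' : s'.var 10 = 1 := by rw [hs 10 (by norm_num), h10]
    -- A squaring happens only while the old power is at most `a`, so no intermediate number has
    -- more than about twice the digits of `a`.
    have hia : 2 ^ 2 ^ i ≤ a := by
      by_contra h
      rw [not_le, lt_two_pow_two_pow_iff] at h
      omega
    refine ⟨by omega, ?_⟩
    have b2 : bitCost (2 ^ 2 ^ i) ≤ bitCost a := bitCost_mono hia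
    have b3 := bitCost_mul_le (2 ^ 2 ^ i) (2 ^ 2 ^ i)
    have b4 : bitCost i ≤ bitCost a := by
      have := bitCost_le_self i
      omega
    have b5 : bitCost (a + 1 - 2 ^ 2 ^ i) ≤ bitCost (a + 1) := bitCost_sub_le _ _
    have e1 : 2 ^ 2 ^ i * 2 ^ 2 ^ i = 2 ^ 2 ^ (i + 1) := by
      rw [← pow_add, pow_succ, mul_two]
    simp [WP, Arith.eval, hm, hc, h26, h24, h28, h29, h10', hs]
    refine ⟨?_, e1, by rw [e1]⟩
    simp only [bitCost_one] at b1
    omega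
  · rintro s' ⟨-, -, -, -, -, -, h⟩
    rw [h, Nat.sub_eq_zero_iff_le]
    exact (lt_two_pow_two_pow_iff a w).2 le_rfl
  · simp [ha]
  · rintro T s' ⟨hT, hm, hc, hs, -, h24, -⟩
    refine ⟨?_, h24, hm, hc, hs⟩
    have h1 : w * (20 * (1 + Nat.size a)) ≤ L * (20 * (1 + Nat.size a)) := by gcongr
    have h2 : 1 + Nat.size a ≤ L * (1 + Nat.size a) := Nat.le_mul_of_pos_left _ hL
    have h3 : L * (20 * (1 + Nat.size a)) = 20 * (L * (1 + Nat.size a)) := by ring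
    have h4 : 40 * L * (1 + Nat.size a) = 40 * (L * (1 + Nat.size a)) := by ring
    simp only [bitCost_one] at b1
    omega

theorem four_mul_le_sq {L : ℕ} (hL : 4 ≤ L) : 4 * L ≤ L ^ 2 := by
  rw [pow_two]
  exact Nat.mul_le_mul_right L hL

theorem size_div_two {a : ℕ} (ha : a ≠ 0) : Nat.size a = Nat.size (a / 2) + 1 := by
  apply le_antisymm
  · rw [Nat.size_le]
    have := Nat.lt_size_self (a / 2)
    rw [pow_succ]
    omega
  · rw [Nat.succ_le_iff, Nat.lt_size]
    by_cases h : a / 2 = 0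
    · rw [h]
      simp
      omega
    · obtain ⟨m, hm⟩ := Nat.exists_eq_succ_of_ne_zero (Nat.size_pos.2 (Nat.pos_of_ne_zero h)).ne'
      have := (Nat.lt_size (m := m) (n := a / 2)).1 (by omega)
      rw [hm, pow_succ]
      omega

theorem size_sub_div (a i : ℕ) : Nat.size (a / 2 ^ i) = Nat.size a - i := by
  induction i with
  | zero => simp
  | succ i ih =>
    rw [pow_succ, ← Nat.div_div_eq_div_mul]
    by_cases h : a / 2 ^ i = 0
    · rw [h] at ih ⊢
      simp at ih ⊢
      omega
    · have := size_div_two h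
      omega

theorem heightFin_spec {ω : ℕ → Bool} {s : Config} {L : ℕ} (h10 : s.var 10 = 1)
    (h11 : s.var 11 = 2) (hL : 4 ≤ L) (b24 : bitCost (s.var 24) ≤ L) (b25 : bitCost (s.var 25) ≤ L) :
    WP ω heightFin s fun T s' => T ≤ 40 * L ^ 2 ∧
      s'.var 24 = s.var 24 + Nat.size (s.var 25) ∧ s'.mem = s.mem ∧
      s'.coins = s.coins ∧ s.SameBelow 24 s' := by
  set a := s.var 25 with ha
  have hx : bitCost a = 1 + Nat.size a := add_comm _ _
  simp only [heightFin, WP, Arith.eval, h10, ← ha, bitCost_one]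
  rw [← wp_iff]
  refine (wp_loop_const (N := Nat.size a) (fun i s' => s'.mem = s.mem ∧ s'.coins = s.coins ∧
    s.SameBelow 24 s' ∧ s'.var 24 = s.var 24 + i ∧ s'.var 28 = a / 2 ^ i) (10 * L) ?_ ?_ ?_).mono ?_
  · rintro i hi s' ⟨hm, hc, hs, h24, h28⟩
    have h10' : s'.var 10 = 1 := by rw [hs 10 (by norm_num), h10]
    have h11' : s'.var 11 = 2 := by rw [hs 11 (by norm_num), h11]
    refine ⟨?_, ?_⟩
    · rw [h28, ← Nat.pos_iff_ne_zero, ← Nat.size_pos, size_sub_div]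
      omega
    have b1 := bitCost_div_le a (2 ^ i)
    have b2 := bitCost_add_le (s.var 24) i
    have b3 := bitCost_le_self i
    simp [WP, Arith.eval, hm, hc, h24, h28, h10', h11', hs]
    refine ⟨by omega, by ring, ?_⟩
    rw [pow_succ, Nat.div_div_eq_div_mul]
  · rintro s' ⟨-, -, -, -, h⟩
    rw [h, ← Nat.size_eq_zero, size_sub_div]
    omega
  · simp [ha]
  · rintro T s' ⟨hT, hm, hc, hs, h24, -⟩
    refine ⟨?_, h24, hm, hc, hs⟩
    have h1 : Nat.size a * (10 * L) ≤ L * (10 * L) := by gcongr; omega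
    have h2 := four_mul_le_sq hL
    have h3 : L * (10 * L) = 10 * L ^ 2 := by ring
    omega

theorem heightInterp_implements {ω : ℕ → Bool} {s₀ : Config} {L : ℕ} (n : ℕ) (h10 : s₀.var 10 = 1)
    (h11 : s₀.var 11 = 2) (hL : 4 ≤ L) (b8 : bitCost (s₀.var 8) ≤ L) :
    Implements ω n s₀ (heightInterp (s₀.var 8)) heightVar heightConst heightStep heightFin
      (40 * L ^ 2) L where
  one := h10
  var s hs _ := by
    have e10 := hs.1 10 (by norm_num)
    have e8 := hs.1 8 (by norm_num)
    simp [heightVar, WP, Arith.eval, e10, e8, h10, heightInterp]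
    have := four_mul_le_sq hL
    omega
  const s hs _ hsz := by
    have e10 := hs.1 10 (by norm_num)
    refine (heightConst_spec (by rw [e10, h10]) (by omega) hsz).mono ?_
    rintro T s' ⟨hT, h⟩
    refine ⟨hT.trans ?_, h⟩
    gcongr
    exact Nat.le_self_pow (by norm_num) L
  step s hs _ b24 b26 := by
    have h1 := bitCost_sub_le (s.var 26) (s.var 24)
    simp [heightStep, WP, Arith.eval, heightInterp]
    have := four_mul_le_sq hL
    exact ⟨by omega, by omega⟩
  fin s hs b24 b25 :=
    heightFin_spec (by rw [hs.1 10 (by norm_num), h10]) (by rw [hs.1 11 (by norm_num), h11]) hL b24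
      b25
  step_le _ a v _ ha hv := by
    simp only [heightInterp]
    rcases max_cases a v with h | h <;> rw [h.1] <;> assumption

/-! ### Evaluating the circuit modulo a number -/

/-- The value that is substituted for a variable with random number `x`, where the residue of `x`
modulo `t` is the color of the variable and `A` encodes a set of colors. -/
def varValue (t p M A x : ℕ) : ℕ := x * p * (A / 2 ^ (x % t) % 2) % M

/-- Evaluation modulo `M`. -/
def modInterp (t p M A : ℕ) (x : ℕ → ℕ) : Interp where
  var j := varValue t p M A (x j)
  const sgn a := if sgn = 0 then a % M else M - a % M
  step op a v := (if op = 0 then a + v else a * v) % M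
  fin _ a := a

/-- `x := x % m`, with an auxiliary variable. -/
def modProg (x m aux : ℕ) : Prog :=
  .arith aux .div x m ;; .arith aux .mul aux m ;; .arith x .sub x aux

/-- The machine has no shift, so the digit of `A` at position `x % t` is found by halving `A` that
many times. This takes fewer than `t` rounds. -/
def modVar : Prog :=
  .arith 28 .add 7 25 ;; .load 26 28 ;; .arith 28 .mul 26 10 ;; modProg 28 5 29 ;;
  .arith 29 .mul 16 10 ;;
  .loop 28 (.arith 29 .div 29 11 ;; .arith 28 .sub 28 10) ;;
  modProg 29 11 28 ;; .arith 24 .mul 26 13 ;; .arith 24 .mul 24 29 ;; modProg 24 14 28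

/-- A negative constant is represented by `M - a % M`, which equals `M` rather than `0` when `M`
divides `a`. -/
def modConst : Prog :=
  .arith 24 .mul 26 10 ;; modProg 24 14 28 ;; .ite 25 (.arith 24 .sub 14 24) .skip

def modStep : Prog :=
  .ite 23 (.arith 24 .mul 24 26) (.arith 24 .add 24 26) ;; modProg 24 14 28

theorem modVar_spec {ω : ℕ → Bool} {s : Config} {L x : ℕ} (h10 : s.var 10 = 1)
    (h11 : s.var 11 = 2) (hL : 4 ≤ L) (ht : 0 < s.var 5) (htL : s.var 5 ≤ L)
    (hx : s.mem (s.var 7 + s.var 25) = x) (bx : bitCost x ≤ L)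
    (b7 : bitCost (s.var 7 + s.var 25) ≤ L) (b13 : bitCost (s.var 13) ≤ L)
    (b14 : bitCost (s.var 14) ≤ L) (b16 : bitCost (s.var 16) ≤ L) :
    WP ω modVar s fun T s' => T ≤ 100 * L ^ 2 ∧
      s'.var 24 = varValue (s.var 5) (s.var 13) (s.var 14) (s.var 16) x ∧ s'.mem = s.mem ∧
      s'.coins = s.coins ∧ s.SameBelow 24 s' := by
  have hmod : ∀ a m, a - a / m * m = a % m := fun a m => Nat.mod_eq_sub_div_mul.symm
  have hxt := Nat.mod_lt x ht
  have b5 : bitCost (s.var 5) ≤ L + 1 := (bitCost_le_self _).trans (by omega)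
  have b71 : bitCost (s.var 7) ≤ L := (bitCost_mono (by omega)).trans b7
  have b72 : bitCost (s.var 25) ≤ L := (bitCost_mono (by omega)).trans b7
  have b1 := bitCost_div_le x (s.var 5)
  have b2 : bitCost (x / s.var 5 * s.var 5) ≤ bitCost x := bitCost_mono (Nat.div_mul_le_self _ _)
  simp only [modVar, modProg, WP, Arith.eval, Config.setVar_var, reduceIte, Nat.reduceEqDiff, h10,
    hx, Config.setVar_mem, mul_one, hmod]
  rw [← wp_iff]
  refine (wp_loop_const (N := x % s.var 5) (fun i s' => s'.mem = s.mem ∧ s'.coins = s.coins ∧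
    s.SameBelow 24 s' ∧ s'.var 26 = x ∧ s'.var 28 = x % s.var 5 - i ∧
    s'.var 29 = s.var 16 / 2 ^ i) (10 * L) ?_ ?_ ?_).mono ?_
  · rintro i hi s' ⟨hm, hc, hs, h26, h28, h29⟩
    have h10' : s'.var 10 = 1 := by rw [hs 10 (by norm_num), h10]
    have h11' : s'.var 11 = 2 := by rw [hs 11 (by norm_num), h11]
    refine ⟨by omega, ?_⟩
    have b1 := bitCost_div_le (s.var 16) (2 ^ i)
    have b3 := bitCost_le_self (x % s.var 5 - i)
    simp [WP, Arith.eval, hm, hc, h26, h28, h29, h10', h11', hs]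
    refine ⟨by omega, by omega, ?_⟩
    rw [pow_succ, Nat.div_div_eq_div_mul]
  · rintro s' ⟨-, -, -, -, h, -⟩
    omega
  · simp
  · rintro T s' ⟨hT, hm, hc, hs, h26, h28, h29⟩
    have h11' : s'.var 11 = 2 := by rw [hs 11 (by norm_num), h11]
    have h13' := hs 13 (by norm_num)
    have h14' := hs 14 (by norm_num)
    simp only [h11', h26, h29, h13', h14']
    have hb : s.var 16 / 2 ^ (x % s.var 5) % 2 ≤ 1 := by omega
    have b3 : bitCost (s.var 16 / 2 ^ (x % s.var 5)) ≤ L := (bitCost_div_le _ _).trans b16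
    have b4 : bitCost (s.var 16 / 2 ^ (x % s.var 5) / 2) ≤ L := (bitCost_div_le _ _).trans b3
    have b6 : bitCost (s.var 16 / 2 ^ (x % s.var 5) / 2 * 2) ≤ L :=
      (bitCost_mono (Nat.div_mul_le_self _ _)).trans b3
    have b8 := bitCost_mul_le x (s.var 13)
    have b9 : bitCost (s.var 16 / 2 ^ (x % s.var 5) % 2) ≤ 2 := (bitCost_mono hb).trans (by simp)
    have b10 := bitCost_mul_le (x * s.var 13) (s.var 16 / 2 ^ (x % s.var 5) % 2)
    have b11 := bitCost_div_le (x * s.var 13 * (s.var 16 / 2 ^ (x % s.var 5) % 2)) (s.var 14)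
    have b12 : bitCost (x * s.var 13 * (s.var 16 / 2 ^ (x % s.var 5) % 2) / s.var 14 * s.var 14) ≤
      bitCost (x * s.var 13 * (s.var 16 / 2 ^ (x % s.var 5) % 2)) :=
      bitCost_mono (Nat.div_mul_le_self _ _)
    refine ⟨?_, rfl, by simp [hm], by simp [hc], by simpa using hs⟩
    have h1 : x % s.var 5 * (10 * L) ≤ L * (10 * L) := by gcongr; omega
    have h2 := four_mul_le_sq hL
    have h3 : L * (10 * L) = 10 * L ^ 2 := by ring
    have b17 : bitCost (x / s.var 5 * s.var 5) ≤ L := b2.trans bx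
    simp only [bitCost_one, bitCost_two]
    omega

theorem modInterp_implements {ω : ℕ → Bool} {s₀ : Config} {L : ℕ} (n : ℕ) (x : ℕ → ℕ)
    (h10 : s₀.var 10 = 1) (h11 : s₀.var 11 = 2) (hL : 4 ≤ L) (ht : 0 < s₀.var 5)
    (htL : s₀.var 5 ≤ L) (h7 : s₀.var 7 = s₀.var 6 + s₀.var 3) (hM : 0 < s₀.var 14)
    (hx : ∀ j < n, s₀.mem (s₀.var 7 + j) = x j) (bx : ∀ j < n, bitCost (x j) ≤ L)
    (b7 : bitCost (s₀.var 7 + n) ≤ L) (b13 : bitCost (s₀.var 13) ≤ L)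
    (b14 : bitCost (s₀.var 14) ≤ L) (b16 : bitCost (s₀.var 16) ≤ L) :
    Implements ω n s₀ (modInterp (s₀.var 5) (s₀.var 13) (s₀.var 14) (s₀.var 16) x)
      modVar modConst modStep .skip (100 * L ^ 2) L where
  one := h10
  var s hs hj := by
    have e10 := hs.1 10 (by norm_num)
    have e11 := hs.1 11 (by norm_num)
    have e5 := hs.1 5 (by norm_num)
    have e7 := hs.1 7 (by norm_num)
    have e13 := hs.1 13 (by norm_num)
    have e14 := hs.1 14 (by norm_num)
    have e16 := hs.1 16 (by norm_num)
    simp only [modInterp]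
    rw [← e5, ← e13, ← e14, ← e16]
    exact modVar_spec (by omega) (by omega) hL (by omega) (by omega)
      (by rw [hs.2 _ (by omega), e7, hx _ hj]) (bx _ hj)
      ((bitCost_mono (by omega)).trans b7) (by rwa [e13]) (by rwa [e14]) (by rwa [e16])
  const s hs h25 _ := by
    have e10 := hs.1 10 (by norm_num)
    have e14 := hs.1 14 (by norm_num)
    have hmod : ∀ a m, a - a / m * m = a % m := fun a m => Nat.mod_eq_sub_div_mul.symm
    have hx : bitCost (s.var 26) = 1 + Nat.size (s.var 26) := add_comm _ _
    have b1 := bitCost_div_le (s.var 26) (s₀.var 14)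
    have b2 : bitCost (s.var 26 / s₀.var 14 * s₀.var 14) ≤ bitCost (s.var 26) :=
      bitCost_mono (Nat.div_mul_le_self _ _)
    have b3 : bitCost (s.var 26 % s₀.var 14) ≤ bitCost (s.var 26) := bitCost_mono (Nat.mod_le _ _)
    have b4 : bitCost (s.var 25) ≤ 2 := (bitCost_mono h25).trans (by simp)
    have hT : 20 * (L + bitCost (s.var 26)) ≤ 100 * L ^ 2 * (1 + Nat.size (s.var 26)) := by
      rw [← hx]
      have h1 : L ≤ L ^ 2 * bitCost (s.var 26) := by
        rw [pow_two, mul_assoc]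
        exact Nat.le_mul_of_pos_right _ (Nat.mul_pos (by omega) (by omega))
      have h2 : bitCost (s.var 26) ≤ L ^ 2 * bitCost (s.var 26) :=
        Nat.le_mul_of_pos_left _ (by positivity)
      rw [mul_assoc]
      omega
    simp only [modConst, modProg, WP, Arith.eval, Config.setVar_var, reduceIte, Nat.reduceEqDiff,
      e10, h10, e14, mul_one, hmod, modInterp, bitCost_one, Config.setVar_mem,
      Config.setVar_coins, true_and]
    constructor
    · intro h
      refine ⟨?_, by simp [h], by simp⟩
      omega
    · intro h
      refine ⟨?_, by simp [h], by simp⟩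
      omega
  step s hs _ b24 b26 := by
    have e14 := hs.1 14 (by norm_num)
    have hmod : ∀ a m, a - a / m * m = a % m := fun a m => Nat.mod_eq_sub_div_mul.symm
    have h2 := four_mul_le_sq hL
    have key : ∀ y, bitCost y ≤ bitCost (s.var 24) + bitCost (s.var 26) →
        bitCost (y / s₀.var 14) ≤ 2 * L ∧ bitCost (y / s₀.var 14 * s₀.var 14) ≤ 2 * L := by
      intro y hy
      have h1 : bitCost (y / s₀.var 14 * s₀.var 14) ≤ bitCost y :=
        bitCost_mono (Nat.div_mul_le_self _ _)
      have h2 := bitCost_div_le y (s₀.var 14)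
      omega
    have b23 : bitCost (s.var 23) ≤ 2 := (bitCost_mono (by assumption)).trans (by simp)
    have k1 := key _ (bitCost_mul_le _ _)
    have k2 := key _ (bitCost_add_le _ _)
    have k3 := bitCost_mul_le (s.var 24) (s.var 26)
    have k4 := bitCost_add_le (s.var 24) (s.var 26)
    simp only [modStep, modProg, WP, Arith.eval, Config.setVar_var, reduceIte, Nat.reduceEqDiff,
      e14, hmod, modInterp, Config.setVar_mem, Config.setVar_coins, true_and]
    constructor
    · intro h
      refine ⟨?_, by simp [h], by simp⟩
      omega
    · intro h
      refine ⟨?_, by simp [h], by simp⟩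
      omega
  fin s hs _ _ := by
    have h2 := four_mul_le_sq hL
    simp only [WP, modInterp, Config.SameBelow.refl, and_true]
    omega
  step_le op a v _ _ _ := (bitCost_mono (Nat.mod_lt _ hM).le).trans b14

/-- The bound is not strict: a negative multiple of `M` yields `M` itself, and for `M = 1` an empty
product is `1`. This suffices, since the reflections `h ↦ M - h` still represent negation on numbers
up to `M`. -/
theorem modInterp_le {n t p M A : ℕ} (hM : 0 < M) (x : ℕ → ℕ) (C : Circuit n) (i : ℕ) :
    C.val (modInterp t p M A x) i ≤ M := by
  have hfold : ∀ (op : ℕ) (l : List ℕ) (a : ℕ), a ≤ M →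
      l.foldl ((modInterp t p M A x).step op) a ≤ M := by
    intro op l
    induction l with
    | nil => exact fun a ha => ha
    | cons v l ih => exact fun a _ => ih _ (Nat.mod_lt _ hM).le
  unfold Circuit.val
  split
  · next hi =>
    rw [Circuit.value]
    split
    · exact (Nat.mod_lt _ hM).le
    · dsimp only [modInterp]
      split_ifs <;> first | exact (Nat.mod_lt _ hM).le | exact Nat.sub_le _ _
    · exact hfold _ _ _ hM.le
    · exact hfold _ _ _ hM
  · exact hM.le

/-! ### One evaluation of the circuit -/

/-- The number of ones among the `t` least significant binary digits of `A`. -/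
def popcount (A t : ℕ) : ℕ := ∑ i ∈ Finset.range t, A / 2 ^ i % 2

theorem popcount_le (A t : ℕ) : popcount A t ≤ t := by
  refine (Finset.sum_le_card_nsmul _ _ 1 fun i _ => by omega).trans (by simp)

/-- The contribution of the set of colors `A` to the result of a trial. -/
def trialTerm {n : ℕ} (C : Circuit n) (k t p M : ℕ) (x : ℕ → ℕ) (A : ℕ) : ℕ :=
  (fun h => M - h)^[t - popcount A t] (C.val (modInterp t p M A x) C.out) *
    (popcount A t).descFactorial (t - k)

/-- Change the sign of the result for every color that is missing, and count the others. -/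
def signProg : Prog :=
  .const 25 0 ;; .arith 26 .mul 16 10 ;; .arith 27 .mul 5 10 ;;
  .loop 27 (.arith 28 .div 26 11 ;; .arith 29 .mul 28 11 ;; .arith 29 .sub 26 29 ;;
    .arith 26 .mul 28 10 ;; .ite 29 (.arith 25 .add 25 10) (.arith 24 .sub 14 24) ;;
    .arith 27 .sub 27 10)

/-- Multiply the result by a falling factorial of the number of colors. -/
def weightProg : Prog :=
  .arith 27 .sub 5 2 ;;
  .loop 27 (.arith 24 .mul 24 25 ;; .arith 25 .sub 25 10 ;; .arith 27 .sub 27 10)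

def termProg : Prog :=
  traversal modVar modConst modStep .skip ;; .arith 28 .add 6 4 ;; .load 24 28 ;;
  signProg ;; weightProg ;; .arith 15 .add 15 24

/-- Each missing color contributes one reflection `h ↦ M - h`, which is negation modulo `M`. The
same pass over the digits of `A` counts the colors that are present. -/
theorem signProg_spec {ω : ℕ → Bool} {s : Config} {L : ℕ} (h10 : s.var 10 = 1)
    (h11 : s.var 11 = 2) (hL : 4 ≤ L) (htL : s.var 5 < L) (b14 : bitCost (s.var 14) ≤ L)
    (b16 : bitCost (s.var 16) ≤ L) (h24 : s.var 24 ≤ s.var 14) :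
    WP ω signProg s fun T s' => T ≤ 30 * L ^ 2 ∧ s'.mem = s.mem ∧ s'.coins = s.coins ∧
      s.SameBelow 24 s' ∧ s'.var 25 = popcount (s.var 16) (s.var 5) ∧ s'.var 24 ≤ s.var 14 ∧
      s'.var 24 = (fun h => s.var 14 - h)^[s.var 5 - popcount (s.var 16) (s.var 5)] (s.var 24) := by
  have b5 : bitCost (s.var 5) ≤ L := (bitCost_le_self _).trans htL
  simp only [signProg, WP, Arith.eval, Config.setVar_var, reduceIte, Nat.reduceEqDiff, h10,
    mul_one, bitCost_one, bitCost_zero]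
  rw [← wp_iff]
  set A := s.var 16 with hA
  set M := s.var 14 with hM
  refine (wp_loop_const (N := s.var 5) (fun i s' => s'.mem = s.mem ∧ s'.coins = s.coins ∧
    s.SameBelow 24 s' ∧ s'.var 25 = popcount A i ∧ s'.var 24 ≤ M ∧
    s'.var 24 = (fun h => M - h)^[i - popcount A i] (s.var 24) ∧ s'.var 26 = A / 2 ^ i ∧
    s'.var 27 = s.var 5 - i) (20 * L) ?_ ?_ ?_).mono ?_
  · rintro i hi s' ⟨hm, hc, hs, h25, h24', hh, h26, h27⟩
    have h10' : s'.var 10 = 1 := by rw [hs 10 (by norm_num), h10]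
    have h11' : s'.var 11 = 2 := by rw [hs 11 (by norm_num), h11]
    have h14' : s'.var 14 = M := hs 14 (by norm_num)
    refine ⟨by omega, ?_⟩
    have b1 : bitCost (A / 2 ^ i) ≤ L := (bitCost_div_le A (2 ^ i)).trans b16
    have b2 : bitCost (A / 2 ^ i / 2) ≤ L := (bitCost_div_le _ _).trans b1
    have b3 : bitCost (A / 2 ^ i / 2 * 2) ≤ L := (bitCost_mono (Nat.div_mul_le_self _ _)).trans b1
    have b4 : bitCost (s.var 5 - i) ≤ L := (bitCost_sub_le _ _).trans b5
    have b6 : bitCost (popcount A i) ≤ L :=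
      (bitCost_mono ((popcount_le A i).trans hi.le)).trans b5
    have b7 : bitCost (s'.var 24) ≤ L := (bitCost_mono h24').trans b14
    have hbit : A / 2 ^ i - A / 2 ^ i / 2 * 2 = A / 2 ^ i % 2 := by omega
    have b8 : bitCost (A / 2 ^ i % 2) ≤ 2 := (bitCost_mono (by omega)).trans bitCost_one.le
    have hpop : popcount A (i + 1) = popcount A i + A / 2 ^ i % 2 := by
      simp [popcount, Finset.sum_range_succ]
    have hple := popcount_le A i
    have hdiv : A / 2 ^ i / 2 = A / 2 ^ (i + 1) := by
      rw [pow_succ, Nat.div_div_eq_div_mul]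
    simp only [WP, Arith.eval, Config.setVar_var, Config.setVar_mem, Config.setVar_coins, reduceIte,
      Nat.reduceEqDiff, h10', h11', h14', h25, h26, h27, hm, hc, hbit, mul_one, bitCost_one,
      bitCost_two, true_and]
    constructor
    · intro h
      have h1 : A / 2 ^ i % 2 = 1 := by omega
      rw [h1] at hpop
      refine ⟨by omega, by simpa using hs, by rw [hpop], h24', ?_, hdiv, by omega⟩
      rw [hh, hpop, Nat.add_sub_add_right]
    · intro h
      rw [h] at hpop
      refine ⟨by omega, by simpa using hs, by rw [hpop, add_zero], Nat.sub_le _ _, ?_, hdiv,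
        by omega⟩
      rw [hpop, add_zero, Nat.succ_sub hple, Function.iterate_succ_apply', ← hh]
  · rintro s' ⟨-, -, -, -, -, -, -, h⟩
    omega
  · simp [popcount, h24]
  · rintro T s' ⟨hT, hm, hc, hs, h25, h24', hh, -⟩
    refine ⟨?_, hm, hc, hs, h25, h24', hh⟩
    have h1 : s.var 5 * (20 * L) ≤ L * (20 * L) := by gcongr
    have h2 := four_mul_le_sq hL
    have h3 : L * (20 * L) = 20 * L ^ 2 := by ring
    omega

theorem bitCost_descFactorial_le {a i t L : ℕ} (ha : a ≤ t) (hi : i ≤ t) (hL : (t + 1) ^ 2 ≤ L) :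
    bitCost (a.descFactorial i) ≤ L + 1 := by
  apply bitCost_le
  calc a.descFactorial i ≤ a ^ i := Nat.descFactorial_le_pow _ _
    _ ≤ (2 ^ t) ^ i := by gcongr; exact ha.trans Nat.lt_two_pow_self.le
    _ ≤ (2 ^ t) ^ t := Nat.pow_le_pow_right (by positivity) hi
    _ = 2 ^ (t * t) := by rw [pow_mul]
    _ < 2 ^ L := by gcongr; norm_num; nlinarith

theorem weightProg_spec {ω : ℕ → Bool} {s : Config} {L : ℕ} (h10 : s.var 10 = 1)
    (hL : 4 ≤ L) (htL : (s.var 5 + 1) ^ 2 ≤ L) (b2 : bitCost (s.var 2) ≤ L)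
    (b24 : bitCost (s.var 24) ≤ L) (h25 : s.var 25 ≤ s.var 5) :
    WP ω weightProg s fun T s' => T ≤ 30 * L ^ 2 ∧ s'.mem = s.mem ∧ s'.coins = s.coins ∧
      s.SameBelow 24 s' ∧
      s'.var 24 = s.var 24 * (s.var 25).descFactorial (s.var 5 - s.var 2) := by
  have htL' : s.var 5 < L := by nlinarith
  have b5 : bitCost (s.var 5) ≤ L := (bitCost_le_self _).trans htL'
  simp only [weightProg, WP, Arith.eval]
  rw [← wp_iff]
  set a := s.var 25 with ha
  refine (wp_loop_const (N := s.var 5 - s.var 2) (fun i s' => s'.mem = s.mem ∧ s'.coins = s.coins ∧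
    s.SameBelow 24 s' ∧ s'.var 25 = a - i ∧ s'.var 24 = s.var 24 * a.descFactorial i ∧
    s'.var 27 = s.var 5 - s.var 2 - i) (20 * L) ?_ ?_ ?_).mono ?_
  · rintro i hi s' ⟨hm, hc, hs, h25, h24, h27⟩
    have h10' : s'.var 10 = 1 := by rw [hs 10 (by norm_num), h10]
    refine ⟨by omega, ?_⟩
    have b1 := bitCost_mul_le (s.var 24) (a.descFactorial i)
    have b3 : bitCost (a - i) ≤ L := (bitCost_mono (by omega)).trans b5
    have b4 : bitCost (s.var 5 - s.var 2 - i) ≤ L := (bitCost_mono (by omega)).trans b5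
    have b6 := bitCost_descFactorial_le (i := i) (by omega) (by omega) htL (a := a)
    simp only [WP, Arith.eval, Config.setVar_var, Config.setVar_mem, Config.setVar_coins, reduceIte,
      Nat.reduceEqDiff, h10', h24, h25, h27, hm, hc, bitCost_one, true_and]
    refine ⟨by omega, by simpa using hs, by omega, ?_, by omega⟩
    rw [Nat.descFactorial_succ]
    ring
  · rintro s' ⟨-, -, -, -, -, h⟩
    omega
  · simp [ha]
  · rintro T s' ⟨hT, hm, hc, hs, -, h24, -⟩
    refine ⟨?_, hm, hc, hs, h24⟩
    have h1 : (s.var 5 - s.var 2) * (20 * L) ≤ L * (20 * L) := by gcongr; omega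
    have h2 := four_mul_le_sq hL
    have h3 : L * (20 * L) = 20 * L ^ 2 := by ring
    omega

/-- The parameters of the algorithm and the instance have been prepared. -/
structure Config.Ready (s : Config) {n : ℕ} (C : Circuit n) (k t e B : ℕ) : Prop where
  h1 : s.var 1 = n
  h2 : s.var 2 = k
  h3 : s.var 3 = C.numGates
  h4 : s.var 4 = C.out
  h5 : s.var 5 = t
  h6 : s.var 6 = C.len
  h7 : s.var 7 = C.len + C.numGates
  h8 : s.var 8 = e
  h9 : s.var 9 = B
  h10 : s.var 10 = 1
  h11 : s.var 11 = 2
  mem : ∀ a < C.len, s.mem a = (C.encode k).getD a 0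

theorem Config.Ready.trans {s s' : Config} {n : ℕ} {C : Circuit n} {k t e B : ℕ}
    (h : s.Ready C k t e B) (hs : ∀ v ≠ 0, v < 12 → s'.var v = s.var v) (hm : ∀ a < C.len, s'.mem a = s.mem a) :
    s'.Ready C k t e B where
  h1 := by rw [hs 1 (by norm_num) (by norm_num), h.h1]
  h2 := by rw [hs 2 (by norm_num) (by norm_num), h.h2]
  h3 := by rw [hs 3 (by norm_num) (by norm_num), h.h3]
  h4 := by rw [hs 4 (by norm_num) (by norm_num), h.h4]
  h5 := by rw [hs 5 (by norm_num) (by norm_num), h.h5]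
  h6 := by rw [hs 6 (by norm_num) (by norm_num), h.h6]
  h7 := by rw [hs 7 (by norm_num) (by norm_num), h.h7]
  h8 := by rw [hs 8 (by norm_num) (by norm_num), h.h8]
  h9 := by rw [hs 9 (by norm_num) (by norm_num), h.h9]
  h10 := by rw [hs 10 (by norm_num) (by norm_num), h.h10]
  h11 := by rw [hs 11 (by norm_num) (by norm_num), h.h11]
  mem a ha := by rw [hm a ha, h.mem a ha]

/-- `L` is a bound on the bit lengths of the numbers that occur in a trial. -/
structure SizeBound {n : ℕ} (C : Circuit n) (k t e B L : ℕ) : Prop where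
  pos : 0 < t
  le : k ≤ t
  four : 4 ≤ L
  colors : (t + 1) ^ 2 ≤ L
  bits : e + 2 ≤ L
  vars : n + 1 ≤ L
  modulus : (k + 1) * (B + 2) ≤ L
  addr : bitCost (C.len + C.numGates + n) ≤ L
  size : bitCost C.size ≤ L

theorem SizeBound.colors_add_two_le {n : ℕ} {C : Circuit n} {k t e B L : ℕ}
    (h : SizeBound C k t e B L) : t + 2 ≤ L := by
  have := h.pos
  have := h.colors
  nlinarith

theorem SizeBound.base_add_two_le {n : ℕ} {C : Circuit n} {k t e B L : ℕ}
    (h : SizeBound C k t e B L) : B + 2 ≤ L :=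
  (Nat.le_mul_of_pos_left _ (Nat.succ_pos k)).trans h.modulus

theorem termProg_spec {ω : ℕ → Bool} {s : Config} {n : ℕ} {C : Circuit n} {k t e B L : ℕ}
    (hs : s.Ready C k t e B) (hL : SizeBound C k t e B L) {p M : ℕ} {x : ℕ → ℕ}
    (hx : ∀ j < n, s.mem (C.len + C.numGates + j) = x j) (hxe : ∀ j < n, x j < 2 ^ e)
    (h13 : s.var 13 = p) (h14 : s.var 14 = M) (hM : 0 < M) (b13 : bitCost p ≤ L)
    (b14 : bitCost M ≤ L) (b16 : bitCost (s.var 16) ≤ L) (b15 : bitCost (s.var 15) ≤ 4 * L) :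
    WP ω termProg s fun T s' => T ≤ C.size * (300 * L ^ 2) ∧ s.SameBelow 15 s' ∧
      s'.coins = s.coins ∧ s'.var 15 = s.var 15 + trialTerm C k t p M x (s.var 16) ∧
      s'.var 16 = s.var 16 ∧
      ∀ a, a < C.len ∨ C.len + C.numGates ≤ a → s'.mem a = s.mem a := by
  have hL4 := hL.four
  have htL : t + 2 ≤ L := hL.colors_add_two_le
  have bx : ∀ j < n, bitCost (x j) ≤ L := fun j hj =>
    (bitCost_le (hxe j hj)).trans (by have := hL.bits; omega)
  have himp := modInterp_implements (ω := ω) (s₀ := s) (L := L) n x hs.h10 hs.h11 hL4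
    (by rw [hs.h5]; exact hL.pos) (by rw [hs.h5]; omega) (by rw [hs.h7, hs.h6, hs.h3])
    (by rwa [h14]) (by rwa [hs.h7]) bx (by rw [hs.h7]; exact hL.addr) (by rwa [h13])
    (by rwa [h14]) b16
  rw [hs.h5, h13, h14] at himp
  have hval := fun i => modInterp_le (t := t) (p := p) (A := s.var 16) hM x C i
  refine WP.seq (traversal_spec himp hL4 hs.h3 hs.h6 hs.mem
    ((bitCost_mono (Nat.le_add_right _ _)).trans hL.addr)
    (fun i _ => (bitCost_mono (hval i)).trans b14)
    ((bitCost_mono (Nat.le_add_left _ _)).trans hL.addr) hL.size) ?_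
  rintro T₁ s₁ ⟨hT₁, hs₁, hc₁, hv₁⟩
  have e6 := hs₁.1 6 (by norm_num)
  have e4 := hs₁.1 4 (by norm_num)
  have e5 := hs₁.1 5 (by norm_num)
  have e2 := hs₁.1 2 (by norm_num)
  have e10 := hs₁.1 10 (by norm_num)
  have e11 := hs₁.1 11 (by norm_num)
  have e14 := hs₁.1 14 (by norm_num)
  have e15 := hs₁.1 15 (by norm_num)
  have e16 := hs₁.1 16 (by norm_num)
  rw [hs.h6] at e6
  rw [hs.h5] at e5
  rw [hs.h4] at e4
  rw [hs.h2] at e2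
  rw [hs.h10] at e10
  rw [hs.h11] at e11
  rw [h14] at e14
  have hout := hv₁ C.out C.out.2
  set v := C.val (modInterp t p M (s.var 16) x) C.out with hv
  have bv : bitCost v ≤ L := (bitCost_mono (hval _)).trans b14
  have b1 : bitCost (C.len + C.out) ≤ L :=
    (bitCost_mono (by have := C.out.2; omega)).trans hL.addr
  have b2 : bitCost C.len ≤ L := (bitCost_mono (by omega)).trans hL.addr
  have b3 : bitCost C.out ≤ L := (bitCost_mono (by have := C.out.2; omega)).trans hL.addr
  simp only [WP, Arith.eval, Config.setVar_var, Config.setVar_mem, e4, e6, reduceIte,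
    Nat.reduceEqDiff, hout]
  refine (signProg_spec (L := L) (by simpa using e10) (by simpa using e11) hL4
    (by simpa [e5] using (show t < L by omega)) (by simpa [e14] using b14) (by simpa [e16] using b16)
    (by simpa [e14] using hval _)).mono ?_
  rintro T₂ s₂ ⟨hT₂, hm₂, hc₂, hs₂, h25, hle, h24⟩
  simp only [Config.setVar_var, Config.setVar_mem, reduceIte, Nat.reduceEqDiff, e5, e14, e16,
    Config.setVar_coins] at hm₂ hc₂ h25 hle h24
  have f5 : s₂.var 5 = t := by rw [hs₂ 5 (by norm_num)]; simpa using e5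
  have f2 : s₂.var 2 = k := by rw [hs₂ 2 (by norm_num)]; simpa using e2
  have f10 : s₂.var 10 = 1 := by rw [hs₂ 10 (by norm_num)]; simpa using e10
  have hkt := hL.le
  refine (weightProg_spec (L := L) f10 hL4 (by rw [f5]; exact hL.colors)
    (by rw [f2]; exact (bitCost_le_self k).trans (by omega)) ((bitCost_mono hle).trans b14)
    (by rw [f5, h25]; exact popcount_le _ _)).mono ?_
  rintro T₃ s₃ ⟨hT₃, hm₃, hc₃, hs₃, k24⟩
  rw [h24, h25, f5, f2] at k24
  have hterm : s₃.var 24 = trialTerm C k t p M x (s.var 16) := by rw [k24, trialTerm]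
  have k15 : s₃.var 15 = s.var 15 := by
    rw [hs₃ 15 (by norm_num), hs₂ 15 (by norm_num)]
    simpa using e15
  have k16 : s₃.var 16 = s.var 16 := by
    rw [hs₃ 16 (by norm_num), hs₂ 16 (by norm_num)]
    simpa using e16
  have b4 : bitCost (s₃.var 24) ≤ 2 * L + 1 := by
    rw [k24]
    refine (bitCost_mul_le _ _).trans ?_
    rw [← h24]
    have h1 := (bitCost_mono hle).trans b14
    have h2 := bitCost_descFactorial_le (popcount_le (s.var 16) t) (Nat.sub_le t k) hL.colors
    omega
  have hsame : s.SameBelow 20 s₃ := by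
    refine Config.SameBelow.trans hs₁.1 (Config.SameBelow.trans (s' := s₂) ?_
      (hs₃.mono (by norm_num)))
    exact Config.SameBelow.trans (by simp) (hs₂.mono (by norm_num))
  refine ⟨?_, ?_, ?_, ?_, ?_, ?_⟩
  · rw [k15]
    have h2 := four_mul_le_sq hL4
    have h3 : L ^ 2 ≤ C.size * L ^ 2 := Nat.le_mul_of_pos_left _ C.one_le_size
    have h4 : C.size * (100 * L ^ 2 + 50 * L) ≤ C.size * (120 * L ^ 2) := by
      gcongr
      omega
    have h5 : C.size * (120 * L ^ 2) = 120 * (C.size * L ^ 2) := by ring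
    have h6 : C.size * (300 * L ^ 2) = 300 * (C.size * L ^ 2) := by ring
    omega
  · simpa using hsame.mono (by norm_num)
  · simp [hc₃, hc₂, hc₁]
  · simp [k15, hterm]
  · simp [k16]
  · intro a ha
    show s₃.mem a = s.mem a
    rw [hm₃, hm₂]
    exact hs₁.2 a (by rwa [hs.h6, hs.h3])

/-! ### A trial -/

/-- The number with binary digits `ω c, …, ω (c + e - 1)`, most significant digit first. -/
def num (ω : ℕ → Bool) (c : ℕ) : ℕ → ℕ
  | 0 => 0
  | e + 1 => 2 * num ω c e + if ω (c + e) then 1 else 0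

theorem num_lt (ω : ℕ → Bool) (c e : ℕ) : num ω c e < 2 ^ e := by
  induction e with
  | zero => simp [num]
  | succ e ih => rw [num, pow_succ]; split <;> omega

def randBits : Prog :=
  .const 24 0 ;; .loop 27 (.flip 28 ;; .arith 24 .add 24 24 ;; .arith 24 .add 24 28 ;;
    .arith 27 .sub 27 10)

theorem randBits_spec {ω : ℕ → Bool} {s : Config} {L : ℕ} (h10 : s.var 10 = 1)
    (hL : s.var 27 ≤ L) :
    WP ω randBits s fun T s' => T ≤ 10 * (L + 2) ^ 2 ∧ s'.mem = s.mem ∧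
      s'.coins = s.coins + s.var 27 ∧ s.SameBelow 24 s' ∧
      s'.var 24 = num ω s.coins (s.var 27) := by
  set e := s.var 27 with he
  refine WP.seq (Q₁ := fun T s' => T = 1 ∧ s' = s.setVar 24 0) (by simp [WP]) ?_
  rintro _ _ ⟨rfl, rfl⟩
  refine (wp_loop_const (N := e) (fun i s' => s'.mem = s.mem ∧ s'.coins = s.coins + i ∧
    s.SameBelow 24 s' ∧ s'.var 24 = num ω s.coins i ∧ s'.var 27 = e - i) (7 * (L + 2)) ?_ ?_ ?_).mono ?_
  · rintro i hi s' ⟨hm, hc, hs, hx, hn⟩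
    have h10' : s'.var 10 = 1 := (hs 10 (by norm_num)).trans h10
    have hb : bitCost (num ω s.coins i) ≤ L + 1 :=
      bitCost_le ((num_lt _ _ _).trans_le (Nat.pow_le_pow_right (by norm_num) (by omega)))
    have hb2 : bitCost (e - i) ≤ L + 1 := (bitCost_le_self _).trans (by omega)
    have hb3 := bitCost_add_le (num ω s.coins i) (num ω s.coins i)
    have hb4 : bitCost (if ω (s.coins + i) then 1 else 0) ≤ 2 := by split <;> simp
    simp only [WP, Arith.eval, num, hm, hx, hc, hn, h10', Config.setVar_var, Config.setVar_mem,
      reduceIte, Nat.reduceEqDiff, Config.setVar_coins, bitCost_one, true_and]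
    refine ⟨by omega, by omega, by omega, ?_, by omega, by omega⟩
    intro v hv
    have : v ≠ 27 ∧ v ≠ 24 ∧ v ≠ 28 := by omega
    simp [this, hs v hv]
  · rintro s' ⟨-, -, -, -, h⟩
    omega
  · simp [num, he]
  · rintro T s' ⟨hT, hm, hc, hs, hx, -⟩
    refine ⟨?_, hm, hc, Config.SameBelow.trans (by simp) hs, hx⟩
    have : e * (7 * (L + 2)) ≤ L * (7 * (L + 2)) := by gcongr
    nlinarith

/-- Draw a random number for every variable. -/
def drawVars : Prog :=
  .arith 22 .mul 7 10 ;; .arith 21 .mul 1 10 ;;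
  .loop 21 (.arith 27 .mul 8 10 ;; randBits ;; .store 22 24 ;; .arith 22 .add 22 10 ;;
    .arith 21 .sub 21 10)

/-- Draw a random number `p` and compute the modulus `p ^ (k + 1)`. -/
def drawMod : Prog :=
  .arith 27 .mul 9 10 ;; randBits ;; .arith 13 .add 24 10 ;; .arith 14 .mul 13 10 ;;
  .arith 27 .mul 2 10 ;; .loop 27 (.arith 14 .mul 14 13 ;; .arith 27 .sub 27 10)

/-- Sum the contributions of all sets of colors. -/
def sumProg : Prog :=
  .const 15 0 ;; .const 16 1 ;; .arith 27 .mul 5 10 ;;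
  .loop 27 (.arith 16 .add 16 16 ;; .arith 27 .sub 27 10) ;;
  .loop 16 (.arith 16 .sub 16 10 ;; termProg)

def trialProg : Prog :=
  drawVars ;; drawMod ;; sumProg ;; modProg 15 14 28 ;; .ite 15 (.const 0 1) .skip

theorem drawVars_spec {ω : ℕ → Bool} {s : Config} {n : ℕ} {C : Circuit n} {k t e B L : ℕ}
    (hs : s.Ready C k t e B) (hL : SizeBound C k t e B L) :
    WP ω drawVars s fun T s' => T ≤ 60 * L ^ 3 ∧ s.SameBelow 20 s' ∧ s'.coins = s.coins + n * e ∧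
      (∀ j < n, s'.mem (C.len + C.numGates + j) = num ω (s.coins + j * e) e) ∧
      ∀ a < C.len + C.numGates, s'.mem a = s.mem a := by
  have hL4 := hL.four
  have haddr := hL.addr
  have b1 : bitCost (C.len + C.numGates) ≤ L := (bitCost_mono (by omega)).trans haddr
  have b2 : bitCost n ≤ L := (bitCost_mono (by omega)).trans haddr
  have b3 : bitCost e ≤ L := (bitCost_le_self e).trans (by have := hL.bits; omega)
  have hsq := four_mul_le_sq hL4
  simp only [drawVars, WP, Arith.eval, Config.setVar_var, reduceIte, Nat.reduceEqDiff, hs.h7,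
    hs.h10, hs.h1, mul_one, bitCost_one]
  rw [← wp_iff]
  refine (wp_loop_const (N := n) (fun i s' => s.SameBelow 20 s' ∧ s'.coins = s.coins + i * e ∧
    s'.var 21 = n - i ∧ s'.var 22 = C.len + C.numGates + i ∧
    (∀ j < i, s'.mem (C.len + C.numGates + j) = num ω (s.coins + j * e) e) ∧
    ∀ a < C.len + C.numGates, s'.mem a = s.mem a) (40 * L ^ 2) ?_ ?_ ?_).mono ?_
  · rintro i hi s' ⟨hs', hc, h21, h22, hx, hm⟩
    have e10 : s'.var 10 = 1 := by rw [hs' 10 (by norm_num), hs.h10]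
    have e8 : s'.var 8 = e := by rw [hs' 8 (by norm_num), hs.h8]
    refine ⟨by omega, ?_⟩
    simp only [WP, Arith.eval, Config.setVar_var, reduceIte, Nat.reduceEqDiff, e10, e8, mul_one]
    refine (randBits_spec (L := e) (by simpa using e10) (by simp)).mono ?_
    rintro T₁ s₁ ⟨hT₁, hm₁, hc₁, hs₁, h24⟩
    simp only [Config.setVar_var, reduceIte, Config.setVar_coins, Config.setVar_mem, hc]
      at hm₁ hc₁ h24
    have f10 : s₁.var 10 = 1 := by rw [hs₁ 10 (by norm_num)]; simpa using e10
    have f21 : s₁.var 21 = n - i := by rw [hs₁ 21 (by norm_num)]; simpa using h21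
    have f22 : s₁.var 22 = C.len + C.numGates + i := by
      rw [hs₁ 22 (by norm_num)]; simpa using h22
    have b4 : bitCost (num ω (s.coins + i * e) e) ≤ L :=
      (bitCost_le (num_lt _ _ _)).trans (by have := hL.bits; omega)
    have b5 : bitCost (C.len + C.numGates + i) ≤ L := (bitCost_mono (by omega)).trans haddr
    have b6 : bitCost (n - i) ≤ L := (bitCost_mono (by omega)).trans b2
    simp only [f10, f21, f22, h24,
      Config.setVar_coins, Config.setVar_mem, Config.setMem_var, Config.setMem_coins,
      Config.setMem_mem, hc₁, h21, bitCost_one]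
    refine ⟨?_, ?_, by ring, by omega, by ring, ?_, ?_⟩
    · have h1 : 10 * (e + 2) ^ 2 ≤ 10 * L ^ 2 := by
        gcongr
        exact hL.bits
      omega
    · simp only [Config.sameBelow_setVar, Nat.reduceLeDiff, Config.sameBelow_setMem]
      exact hs'.trans (Config.SameBelow.trans (by simp) (hs₁.mono (by norm_num)))
    · intro j hj
      rcases Nat.lt_succ_iff_lt_or_eq.1 hj with h | rfl
      · rw [if_neg (by omega), hm₁, hx j h]
      · rw [if_pos rfl]
    · intro a ha
      rw [if_neg (by omega), hm₁, hm a ha]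
  · rintro s' ⟨-, -, h, -⟩
    omega
  · simp
  · rintro T s' ⟨hT, hs', hc, -, -, hx, hm⟩
    refine ⟨?_, hs', hc, hx, hm⟩
    have h1 : n * (40 * L ^ 2) ≤ L * (40 * L ^ 2) := by
      gcongr
      have := hL.vars
      omega
    have h2 : L * (40 * L ^ 2) = 40 * L ^ 3 := by ring
    have h3 : L ^ 2 ≤ L ^ 3 := Nat.pow_le_pow_right (by omega) (by norm_num)
    omega

theorem drawMod_spec {ω : ℕ → Bool} {s : Config} {n : ℕ} {C : Circuit n} {k t e B L : ℕ}
    (hs : s.Ready C k t e B) (hL : SizeBound C k t e B L) :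
    WP ω drawMod s fun T s' => T ≤ 60 * L ^ 2 ∧ s.SameBelow 13 s' ∧ s'.coins = s.coins + B ∧
      s'.mem = s.mem ∧ s'.var 13 = num ω s.coins B + 1 ∧
      s'.var 14 = (num ω s.coins B + 1) ^ (k + 1) ∧ bitCost (num ω s.coins B + 1) ≤ L ∧
      bitCost ((num ω s.coins B + 1) ^ (k + 1)) ≤ L := by
  have hL4 := hL.four
  have hsq := four_mul_le_sq hL4
  set p := num ω s.coins B + 1 with hp
  have hmod := hL.modulus
  have hBL : B + 2 ≤ L := hL.base_add_two_le
  have hkL : k + 1 ≤ L := by nlinarith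
  have bp : bitCost p ≤ B + 2 := by
    refine bitCost_le (L := B + 1) ?_
    have h1 := num_lt ω s.coins B
    have h2 : 1 ≤ 2 ^ B := Nat.one_le_two_pow
    rw [pow_succ]
    omega
  -- Each factor `p ≤ 2 ^ B` contributes at most `B + 2`, and `SizeBound.modulus` leaves room for `k
  -- + 1` factors.
  have bpow : ∀ i ≤ k, bitCost (p ^ (i + 1)) ≤ L := by
    have : ∀ i, bitCost (p ^ (i + 1)) ≤ (i + 1) * (B + 2) := by
      intro i
      induction i with
      | zero => simpa using bp
      | succ i ih =>
        rw [pow_succ]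
        refine (bitCost_mul_le _ _).trans ?_
        rw [add_mul (i + 1)]
        omega
    intro i hi
    refine (this i).trans (le_trans ?_ hmod)
    gcongr
  have b1 : bitCost B ≤ L := (bitCost_le_self B).trans (by omega)
  have b2 : bitCost k ≤ L := (bitCost_le_self k).trans (by omega)
  simp only [drawMod, WP, Arith.eval, Config.setVar_var, reduceIte, Nat.reduceEqDiff, hs.h9,
    hs.h10, mul_one, bitCost_one]
  refine (randBits_spec (L := B) (by simpa using hs.h10) (by simp)).mono ?_
  rintro T₁ s₁ ⟨hT₁, hm₁, hc₁, hs₁, h24⟩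
  simp only [Config.setVar_var, reduceIte, Config.setVar_coins, Config.setVar_mem]
    at hm₁ hc₁ h24
  have f10 : s₁.var 10 = 1 := by rw [hs₁ 10 (by norm_num)]; simpa using hs.h10
  have f2 : s₁.var 2 = k := by rw [hs₁ 2 (by norm_num)]; simpa using hs.h2
  have b3 : bitCost (num ω s.coins B) ≤ B + 1 := bitCost_le (num_lt _ _ _)
  simp only [f10, f2, h24, ← hp, mul_one, bitCost_one]
  rw [← wp_iff]
  refine (wp_loop_const (N := k) (fun i s' => s.SameBelow 13 s' ∧ s'.coins = s.coins + B ∧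
    s'.mem = s.mem ∧ s'.var 13 = p ∧ s'.var 14 = p ^ (i + 1) ∧ s'.var 27 = k - i)
    (10 * L) ?_ ?_ ?_).mono ?_
  · rintro i hi s' ⟨hs', hc, hm, h13, h14, h27⟩
    have e10 : s'.var 10 = 1 := by rw [hs' 10 (by norm_num), hs.h10]
    refine ⟨by omega, ?_⟩
    have b4 := bpow i hi.le
    have b5 : bitCost (k - i) ≤ L := (bitCost_sub_le _ _).trans b2
    simp only [WP, Arith.eval, Config.setVar_var, Config.setVar_mem, Config.setVar_coins,
      reduceIte, Nat.reduceEqDiff, e10, h13, h14, h27, hm, hc, bitCost_one, true_and]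
    refine ⟨by omega, by simpa using hs', by ring, by omega⟩
  · rintro s' ⟨-, -, -, -, -, h⟩
    omega
  · have h : s.SameBelow 13 s₁ := Config.SameBelow.trans (by simp) (hs₁.mono (by norm_num))
    simp [h, hm₁, hc₁, hp]
  · rintro T s' ⟨hT, hs', hc, hm, h13, h14, -⟩
    refine ⟨?_, hs', hc, hm, h13, h14, by omega, bpow k le_rfl⟩
    have h1 : k * (10 * L) ≤ L * (10 * L) := by
      gcongr
      omega
    have h2 : L * (10 * L) = 10 * L ^ 2 := by ring
    have h3 : 10 * (B + 2) ^ 2 ≤ 10 * L ^ 2 := by gcongr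
    omega

/-- The result of a trial before the final reduction. -/
def trialSum {n : ℕ} (C : Circuit n) (k t p : ℕ) (x : ℕ → ℕ) : ℕ :=
  ∑ A ∈ Finset.range (2 ^ t), trialTerm C k t p (p ^ (k + 1)) x A

/-- The random number of variable `j` in a trial that uses the coins from `c` on. -/
def trialVar (ω : ℕ → Bool) (c e j : ℕ) : ℕ := num ω (c + j * e) e

/-- The random base of the modulus in a trial that uses the coins from `c` on. -/
def trialBase (ω : ℕ → Bool) (c n e B : ℕ) : ℕ := num ω (c + n * e) B + 1

/-- The trial that uses the coins from `c` on succeeds. -/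
def TrialSucceeds (ω : ℕ → Bool) {n : ℕ} (C : Circuit n) (k t e B c : ℕ) : Prop :=
  trialSum C k t (trialBase ω c n e B) (trialVar ω c e) % trialBase ω c n e B ^ (k + 1) ≠ 0

theorem iterate_sub_le {M a : ℕ} (h : a ≤ M) (i : ℕ) : (fun h => M - h)^[i] a ≤ M := by
  cases i with
  | zero => exact h
  | succ i => rw [Function.iterate_succ_apply']; exact Nat.sub_le _ _

theorem trialTerm_le {n : ℕ} (C : Circuit n) {k t p M : ℕ} (hM : 0 < M) (x : ℕ → ℕ) (A : ℕ) :
    trialTerm C k t p M x A ≤ M * (2 ^ t) ^ t := by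
  unfold trialTerm
  gcongr
  · exact iterate_sub_le (modInterp_le hM x C _) _
  · have h1 := popcount_le A t
    have h2 : popcount A t ≤ 2 ^ t := h1.trans Nat.lt_two_pow_self.le
    calc (popcount A t).descFactorial (t - k) ≤ popcount A t ^ (t - k) :=
          Nat.descFactorial_le_pow _ _
      _ ≤ (2 ^ t) ^ (t - k) := by gcongr
      _ ≤ (2 ^ t) ^ t := Nat.pow_le_pow_right (by positivity) (Nat.sub_le _ _)

theorem sumProg_spec {ω : ℕ → Bool} {s : Config} {n : ℕ} {C : Circuit n} {k t e B L : ℕ}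
    (hs : s.Ready C k t e B) (hL : SizeBound C k t e B L) {p M : ℕ} {x : ℕ → ℕ}
    (hx : ∀ j < n, s.mem (C.len + C.numGates + j) = x j) (hxe : ∀ j < n, x j < 2 ^ e)
    (h13 : s.var 13 = p) (h14 : s.var 14 = M) (hM : 0 < M) (b13 : bitCost p ≤ L)
    (b14 : bitCost M ≤ L) :
    WP ω sumProg s fun T s' => T ≤ 2 ^ t * (C.size * (400 * L ^ 2)) ∧ s.SameBelow 15 s' ∧
      s'.coins = s.coins ∧ s'.var 15 = ∑ A ∈ Finset.range (2 ^ t), trialTerm C k t p M x A ∧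
      bitCost (s'.var 15) ≤ 4 * L ∧
      ∀ a, a < C.len ∨ C.len + C.numGates ≤ a → s'.mem a = s.mem a := by
  have hL4 := hL.four
  have hsq := four_mul_le_sq hL4
  have htt := hL.colors
  have htL : t + 2 ≤ L := hL.colors_add_two_le
  have bt : bitCost t ≤ L := (bitCost_le_self t).trans (by omega)
  have bpow : ∀ i ≤ t, bitCost (2 ^ i) ≤ L := fun i hi =>
    (bitCost_le (L := i + 1) (by gcongr <;> omega)).trans (by omega)
  simp only [sumProg, WP, Arith.eval, Config.setVar_var, reduceIte, Nat.reduceEqDiff, hs.h5,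
    hs.h10, mul_one, bitCost_one, bitCost_zero]
  rw [← wp_iff]
  refine (wp_loop_const (N := t) (fun i s' => s.SameBelow 15 s' ∧ s'.coins = s.coins ∧
    s'.mem = s.mem ∧ s'.var 15 = 0 ∧ s'.var 16 = 2 ^ i ∧ s'.var 27 = t - i)
    (10 * L) ?_ ?_ ?_).mono ?_
  · rintro i hi s' ⟨hs', hc, hm, h15, h16, h27⟩
    have e10 : s'.var 10 = 1 := by rw [hs' 10 (by norm_num), hs.h10]
    refine ⟨by omega, ?_⟩
    have b4 := bpow i hi.le
    have b5 : bitCost (t - i) ≤ L := (bitCost_sub_le _ _).trans bt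
    simp only [WP, Arith.eval, Config.setVar_var, Config.setVar_mem, Config.setVar_coins,
      reduceIte, Nat.reduceEqDiff, e10, h15, h16, h27, hm, hc, bitCost_one, true_and]
    refine ⟨by omega, by simpa using hs', by ring, by omega⟩
  · rintro s' ⟨-, -, -, -, -, h⟩
    omega
  · simp
  rintro T₁ s₁ ⟨hT₁, hs₁, hc₁, hm₁, h15, h16, -⟩
  -- The running sum is not reduced before the end. It is at most `2 ^ t * M * (2 ^ t) ^ t`, and the
  -- three factors cost `L`, `L` and `L + 1`.
  have hbound : ∀ i ≤ 2 ^ t, bitCost (∑ j ∈ Finset.range i, trialTerm C k t p M x (2 ^ t - 1 - j))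
      ≤ 4 * L := by
    intro i hi
    have h1 : ∑ j ∈ Finset.range i, trialTerm C k t p M x (2 ^ t - 1 - j) ≤
        2 ^ t * (M * (2 ^ t) ^ t) := by
      refine (Finset.sum_le_card_nsmul _ _ _ fun j _ => trialTerm_le C hM x _).trans ?_
      simp only [Finset.card_range, smul_eq_mul]
      gcongr
    have h2 := bitCost_mul_le (2 ^ t) (M * (2 ^ t) ^ t)
    have h3 := bitCost_mul_le M ((2 ^ t) ^ t)
    have h4 : bitCost ((2 ^ t) ^ t) ≤ L + 1 := by
      apply bitCost_le
      rw [← pow_mul]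
      gcongr
      · norm_num
      · nlinarith
    have h5 := bpow t le_rfl
    exact (bitCost_mono h1).trans (by omega)
  refine (wp_loop_const (N := 2 ^ t) (fun i s' => s.SameBelow 15 s' ∧ s'.coins = s.coins ∧
    s'.var 15 = ∑ j ∈ Finset.range i, trialTerm C k t p M x (2 ^ t - 1 - j) ∧
    s'.var 16 = 2 ^ t - i ∧
    ∀ a, a < C.len ∨ C.len + C.numGates ≤ a → s'.mem a = s.mem a)
    (C.size * (320 * L ^ 2)) ?_ ?_ ?_).mono ?_
  · rintro i hi s' ⟨hs', hc, h15, h16, hm⟩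
    have e10 : s'.var 10 = 1 := by rw [hs' 10 (by norm_num), hs.h10]
    refine ⟨by omega, ?_⟩
    simp only [WP, Arith.eval, e10]
    have b5 : bitCost (2 ^ t - i) ≤ L := (bitCost_sub_le _ _).trans (bpow t le_rfl)
    have b6 : bitCost (2 ^ t - i - 1) ≤ L := (bitCost_sub_le _ _).trans b5
    refine (termProg_spec (s := s'.setVar 16 (s'.var 16 - 1)) (hs.trans ?_ ?_) hL (p := p) (M := M)
      (x := x) ?_ hxe ?_ ?_ hM b13 b14 ?_ ?_).mono ?_
    · intro v _ hv
      rw [Config.setVar_var, if_neg (by omega), hs' v (by omega)]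
    · intro a ha
      exact hm a (.inl ha)
    · intro j hj
      rw [Config.setVar_mem, hm _ (.inr (by omega)), hx j hj]
    · simp [hs' 13, h13]
    · simp [hs' 14, h14]
    · simpa [h16] using b6
    · simpa [h15] using hbound i hi.le
    · rintro T s₂ ⟨hT, hs₂, hc₂, k15, k16, hm₂⟩
      simp only [Config.setVar_var, reduceIte, Nat.reduceEqDiff, Config.setVar_coins,
        Config.setVar_mem, h16, h15] at hc₂ k15 k16 hm₂
      refine ⟨?_, ?_, hc₂.trans hc, ?_, ?_, ?_⟩
      · rw [h16, bitCost_one]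
        have h3 : L ^ 2 ≤ C.size * L ^ 2 := Nat.le_mul_of_pos_left _ C.one_le_size
        have h5 : C.size * (300 * L ^ 2) = 300 * (C.size * L ^ 2) := by ring
        have h6 : C.size * (320 * L ^ 2) = 320 * (C.size * L ^ 2) := by ring
        omega
      · exact Config.SameBelow.trans (by simpa using hs') hs₂
      · rw [k15, Finset.sum_range_succ]
        congr 2
        omega
      · omega
      · intro a ha
        rw [hm₂ a ha, hm a ha]
  · rintro s' ⟨-, -, -, h, -⟩
    omega
  · exact ⟨hs₁, hc₁, by simp [h15], by simp [h16], fun a _ => by rw [hm₁]⟩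
  rintro T₂ s₂ ⟨hT₂, hs₂, hc₂, k15, -, hm₂⟩
  refine ⟨?_, hs₂, hc₂, ?_, ?_, hm₂⟩
  · have h1 : t * (10 * L) ≤ L * (10 * L) := by gcongr; omega
    have h2 : L * (10 * L) = 10 * L ^ 2 := by ring
    have h3 : L ^ 2 ≤ 2 ^ t * (C.size * L ^ 2) :=
      (Nat.le_mul_of_pos_left _ C.one_le_size).trans (Nat.le_mul_of_pos_left _ (by positivity))
    have h5 : 2 ^ t * (C.size * (320 * L ^ 2)) = 320 * (2 ^ t * (C.size * L ^ 2)) := by ring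
    have h6 : 2 ^ t * (C.size * (400 * L ^ 2)) = 400 * (2 ^ t * (C.size * L ^ 2)) := by ring
    omega
  -- The register that holds `A` doubles as the loop counter, so the sets of colors are visited
  -- downwards from `2 ^ t - 1`.
  · rw [k15, Finset.sum_range_reflect]
  · rw [k15]
    exact hbound _ le_rfl

/-- The verdict in register 0 is only ever raised to `1`, never reset, so that after all trials it
records whether some trial succeeded. The number of coins used does not depend on their outcome,
which gives trial `i` a fixed block of coins. -/
theorem trialProg_spec {ω : ℕ → Bool} {s : Config} {n : ℕ} {C : Circuit n} {k t e B L : ℕ}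
    (hs : s.Ready C k t e B) (hL : SizeBound C k t e B L) [Decidable (TrialSucceeds ω C k t e B s.coins)] :
    WP ω trialProg s fun T s' => T ≤ 2 ^ t * (C.size * (600 * L ^ 3)) ∧
      (∀ v ≠ 0, v < 13 → s'.var v = s.var v) ∧ s'.coins = s.coins + (n * e + B) ∧
      s'.var 0 = (if TrialSucceeds ω C k t e B s.coins then 1 else s.var 0) ∧
      ∀ a < C.len, s'.mem a = s.mem a := by
  have hL4 := hL.four
  have hsq := four_mul_le_sq hL4
  have hcube : L ^ 2 ≤ L ^ 3 := Nat.pow_le_pow_right (by omega) (by norm_num)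
  refine WP.seq (drawVars_spec hs hL) ?_
  rintro T₁ s₁ ⟨hT₁, hs₁, hc₁, hx₁, hm₁⟩
  have hr₁ : s₁.Ready C k t e B :=
    hs.trans (fun v _ hv => hs₁ v (by omega)) fun a ha => hm₁ a (by omega)
  refine WP.seq (drawMod_spec hr₁ hL) ?_
  rintro T₂ s₂ ⟨hT₂, hs₂, hc₂, hm₂, h13, h14, b13, b14⟩
  rw [hc₁] at h13 h14 b13 b14
  have hr₂ : s₂.Ready C k t e B :=
    hr₁.trans (fun v _ hv => hs₂ v (by omega)) fun a ha => by rw [hm₂]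
  refine WP.seq (sumProg_spec hr₂ hL (x := trialVar ω s.coins e)
    (fun j hj => by rw [hm₂, hx₁ j hj, trialVar]) (fun j _ => num_lt _ _ _) h13 h14 (by positivity)
    b13 b14) ?_
  rintro T₃ s₃ ⟨hT₃, hs₃, hc₃, h15, b15, hm₃⟩
  have k14 := hs₃ 14 (by norm_num)
  rw [h14] at k14
  have hmod : ∀ a m, a - a / m * m = a % m := fun a m => Nat.mod_eq_sub_div_mul.symm
  set S := s₃.var 15 with hS
  set M := (num ω (s.coins + n * e) B + 1) ^ (k + 1) with hM
  have b1 := bitCost_div_le S M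
  have b2 : bitCost (S / M * M) ≤ bitCost S := bitCost_mono (Nat.div_mul_le_self _ _)
  have b3 : bitCost (S % M) ≤ bitCost S := bitCost_mono (Nat.mod_le _ _)
  have hsucc : TrialSucceeds ω C k t e B s.coins ↔ S % M ≠ 0 := by
    rw [h15, hM]
    rfl
  have hsame : s.SameBelow 13 s₃ :=
    (hs₁.mono (by norm_num)).trans (hs₂.trans (hs₃.mono (by norm_num)))
  have hmem : ∀ a < C.len, s₃.mem a = s.mem a := fun a ha => by
    rw [hm₃ a (.inl ha), hm₂, hm₁ a (by omega)]
  have hcost : T₁ + (T₂ + (T₃ + (200 * L))) ≤ 2 ^ t * (C.size * (600 * L ^ 3)) := by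
    have h3 : L ^ 3 ≤ 2 ^ t * (C.size * L ^ 3) :=
      (Nat.le_mul_of_pos_left _ C.one_le_size).trans (Nat.le_mul_of_pos_left _ (by positivity))
    have h4 : 2 ^ t * (C.size * (400 * L ^ 2)) ≤ 2 ^ t * (C.size * (400 * L ^ 3)) := by gcongr
    have h5 : 2 ^ t * (C.size * (400 * L ^ 3)) = 400 * (2 ^ t * (C.size * L ^ 3)) := by ring
    have h6 : 2 ^ t * (C.size * (600 * L ^ 3)) = 600 * (2 ^ t * (C.size * L ^ 3)) := by ring
    omega
  simp only [modProg, WP, Arith.eval, Config.setVar_var, reduceIte, Nat.reduceEqDiff, k14, hmod,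
    bitCost_one, ← hS, Config.setVar_mem, Config.setVar_coins, hsucc, hc₃, hc₂, hc₁]
  constructor
  · intro h
    refine ⟨by omega, ?_, by ring, by rw [if_pos h], hmem⟩
    intro v hv0 hv
    have : v ≠ 15 ∧ v ≠ 28 := by omega
    simp [this, hv0, hsame v hv]
  · intro h
    refine ⟨by omega, ?_, by ring, ?_, hmem⟩
    · intro v hv0 hv
      have : v ≠ 15 ∧ v ≠ 28 := by omega
      simp [this, hsame v hv]
    · rw [if_neg (by simpa using h)]
      exact hsame 0 (by norm_num)

/-! ### The algorithm -/

/-- Load the instance into variables. -/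
def loadProg : Prog :=
  .const 10 1 ;; .const 11 2 ;; .load 1 28 ;; .load 2 10 ;; .load 3 11 ;; .const 28 3 ;; .load 4 28

/-- Advance the pointer to the end of the input. -/
def skipProg : Prog :=
  .const 20 4 ;; .arith 21 .mul 3 10 ;;
  .loop 21 (.load 23 20 ;; .arith 20 .add 20 10 ;;
    .ite 23 (.arith 23 .sub 23 10 ;;
      .ite 23 (.load 25 20 ;; .arith 20 .add 20 10 ;; .arith 20 .add 20 25)
        (.arith 20 .add 20 11))
      (.arith 20 .add 20 10) ;;
    .arith 21 .sub 21 10)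

/-- Compute the addresses of the work space and the number of colors. -/
def layoutProg : Prog :=
  .arith 6 .mul 20 10 ;; .arith 7 .add 6 3 ;; .const 28 10 ;; .arith 28 .div 2 28 ;;
  .arith 18 .add 28 10 ;; .const 28 13 ;; .arith 5 .mul 18 28 ;; .arith 8 .add 5 5 ;;
  .arith 8 .add 8 1

/-- Compute the number of bits of the random base. -/
def bitsProg : Prog :=
  traversal heightVar heightConst heightStep heightFin ;;
  .arith 28 .add 6 4 ;; .load 28 28 ;; .arith 28 .add 28 5 ;; .arith 28 .add 28 28 ;;
  .const 29 4 ;; .arith 9 .add 28 29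

/-- Compute the number of trials. -/
def countProg : Prog :=
  .const 12 40 ;; .arith 12 .mul 12 9 ;; .arith 28 .add 5 10 ;; .arith 12 .mul 12 28 ;;
  .const 29 271 ;; .arith 27 .mul 18 10 ;;
  .loop 27 (.arith 12 .mul 12 29 ;; .arith 27 .sub 27 10)

def mainProg : Prog :=
  skipProg ;; layoutProg ;; bitsProg ;; countProg ;; .loop 12 (trialProg ;; .arith 12 .sub 12 10)

/-- The algorithm: it detects multilinear terms of degree `k`. -/
def detectProg : Prog :=
  loadProg ;; .arith 28 .sub 2 1 ;; .ite 28 .skip mainProg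

/-- The number of blocks of `13` colors. -/
def blocks (k : ℕ) : ℕ := k / 10 + 1

/-- The number of colors. -/
def colors (k : ℕ) : ℕ := 13 * blocks k

/-- The number of random bits for every variable. -/
def varBits (n k : ℕ) : ℕ := 2 * colors k + n

/-- The number of random bits for the base of the modulus. -/
def baseBits {n : ℕ} (C : Circuit n) (k : ℕ) : ℕ :=
  2 * (C.val (heightInterp (varBits n k)) C.out + colors k) + 4

/-- The number of trials. -/
def trials {n : ℕ} (C : Circuit n) (k : ℕ) : ℕ :=
  40 * baseBits C k * (colors k + 1) * 271 ^ blocks k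

/-- The number of coins that are flipped in a trial. -/
def trialCoins {n : ℕ} (C : Circuit n) (k : ℕ) : ℕ := n * varBits n k + baseBits C k

/-! ### Correctness and cost of the preparation and of the main loop -/

theorem skipProg_spec {ω : ℕ → Bool} {s : Config} {n : ℕ} {C : Circuit n} {k L : ℕ}
    (h10 : s.var 10 = 1) (h11 : s.var 11 = 2) (h3 : s.var 3 = C.numGates)
    (hmem : ∀ a < C.len, s.mem a = (C.encode k).getD a 0) (hL : 4 ≤ L)
    (hlen : bitCost (C.len + C.numGates) ≤ L) :
    WP ω skipProg s fun T s' => T ≤ C.size * (40 * L) ∧ s'.mem = s.mem ∧ s'.coins = s.coins ∧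
      s.SameBelow 20 s' ∧ s'.var 20 = C.len := by
  have b4 : bitCost 4 ≤ 4 := bitCost_le (L := 3) (by norm_num)
  have b3 : bitCost C.numGates ≤ L := (bitCost_mono (by omega)).trans hlen
  simp only [skipProg, WP, Arith.eval, Config.setVar_var, reduceIte, Nat.reduceEqDiff, h10, h3,
    mul_one, bitCost_one]
  rw [← wp_iff]
  refine (wp_loop_const (N := C.numGates) (fun i s' => s'.mem = s.mem ∧ s'.coins = s.coins ∧
    s.SameBelow 20 s' ∧ s'.var 20 = C.offset i ∧ s'.var 21 = C.numGates - i)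
    (20 * L) ?_ ?_ ?_).mono ?_
  · rintro i hi s' ⟨hm, hc, hs, h20, h21⟩
    have e10 : s'.var 10 = 1 := by rw [hs 10 (by norm_num), h10]
    have e11 : s'.var 11 = 2 := by rw [hs 11 (by norm_num), h11]
    have b5 : bitCost (C.numGates - i) ≤ L := (bitCost_sub_le _ _).trans b3
    have hoff := C.offset_succ i
    have hofflen := C.offset_le_len (i := i + 1) hi
    have hc0 : C.code i = (C.gate ⟨i, hi⟩).encode := by rw [Circuit.code, dif_pos hi]
    have hcode := fun r hr => C.mem_code (s := s) hmem (r := r) hi hr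
    have b1 : bitCost (C.offset i) ≤ L := (bitCost_mono (by omega)).trans hlen
    have key : ∀ op ≤ 1, ∀ l : List ℕ, C.code i = (2 + op) :: l.length :: l →
        s.mem (C.offset i) = 2 + op ∧ s.mem (C.offset i + 1) = l.length ∧
        C.offset (i + 1) = C.offset i + 1 + 1 + l.length ∧ bitCost l.length ≤ L ∧
        bitCost (C.offset i + 1) ≤ L ∧ bitCost (C.offset i + 1 + 1) ≤ L ∧
        bitCost (2 + op) ≤ 3 := by
      intro op hop l hc
      rw [hc] at hcode hoff
      simp only [List.length_cons] at hoff
      exact ⟨hcode 0 (by simp), hcode 1 (by simp), by omega, (bitCost_mono (by omega)).trans hlen,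
        (bitCost_mono (by omega)).trans hlen, (bitCost_mono (by omega)).trans hlen,
        (bitCost_mono (show 2 + op ≤ 3 by omega)).trans (bitCost_le (L := 2) (by norm_num))⟩
    refine ⟨by omega, ?_⟩
    cases hg : C.gate ⟨i, hi⟩ with
    | var j =>
      rw [hc0, hg, Gate.encode] at hcode hoff
      have e0 : s.mem (C.offset i) = 0 := hcode 0 (by simp)
      simp only [List.length_cons, List.length_nil, zero_add] at hoff
      have b2 : bitCost (C.offset i + 1) ≤ L := (bitCost_mono (by omega)).trans hlen
      simp [WP, Arith.eval, h20, e0, hm, e10, e11, h21, hc, hs]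
      omega
    | const z =>
      rw [hc0, hg, Gate.encode] at hcode hoff
      have e0 : s.mem (C.offset i) = 1 := hcode 0 (by simp)
      simp only [List.length_cons, List.length_nil, zero_add] at hoff
      have b2 : bitCost (C.offset i + 1) ≤ L := (bitCost_mono (by omega)).trans hlen
      simp [WP, Arith.eval, h20, e0, hm, e10, e11, h21, hc, hs]
      omega
    | add l =>
      obtain ⟨k1, k2, k3, k4, k5, k6, k7⟩ := key 0 (by omega) (l.map Fin.val)
        (by rw [hc0, hg]; simp [Gate.encode])
      simp [WP, Arith.eval, h20, k1, k2, hm, e10, h21, hc, hs]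
      simp at k3 k4
      omega
    | mul l =>
      obtain ⟨k1, k2, k3, k4, k5, k6, k7⟩ := key 1 (by omega) (l.map Fin.val)
        (by rw [hc0, hg]; simp [Gate.encode])
      simp [WP, Arith.eval, h20, k1, k2, hm, e10, h21, hc, hs]
      simp at k3 k4 k7
      omega
  · rintro s' ⟨-, -, -, -, h⟩
    omega
  · simp [Circuit.offset]
  · rintro T s' ⟨hT, hm, hc, hs, h20, -⟩
    refine ⟨?_, hm, hc, hs, h20⟩
    have h1 : C.numGates * (20 * L) ≤ C.size * (20 * L) := by gcongr; exact C.numGates_le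
    have h2 : L ≤ C.size * L := Nat.le_mul_of_pos_left _ C.one_le_size
    have h3 : C.size * (20 * L) = 20 * (C.size * L) := by ring
    have h4 : C.size * (40 * L) = 40 * (C.size * L) := by ring
    omega

theorem bitsProg_spec {ω : ℕ → Bool} {s : Config} {n : ℕ} {C : Circuit n} {k L : ℕ}
    (h3 : s.var 3 = C.numGates) (h4 : s.var 4 = C.out) (h5 : s.var 5 = colors k)
    (h6 : s.var 6 = C.len) (h8 : s.var 8 = varBits n k)
    (h10 : s.var 10 = 1) (h11 : s.var 11 = 2)
    (hmem : ∀ a < C.len, s.mem a = (C.encode k).getD a 0)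
    (hL : SizeBound C k (colors k) (varBits n k) (baseBits C k) L)
    (hval : ∀ i < C.numGates, bitCost (C.val (heightInterp (varBits n k)) i) ≤ L) :
    WP ω bitsProg s fun T s' => T ≤ C.size * (200 * L ^ 2) ∧ s'.coins = s.coins ∧
      (∀ v ≠ 9, v < 20 → s'.var v = s.var v) ∧ s'.var 9 = baseBits C k ∧
      ∀ a < C.len, s'.mem a = s.mem a := by
  have hL4 := hL.four
  have hsq := four_mul_le_sq hL4
  have b8 : bitCost (varBits n k) ≤ L :=
    (bitCost_le_self _).trans (by have := hL.bits; omega)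
  have himp := heightInterp_implements (ω := ω) n h10 h11 hL4 (by rwa [h8])
  rw [h8] at himp
  refine WP.seq (traversal_spec himp hL4 h3 h6 hmem
    ((bitCost_mono (Nat.le_add_right _ _)).trans hL.addr) hval
    ((bitCost_mono (Nat.le_add_left _ _)).trans hL.addr) hL.size) ?_
  rintro T₁ s₁ ⟨hT₁, hs₁, hc₁, hv₁⟩
  have e6 := hs₁.1 6 (by norm_num)
  have e4 := hs₁.1 4 (by norm_num)
  have e5 := hs₁.1 5 (by norm_num)
  have hout := hv₁ C.out C.out.2
  set u := C.val (heightInterp (varBits n k)) C.out with hu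
  have bu : bitCost u ≤ L := hval _ C.out.2
  have b1 : bitCost (C.len + C.out) ≤ L :=
    (bitCost_mono (by have := C.out.2; omega)).trans hL.addr
  have b2 : bitCost C.len ≤ L := (bitCost_mono (by omega)).trans hL.addr
  have b3 : bitCost C.out ≤ L := (bitCost_mono (by have := C.out.2; omega)).trans hL.addr
  have b5 : bitCost (colors k) ≤ L := (bitCost_le_self _).trans (by have := hL.colors_add_two_le; omega)
  have b7 := bitCost_add_le u (colors k)
  have b9 := bitCost_add_le (u + colors k) (u + colors k)
  have b10 : bitCost 4 ≤ 4 := bitCost_le (L := 3) (by norm_num)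
  simp only [WP, Arith.eval, Config.setVar_var, Config.setVar_mem, Config.setVar_coins, e4, e5, e6,
    h4, h5, h6, reduceIte, Nat.reduceEqDiff, hout, hc₁, true_and]
  refine ⟨?_, ?_, ?_, ?_⟩
  · have h2 : L ^ 2 ≤ C.size * L ^ 2 := Nat.le_mul_of_pos_left _ C.one_le_size
    have h3 : C.size * (40 * L ^ 2 + 50 * L) ≤ C.size * (60 * L ^ 2) := by
      gcongr
      omega
    have h4 : C.size * (60 * L ^ 2) = 60 * (C.size * L ^ 2) := by ring
    have h5 : C.size * (200 * L ^ 2) = 200 * (C.size * L ^ 2) := by ring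
    omega
  · intro v hv9 hv
    have : v ≠ 28 ∧ v ≠ 29 := by omega
    simp [this, hv9, hs₁.1 v hv]
  · rw [baseBits, ← hu]
    ring
  · intro a ha
    exact hs₁.2 a (by omega)

theorem countProg_spec {ω : ℕ → Bool} {s : Config} {n : ℕ} {C : Circuit n} {k L : ℕ}
    (h5 : s.var 5 = colors k) (h9 : s.var 9 = baseBits C k) (h10 : s.var 10 = 1)
    (h18 : s.var 18 = blocks k)
    (hL : SizeBound C k (colors k) (varBits n k) (baseBits C k) L) :
    WP ω countProg s fun T s' => T ≤ 40 * L ^ 2 ∧ s'.coins = s.coins ∧ s'.mem = s.mem ∧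
      s.SameBelow 12 s' ∧ s'.var 12 = trials C k ∧ bitCost (trials C k) ≤ 4 * L := by
  have hL4 := hL.four
  have hsq := four_mul_le_sq hL4
  have hpos := hL.pos
  have htL := hL.colors_add_two_le
  have hBL := hL.base_add_two_le
  have b5 : bitCost (colors k) ≤ L := (bitCost_le_self _).trans (by omega)
  have b51 : bitCost (colors k + 1) ≤ L := (bitCost_le_self _).trans (by omega)
  have b9 : bitCost (baseBits C k) ≤ L := (bitCost_le_self _).trans (by omega)
  have hq : 13 * blocks k + 2 ≤ L := by rwa [colors] at htL
  have b18 : bitCost (blocks k) ≤ L := (bitCost_le_self _).trans (by omega)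
  have b40 : bitCost 40 ≤ 7 := bitCost_le (L := 6) (by norm_num)
  have b271 : bitCost 271 ≤ 10 := bitCost_le (L := 9) (by norm_num)
  have b1 := bitCost_mul_le 40 (baseBits C k)
  have b2 := bitCost_mul_le (40 * baseBits C k) (colors k + 1)
  -- As `271 < 2 ^ 9`, the power costs at most `9 * i + 2`, which is covered by `13 * blocks k + 2 ≤
  -- L`.
  have bpow : ∀ i ≤ blocks k, bitCost (40 * baseBits C k * (colors k + 1) * 271 ^ i) ≤ 4 * L := by
    intro i hi
    have h1 := bitCost_mul_le (40 * baseBits C k * (colors k + 1)) (271 ^ i)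
    have h2 : bitCost (271 ^ i) ≤ 9 * i + 2 := by
      apply bitCost_le
      calc 271 ^ i ≤ (2 ^ 9) ^ i := by gcongr; norm_num
        _ = 2 ^ (9 * i) := by rw [pow_mul]
        _ < 2 ^ (9 * i + 1) := by gcongr <;> omega
    have h3 : 4 ≤ blocks k * 4 := Nat.le_mul_of_pos_left _ (Nat.succ_pos _)
    omega
  simp only [countProg, WP, Arith.eval, Config.setVar_var, reduceIte, Nat.reduceEqDiff, h5, h9,
    h10, h18, mul_one, bitCost_one]
  rw [← wp_iff]
  refine (wp_loop_const (N := blocks k) (fun i s' => s.SameBelow 12 s' ∧ s'.coins = s.coins ∧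
    s'.mem = s.mem ∧ s'.var 29 = 271 ∧ s'.var 27 = blocks k - i ∧
    s'.var 12 = 40 * baseBits C k * (colors k + 1) * 271 ^ i) (10 * L) ?_ ?_ ?_).mono ?_
  · rintro i hi s' ⟨hs', hc, hm, h29, h27, h12⟩
    have e10 : s'.var 10 = 1 := by rw [hs' 10 (by norm_num), h10]
    refine ⟨by omega, ?_⟩
    have b4 := bpow i hi.le
    have b6 : bitCost (blocks k - i) ≤ L := (bitCost_sub_le _ _).trans b18
    simp only [WP, Arith.eval, Config.setVar_var, Config.setVar_mem, Config.setVar_coins,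
      reduceIte, Nat.reduceEqDiff, e10, h12, h29, h27, hm, hc, bitCost_one, true_and]
    refine ⟨by omega, by simpa using hs', by omega, by ring⟩
  · rintro s' ⟨-, -, -, -, h, -⟩
    omega
  · simp
  · rintro T s' ⟨hT, hs', hc, hm, -, -, h12⟩
    refine ⟨?_, hc, hm, hs', h12, bpow _ le_rfl⟩
    have h1 : blocks k * (10 * L) ≤ L * (10 * L) := by gcongr; omega
    have h2 : L * (10 * L) = 10 * L ^ 2 := by ring
    omega

open Classical in
theorem trialLoop_spec {ω : ℕ → Bool} {s : Config} {n : ℕ} {C : Circuit n} {k L : ℕ}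
    (hs : s.Ready C k (colors k) (varBits n k) (baseBits C k)) (h0 : s.var 0 = 0)
    (h12 : s.var 12 = trials C k) (bt : bitCost (trials C k) ≤ 4 * L) (hc : s.coins = 0)
    (hL : SizeBound C k (colors k) (varBits n k) (baseBits C k) L) :
    WP ω (.loop 12 (trialProg ;; .arith 12 .sub 12 10)) s fun T s' =>
      T ≤ trials C k * (2 ^ colors k * (C.size * (700 * L ^ 3))) + 1 ∧
      s'.var 0 = if ∃ i < trials C k, TrialSucceeds ω C k (colors k) (varBits n k) (baseBits C k)
        (i * trialCoins C k) then 1 else 0 := by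
  have hL4 := hL.four
  refine (wp_loop_const (N := trials C k) (fun i s' =>
    s'.Ready C k (colors k) (varBits n k) (baseBits C k) ∧ s'.coins = i * trialCoins C k ∧
    s'.var 12 = trials C k - i ∧ s'.var 0 = if ∃ j < i, TrialSucceeds ω C k (colors k)
      (varBits n k) (baseBits C k) (j * trialCoins C k) then 1 else 0)
    (2 ^ colors k * (C.size * (700 * L ^ 3))) ?_ ?_ ?_).mono ?_
  · rintro i hi s' ⟨hs', hc', h12', h0'⟩
    refine ⟨by omega, ?_⟩
    refine WP.seq (trialProg_spec hs' hL) ?_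
    rintro T s₁ ⟨hT, hv, hc₁, k0, hm⟩
    have hs₁ : s₁.Ready C k (colors k) (varBits n k) (baseBits C k) :=
      hs'.trans (fun v h0 hv' => hv v h0 (by omega)) hm
    have b1 : bitCost (trials C k - i) ≤ 4 * L := (bitCost_sub_le _ _).trans bt
    simp only [WP, Arith.eval, Config.setVar_var, Config.setVar_coins, reduceIte, Nat.reduceEqDiff,
      hs₁.h10, hv 12 (by norm_num) (by norm_num), h12', hc₁, hc', bitCost_one]
    refine ⟨?_, ?_, ?_, by omega, ?_⟩
    · have h1 : L ≤ 2 ^ colors k * (C.size * L ^ 3) :=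
        (Nat.le_self_pow (by norm_num) L).trans ((Nat.le_mul_of_pos_left _ C.one_le_size).trans
          (Nat.le_mul_of_pos_left _ (by positivity)))
      have h2 : 2 ^ colors k * (C.size * (600 * L ^ 3)) =
        600 * (2 ^ colors k * (C.size * L ^ 3)) := by ring
      have h3 : 2 ^ colors k * (C.size * (700 * L ^ 3)) =
        700 * (2 ^ colors k * (C.size * L ^ 3)) := by ring
      omega
    · exact hs₁.trans (fun v _ hv' => by rw [Config.setVar_var, if_neg (by omega)]) (by simp)
    · rw [trialCoins]
      ring
    · rw [k0, hc', h0']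
      simp only [Nat.lt_succ_iff_lt_or_eq, or_and_right, exists_or, exists_eq_left]
      by_cases h1 : TrialSucceeds ω C k (colors k) (varBits n k) (baseBits C k) (i * trialCoins C k)
        <;> simp [h1]
  · rintro s' ⟨-, -, h, -⟩
    omega
  · exact ⟨hs, by simp [hc], by simp [h12], by simp [h0]⟩
  · rintro T s' ⟨hT, -, -, -, h⟩
    exact ⟨hT, h⟩

theorem one_le_trials {n : ℕ} (C : Circuit n) (k : ℕ) : 1 ≤ trials C k := by
  have : 0 < baseBits C k := Nat.succ_pos _
  exact Nat.one_le_iff_ne_zero.2 (by unfold trials; positivity)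

open Classical in
theorem mainProg_spec {ω : ℕ → Bool} {s : Config} {n : ℕ} {C : Circuit n} {k L : ℕ}
    (h0 : s.var 0 = 0) (h1 : s.var 1 = n) (h2 : s.var 2 = k) (h3 : s.var 3 = C.numGates)
    (h4 : s.var 4 = C.out) (h10 : s.var 10 = 1) (h11 : s.var 11 = 2) (hc : s.coins = 0)
    (hmem : ∀ a < C.len, s.mem a = (C.encode k).getD a 0)
    (hL : SizeBound C k (colors k) (varBits n k) (baseBits C k) L)
    (hval : ∀ i < C.numGates, bitCost (C.val (heightInterp (varBits n k)) i) ≤ L) :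
    WP ω mainProg s fun T s' =>
      T ≤ trials C k * (2 ^ colors k * (C.size * (1100 * L ^ 3))) ∧
      s'.var 0 = if ∃ i < trials C k, TrialSucceeds ω C k (colors k) (varBits n k) (baseBits C k)
        (i * trialCoins C k) then 1 else 0 := by
  have hL4 := hL.four
  have hsq := four_mul_le_sq hL4
  have hlen : bitCost (C.len + C.numGates) ≤ L :=
    (bitCost_mono (Nat.le_add_right _ _)).trans hL.addr
  refine WP.seq (skipProg_spec h10 h11 h3 hmem hL4 hlen) ?_
  rintro T₁ s₁ ⟨hT₁, hm₁, hc₁, hs₁, e20⟩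
  have e1 := hs₁ 1 (by norm_num)
  have e2 := hs₁ 2 (by norm_num)
  have e3 := hs₁ 3 (by norm_num)
  have e10 := hs₁ 10 (by norm_num)
  rw [h1] at e1
  rw [h2] at e2
  rw [h3] at e3
  rw [h10] at e10
  have hcol : colors k = 13 * blocks k := rfl
  have htL := hL.colors_add_two_le
  have b1 : bitCost C.len ≤ L := (bitCost_mono (by omega)).trans hlen
  have b2 : bitCost C.numGates ≤ L := (bitCost_mono (by omega)).trans hlen
  have b3 : bitCost k ≤ L := (bitCost_le_self k).trans (by have := hL.le; omega)
  have b4 : bitCost n ≤ L := (bitCost_le_self n).trans hL.vars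
  have b5 : bitCost (k / 10) ≤ L := (bitCost_div_le _ _).trans b3
  have b6 : bitCost (k / 10 + 1) ≤ L := by
    refine (bitCost_le_self (blocks k)).trans ?_
    omega
  have b7 : bitCost ((k / 10 + 1) * 13) ≤ L := by
    rw [mul_comm]
    exact (bitCost_le_self (colors k)).trans (by omega)
  have b8 := bitCost_add_le ((k / 10 + 1) * 13) ((k / 10 + 1) * 13)
  have b9 : bitCost 10 ≤ 5 := bitCost_le (L := 4) (by norm_num)
  have b10 : bitCost 13 ≤ 5 := bitCost_le (L := 4) (by norm_num)
  have hlay : WP ω layoutProg s₁ fun T s' => T ≤ 40 * L ∧ s'.mem = s.mem ∧ s'.coins = 0 ∧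
      s'.var 0 = 0 ∧ s'.var 1 = n ∧ s'.var 2 = k ∧ s'.var 3 = C.numGates ∧ s'.var 4 = C.out ∧
      s'.var 5 = colors k ∧ s'.var 6 = C.len ∧ s'.var 7 = C.len + C.numGates ∧
      s'.var 8 = varBits n k ∧ s'.var 10 = 1 ∧ s'.var 11 = 2 ∧ s'.var 18 = blocks k := by
    simp only [layoutProg, WP, Arith.eval, Config.setVar_var, Config.setVar_mem,
      Config.setVar_coins, reduceIte, Nat.reduceEqDiff, e1, e2, e3, e10, e20, mul_one, bitCost_one,
      hm₁, hc₁, hc, OfNat.zero_ne_ofNat, OfNat.one_ne_ofNat, hs₁ 0 (by norm_num),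
      hs₁ 4 (by norm_num), hs₁ 11 (by norm_num), h0, h4, h11, true_and]
    refine ⟨by omega, ?_, ?_, rfl⟩
    · rw [hcol, blocks, mul_comm]
    · rw [varBits, hcol, blocks]
      ring
  refine WP.seq hlay ?_
  rintro T₂ s₂ ⟨hT₂, hm₂, hc₂, f0, f1, f2, f3, f4, f5, f6, f7, f8, f10, f11, f18⟩
  refine WP.seq (bitsProg_spec f3 f4 f5 f6 f8 f10 f11 (by rwa [hm₂]) hL hval) ?_
  rintro T₃ s₃ ⟨hT₃, hc₃, hs₃, h9, hm₃⟩
  have g (v : ℕ) (h9 : v ≠ 9 := by norm_num) (hv : v < 20 := by norm_num) := hs₃ v h9 hv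
  refine WP.seq (countProg_spec ((g 5).trans f5) h9 ((g 10).trans f10) ((g 18).trans f18) hL) ?_
  rintro T₄ s₄ ⟨hT₄, hc₄, hm₄, hs₄, h12, bt⟩
  have hready : s₃.Ready C k (colors k) (varBits n k) (baseBits C k) :=
    { h1 := (g 1).trans f1
      h2 := (g 2).trans f2
      h3 := (g 3).trans f3
      h4 := (g 4).trans f4
      h5 := (g 5).trans f5
      h6 := (g 6).trans f6
      h7 := (g 7).trans f7
      h8 := (g 8).trans f8
      h9 := h9
      h10 := (g 10).trans f10
      h11 := (g 11).trans f11
      mem := fun a ha => by rw [hm₃ a ha, hm₂, hmem a ha] }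
  refine (trialLoop_spec (hready.trans (fun v _ hv => hs₄ v hv) fun a _ => by rw [hm₄])
    (by rw [hs₄ 0 (by norm_num), g 0, f0]) h12 bt (by rw [hc₄, hc₃, hc₂]) hL).mono ?_
  rintro T₅ s₅ ⟨hT₅, h⟩
  refine ⟨?_, h⟩
  set R := trials C k
  have k1 : C.size * L ^ 3 ≤ R * (2 ^ colors k * (C.size * L ^ 3)) :=
    (Nat.le_mul_of_pos_left _ (by positivity)).trans (Nat.le_mul_of_pos_left _ (one_le_trials C k))
  have k2 : L ^ 2 ≤ L ^ 3 := Nat.pow_le_pow_right (by omega) (by norm_num)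
  have k3 : L ^ 3 ≤ C.size * L ^ 3 := Nat.le_mul_of_pos_left _ C.one_le_size
  have k4 : C.size * (40 * L) ≤ C.size * (40 * L ^ 3) := by gcongr; omega
  have k5 : C.size * (200 * L ^ 2) ≤ C.size * (200 * L ^ 3) := by gcongr
  have k6 : C.size * (40 * L ^ 3) = 40 * (C.size * L ^ 3) := by ring
  have k7 : C.size * (200 * L ^ 3) = 200 * (C.size * L ^ 3) := by ring
  have k8 : R * (2 ^ colors k * (C.size * (700 * L ^ 3))) =
    700 * (R * (2 ^ colors k * (C.size * L ^ 3))) := by ring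
  have k9 : R * (2 ^ colors k * (C.size * (1100 * L ^ 3))) =
    1100 * (R * (2 ^ colors k * (C.size * L ^ 3))) := by ring
  omega

theorem loadProg_spec {ω : ℕ → Bool} {n : ℕ} (C : Circuit n) (k : ℕ) :
    WP ω loadProg (C.init k) fun T s =>
      T ≤ 30 + bitCost n + bitCost k + bitCost C.numGates + bitCost C.out ∧
      s.mem = (C.init k).mem ∧ s.coins = 0 ∧ s.var 0 = 0 ∧ s.var 1 = n ∧ s.var 2 = k ∧
      s.var 3 = C.numGates ∧ s.var 4 = C.out ∧ s.var 10 = 1 ∧ s.var 11 = 2 := by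
  have b3 : bitCost 3 ≤ 3 := bitCost_le (L := 2) (by norm_num)
  have m0 : (C.init k).mem 0 = n := by simp [Circuit.init, Circuit.encode]
  have m1 : (C.init k).mem 1 = k := by simp [Circuit.init, Circuit.encode]
  have m2 : (C.init k).mem 2 = C.numGates := by simp [Circuit.init, Circuit.encode]
  have m3 : (C.init k).mem 3 = C.out := by simp [Circuit.init, Circuit.encode]
  have hv : ∀ v, (C.init k).var v = 0 := fun _ => rfl
  have hc : (C.init k).coins = 0 := rfl
  simp [loadProg, WP, hv, hc, m0, m1, m2, m3]
  omega

open Classical in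
theorem detectProg_spec {ω : ℕ → Bool} {n : ℕ} {C : Circuit n} {k L : ℕ} (hk : k ≤ n)
    (hL : SizeBound C k (colors k) (varBits n k) (baseBits C k) L)
    (hval : ∀ i < C.numGates, bitCost (C.val (heightInterp (varBits n k)) i) ≤ L) :
    WP ω detectProg (C.init k) fun T s' =>
      T ≤ trials C k * (2 ^ colors k * (C.size * (1200 * L ^ 3))) ∧
      s'.var 0 = if ∃ i < trials C k, TrialSucceeds ω C k (colors k) (varBits n k) (baseBits C k)
        (i * trialCoins C k) then 1 else 0 := by
  have hL4 := hL.four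
  have haddr := hL.addr
  refine WP.seq (loadProg_spec C k) ?_
  rintro T s ⟨hT, hm, hc, h0, h1, h2, h3, h4, h10, h11⟩
  have hkn : k - n = 0 := by omega
  simp only [WP, Arith.eval, Config.setVar_var, reduceIte, h1, h2, hkn, bitCost_zero,
    ne_eq, not_true_eq_false, false_implies, true_and, forall_const]
  refine (mainProg_spec (s := s.setVar 28 0) (by simpa) (by simpa) (by simpa) (by simpa) (by simpa)
    (by simpa) (by simpa) hc ?_ hL hval).mono ?_
  · intro a _
    rw [Config.setVar_mem, hm]
    rfl
  rintro T' s' ⟨hT', h⟩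
  refine ⟨?_, h⟩
  have b1 : bitCost n ≤ L := (bitCost_mono (by omega)).trans haddr
  have b2 : bitCost k ≤ L := (bitCost_mono (by omega)).trans haddr
  have b3 : bitCost C.numGates ≤ L := (bitCost_mono (by omega)).trans haddr
  have b4 : bitCost C.out ≤ L := (bitCost_mono (by have := C.out.2; omega)).trans haddr
  set R := trials C k
  have k1 : C.size * L ^ 3 ≤ R * (2 ^ colors k * (C.size * L ^ 3)) :=
    (Nat.le_mul_of_pos_left _ (by positivity)).trans (Nat.le_mul_of_pos_left _ (one_le_trials C k))
  have k3 : L ^ 3 ≤ C.size * L ^ 3 := Nat.le_mul_of_pos_left _ C.one_le_size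
  have k4 : L ≤ L ^ 3 := Nat.le_self_pow (by norm_num) L
  have k8 : R * (2 ^ colors k * (C.size * (1200 * L ^ 3))) =
    1200 * (R * (2 ^ colors k * (C.size * L ^ 3))) := by ring
  have k9 : R * (2 ^ colors k * (C.size * (1100 * L ^ 3))) =
    1100 * (R * (2 ^ colors k * (C.size * L ^ 3))) := by ring
  omega

/-- A multilinear monomial has degree at most `n`, so rejecting at once is correct. The case is
split off because a polynomial in `n`, the depth and the logarithm of the size cannot absorb
polynomial factors in `k` when `k` exceeds `n`. -/
theorem detectProg_spec_of_lt {ω : ℕ → Bool} {n : ℕ} {C : Circuit n} {k : ℕ} (hk : n < k) :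
    WP ω detectProg (C.init k) fun T s' => T ≤ 100 * (k + 1) * (Nat.size C.size + 1) ∧
      s'.var 0 = 0 := by
  refine WP.seq (loadProg_spec C k) ?_
  rintro T s ⟨hT, hm, hc, h0, h1, h2, h3, h4, h10, h11⟩
  have hkn : k - n ≠ 0 := by omega
  simp only [WP, Arith.eval, Config.setVar_var, reduceIte, h1, h2, ne_eq, hkn, not_false_eq_true,
    false_implies, and_true, forall_const, OfNat.zero_ne_ofNat, h0]
  have b1 : bitCost n ≤ k + 1 := (bitCost_mono hk.le).trans (bitCost_le_self k)
  have b2 : bitCost k ≤ k + 1 := bitCost_le_self k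
  have b3 : bitCost C.numGates ≤ Nat.size C.size + 1 := bitCost_mono C.numGates_le
  have b4 : bitCost C.out ≤ Nat.size C.size + 1 := bitCost_mono (C.out.2.le.trans C.numGates_le)
  have b5 := bitCost_sub_le k n
  have h1 : k + 1 ≤ (k + 1) * (Nat.size C.size + 1) := Nat.le_mul_of_pos_right _ (Nat.succ_pos _)
  have h2 : Nat.size C.size + 1 ≤ (k + 1) * (Nat.size C.size + 1) :=
    Nat.le_mul_of_pos_left _ (Nat.succ_pos _)
  rw [mul_assoc]
  omega

/-! ### The value of a trial -/

section Weights

/-- Distributivity, with the choice of a summand in each factor encoded by the binary digits of `A`.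
-/
theorem sum_range_two_pow_prod {R : Type*} [CommSemiring R] (g : ℕ → ℕ → R) (t : ℕ) :
    ∑ A ∈ Finset.range (2 ^ t), ∏ i ∈ Finset.range t, g i (A / 2 ^ i % 2) =
      ∏ i ∈ Finset.range t, (g i 0 + g i 1) := by
  induction t with
  | zero => simp
  | succ t ih =>
    have h1 : ∀ A ∈ Finset.range (2 ^ t), ∏ i ∈ Finset.range (t + 1), g i (A / 2 ^ i % 2) =
        (∏ i ∈ Finset.range t, g i (A / 2 ^ i % 2)) * g t 0 := by
      intro A hA
      rw [Finset.prod_range_succ, Nat.div_eq_of_lt (Finset.mem_range.1 hA)]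
    have h2 : ∀ A ∈ Finset.range (2 ^ t),
        ∏ i ∈ Finset.range (t + 1), g i ((2 ^ t + A) / 2 ^ i % 2) =
        (∏ i ∈ Finset.range t, g i (A / 2 ^ i % 2)) * g t 1 := by
      intro A hA
      rw [Finset.prod_range_succ]
      congr 1
      -- Adding `2 ^ t` does not affect digit `i < t`, because `2 ^ t` is a multiple of `2 ^ (i +
      -- 1)`.
      · refine Finset.prod_congr rfl fun i hi => ?_
        have hi := Finset.mem_range.1 hi
        obtain ⟨d, rfl⟩ := Nat.exists_eq_add_of_lt hi
        have : 2 ^ (i + d + 1) = 2 ^ i * (2 * 2 ^ d) := by ring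
        rw [this, Nat.mul_add_div (by positivity), Nat.mul_add_mod]
      · rw [Nat.add_div_left _ (by positivity), Nat.div_eq_of_lt (Finset.mem_range.1 hA)]
    rw [pow_succ, mul_two, Finset.sum_range_add, Finset.sum_congr rfl h1, Finset.sum_congr rfl h2,
      ← Finset.sum_mul, ← Finset.sum_mul, ih, ← mul_add, Finset.prod_range_succ]

open Polynomial in
theorem prod_bits (T : Finset ℕ) (A t : ℕ) :
    ∏ i ∈ Finset.range t, (if A / 2 ^ i % 2 = 1 then (1 + X : ℤ[X]) else if i ∈ T then 0 else -1) =
      C ((∏ i ∈ Finset.range t, if i ∈ T then ((A / 2 ^ i % 2 : ℕ) : ℤ) else 1) *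
        (-1) ^ (t - popcount A t)) * (1 + X) ^ popcount A t := by
  induction t with
  | zero => simp [popcount]
  | succ t ih =>
    have hle := popcount_le A t
    have hpop : popcount A (t + 1) = popcount A t + A / 2 ^ t % 2 := by
      simp [popcount, Finset.sum_range_succ]
    rw [Finset.prod_range_succ, ih, Finset.prod_range_succ, hpop]
    rcases Nat.mod_two_eq_zero_or_one (A / 2 ^ t) with h | h
    · rw [h, add_zero, Nat.succ_sub hle]
      by_cases hT : t ∈ T
      · simp [hT]
      · simp [hT, pow_succ]
    · rw [h, Nat.add_sub_add_right]
      by_cases hT : t ∈ T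
      · simp [hT, pow_succ, mul_assoc]
      · simp [hT, pow_succ, mul_assoc]

open Polynomial in
-- Summing `(-1) ^ (t - |A|) * (1 + X) ^ |A|` over all `A ⊇ T` gives `(1 + X) ^ |T| * ((1 + X) - 1)
-- ^ (t - |T|)`, because every color outside `T` contributes `(1 + X)` or `-1`. The coefficient of
-- `X ^ (t - k)` is `1` if `|T| = k` and `0` if `|T| < k`. On the left it is a binomial coefficient
-- of `|A|`; multiplication by `(t - k)!` turns it into the falling factorial that the machine
-- computes without division.
theorem sum_color_weights {T : Finset ℕ} {t k : ℕ} (hT : T ⊆ Finset.range t) (hk : k ≤ t)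
    (hTk : T.card ≤ k) :
    ∑ A ∈ Finset.range (2 ^ t),
      (∏ i ∈ Finset.range t, if i ∈ T then ((A / 2 ^ i % 2 : ℕ) : ℤ) else 1) *
        ((-1) ^ (t - popcount A t) * ((popcount A t).descFactorial (t - k) : ℤ)) =
      if T.card = k then ((t - k).factorial : ℤ) else 0 := by
  have h2 : ∏ i ∈ Finset.range t, ((if 0 = 1 then (1 + X : ℤ[X]) else if i ∈ T then 0 else -1) +
      if 1 = 1 then (1 + X : ℤ[X]) else if i ∈ T then 0 else -1) =
      (1 + X) ^ T.card * X ^ (t - T.card) := by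
    have : ∀ i ∈ Finset.range t, ((if 0 = 1 then (1 + X : ℤ[X]) else if i ∈ T then 0 else -1) +
      if 1 = 1 then (1 + X : ℤ[X]) else if i ∈ T then 0 else -1) =
      if i ∈ T then 1 + X else X := by
      intro i _
      by_cases h : i ∈ T <;> simp [h]
    rw [Finset.prod_congr rfl this, Finset.prod_ite]
    simp only [Finset.prod_const]
    have e1 : (Finset.range t).filter (· ∈ T) = T := by
      ext i
      simp only [Finset.mem_filter, and_iff_right_iff_imp]
      exact fun h => hT h
    have e2 : (Finset.range t).filter (· ∉ T) = Finset.range t \ T := by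
      ext i
      simp
    rw [e1, e2, Finset.card_sdiff_of_subset hT, Finset.card_range]
  have h1 : ∑ A ∈ Finset.range (2 ^ t),
      C ((∏ i ∈ Finset.range t, if i ∈ T then ((A / 2 ^ i % 2 : ℕ) : ℤ) else 1) *
        (-1) ^ (t - popcount A t)) * (1 + X) ^ popcount A t =
      (1 + X) ^ T.card * X ^ (t - T.card) := by
    rw [← h2, ← sum_range_two_pow_prod
      (fun i b => if b = 1 then (1 + X : ℤ[X]) else if i ∈ T then 0 else -1)]
    exact Finset.sum_congr rfl fun A _ => (prod_bits T A t).symm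
  have h3 := congrArg (fun q : ℤ[X] => q.coeff (t - k)) h1
  simp only [finsetSum_coeff, coeff_C_mul, coeff_one_add_X_pow] at h3
  have h4 : ((1 + X : ℤ[X]) ^ T.card * X ^ (t - T.card)).coeff (t - k) =
      if T.card = k then 1 else 0 := by
    rw [coeff_mul_X_pow']
    split_ifs with ha hb hb
    · rw [hb, Nat.sub_self, coeff_one_add_X_pow]
      simp
    · omega
    · omega
    · rfl
  rw [h4] at h3
  have h5 := congrArg (((t - k).factorial : ℤ) * ·) h3
  simp only [Finset.mul_sum] at h5
  rw [mul_ite, mul_one, mul_zero] at h5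
  rw [← h5]
  refine Finset.sum_congr rfl fun A _ => ?_
  rw [Nat.descFactorial_eq_factorial_mul_choose]
  push_cast
  ring

end Weights

section Value

open MvPolynomial

variable {n : ℕ}

theorem foldl_mod_add (M : ℕ) (l : List ℕ) (a : ℕ) :
    ((l.foldl (fun a v => (a + v) % M) a : ℕ) : ZMod M) = a + (l.map fun v : ℕ => (v : ZMod M)).sum := by
  induction l generalizing a with
  | nil => simp
  | cons v l ih => simp [ih, add_assoc]

theorem foldl_mod_mul (M : ℕ) (l : List ℕ) (a : ℕ) :
    ((l.foldl (fun a v => (a * v) % M) a : ℕ) : ZMod M) = a * (l.map fun v : ℕ => (v : ZMod M)).prod := by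
  induction l generalizing a with
  | nil => simp
  | cons v l ih => simp [ih, mul_assoc]

/-- The number that is substituted for a variable with random number `x`. -/
def substValue (t p A x : ℕ) : ℤ := x * p * (A / 2 ^ (x % t) % 2 : ℕ)

/-- Reduction modulo `M` after each operation is a ring homomorphism in disguise; working in `ZMod
M` absorbs the fact that stored values need not be reduced. -/
theorem value_modInterp {t p M A : ℕ} (hM : 0 < M) (x : ℕ → ℕ) (C : Circuit n) (i : ℕ)
    (hi : i < C.numGates) : ((C.value (modInterp t p M A x) i hi : ℕ) : ZMod M) =
      ((eval (fun j : Fin n => substValue t p A (x j)) (C.polyAt i hi) : ℤ) : ZMod M) := by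
  induction i using Nat.strong_induction_on with
  | _ i ih =>
    rw [Circuit.value, Circuit.polyAt]
    cases C.gate ⟨i, hi⟩ with
    | var j =>
      simp only [eval_X, modInterp, varValue, substValue, ZMod.natCast_mod, Nat.cast_mul,
        Int.cast_mul, Int.cast_natCast]
    | const c =>
      simp only [modInterp, eval_C]
      by_cases hc : c < 0
      · have h1 : ((c.natAbs : ℕ) : ZMod M) = -(c : ZMod M) := by
          rw [← Int.cast_natCast, Int.ofNat_natAbs_of_nonpos hc.le, Int.cast_neg]
        simp [hc, Nat.cast_sub (Nat.mod_lt c.natAbs hM).le, h1]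
      · have h1 : ((c.natAbs : ℕ) : ZMod M) = (c : ZMod M) := by
          rw [← Int.cast_natCast, Int.natAbs_of_nonneg (not_lt.1 hc)]
        simp [hc, h1]
    | add l =>
      simp only [modInterp, if_true, foldl_mod_add, map_list_sum, List.map_map]
      simp only [Nat.cast_zero, zero_add]
      rw [Int.cast_list_sum, List.map_map]
      exact congrArg List.sum (List.map_congr_left fun (j : Fin i) _ => ih j.1 j.2 _)
    | mul l =>
      simp only [modInterp, one_ne_zero, if_false, foldl_mod_mul, map_list_prod, List.map_map]
      simp only [Nat.cast_one, one_mul]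
      rw [Int.cast_list_prod, List.map_map]
      exact congrArg List.prod (List.map_congr_left fun (j : Fin i) _ => ih j.1 j.2 _)

theorem iterate_sub_cast {M a : ℕ} (h : a ≤ M) (i : ℕ) :
    (((fun h => M - h)^[i] a : ℕ) : ZMod M) = (-1) ^ i * a := by
  induction i with
  | zero => simp
  | succ i ih =>
    rw [Function.iterate_succ_apply', Nat.cast_sub (iterate_sub_le h i), ih, pow_succ]
    simp

/-- The part of `f` that consists of the terms of degree `k` whose variables have `k` different
colors. -/
noncomputable def rainbowPart (f : MvPolynomial (Fin n) ℤ) (k : ℕ) (c : Fin n → ℕ) :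
    MvPolynomial (Fin n) ℤ :=
  ∑ m ∈ f.support with m.degree = k ∧ (m.support.image c).card = k, monomial m (f.coeff m)

theorem trialSum_cast (C : Circuit n) {k t p : ℕ} (hp : 0 < p) (x : ℕ → ℕ) :
    ((trialSum C k t p x : ℕ) : ZMod (p ^ (k + 1))) =
      ((∑ A ∈ Finset.range (2 ^ t), eval (fun j : Fin n => substValue t p A (x j)) C.poly *
        ((-1) ^ (t - popcount A t) * ((popcount A t).descFactorial (t - k) : ℤ)) : ℤ) :
        ZMod (p ^ (k + 1))) := by
  have hM : 0 < p ^ (k + 1) := by positivity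
  rw [trialSum, Nat.cast_sum, Int.cast_sum]
  refine Finset.sum_congr rfl fun A _ => ?_
  rw [trialTerm, Nat.cast_mul, iterate_sub_cast (modInterp_le hM x C _), Circuit.val,
    dif_pos C.out.2, value_modInterp hM, Circuit.poly]
  push_cast
  ring

/-- The indicators of colors are `0` or `1`, hence idempotent: of a monomial's exponents and
repeated colors, only its set of colors matters for the last factor. -/
theorem eval_substValue (f : MvPolynomial (Fin n) ℤ) {t p A : ℕ} (x : ℕ → ℕ) (ht : 0 < t) :
    eval (fun j : Fin n => substValue t p A (x j)) f =
      ∑ m ∈ f.support, f.coeff m * (∏ j : Fin n, (x j : ℤ) ^ m j) * (p : ℤ) ^ m.degree *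
        ∏ i ∈ Finset.range t, if i ∈ m.support.image (fun j : Fin n => x j % t) then
          ((A / 2 ^ i % 2 : ℕ) : ℤ) else 1 := by
  rw [eval_eq']
  refine Finset.sum_congr rfl fun m _ => ?_
  simp only [substValue, mul_pow, Finset.prod_mul_distrib]
  have h1 : ∏ j : Fin n, (p : ℤ) ^ m j = (p : ℤ) ^ m.degree := by
    rw [Finset.prod_pow_eq_pow_sum, Finsupp.degree_eq_sum]
  have h2 : ∏ j : Fin n, ((A / 2 ^ (x j % t) % 2 : ℕ) : ℤ) ^ m j =
      ∏ i ∈ Finset.range t, if i ∈ m.support.image (fun j : Fin n => x j % t) then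
        ((A / 2 ^ i % 2 : ℕ) : ℤ) else 1 := by
    by_cases h : ∀ j ∈ m.support, A / 2 ^ (x j % t) % 2 = 1
    · rw [Finset.prod_eq_one, Finset.prod_eq_one]
      · intro i _
        split_ifs with hi
        · obtain ⟨j, hj, rfl⟩ := Finset.mem_image.1 hi
          rw [h j hj, Nat.cast_one]
        · rfl
      · intro j _
        by_cases hj : j ∈ m.support
        · rw [h j hj, Nat.cast_one, one_pow]
        · rw [Finsupp.notMem_support_iff.1 hj, pow_zero]
    · push Not at h
      obtain ⟨j, hj, hb⟩ := h
      have hb : A / 2 ^ (x j % t) % 2 = 0 := by omega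
      rw [Finset.prod_eq_zero (Finset.mem_univ j), Finset.prod_eq_zero
        (Finset.mem_range.2 (Nat.mod_lt (x j) ht))]
      · rw [if_pos (Finset.mem_image_of_mem _ hj), hb, Nat.cast_zero]
      · rw [hb, Nat.cast_zero, zero_pow (Finsupp.mem_support_iff.1 hj)]
  rw [h1, h2]
  ring

theorem card_image_support_le (m : Fin n →₀ ℕ) (c : Fin n → ℕ) :
    (m.support.image c).card ≤ m.degree := by
  refine Finset.card_image_le.trans ?_
  rw [Finsupp.degree_apply, Finset.card_eq_sum_ones]
  exact Finset.sum_le_sum fun j hj => Nat.one_le_iff_ne_zero.2 (Finsupp.mem_support_iff.1 hj)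

theorem eval_rainbowPart (f : MvPolynomial (Fin n) ℤ) (k : ℕ) (c : Fin n → ℕ) (x : Fin n → ℤ) :
    eval x (rainbowPart f k c) = ∑ m ∈ f.support,
      if m.degree = k ∧ (m.support.image c).card = k then f.coeff m * ∏ j, x j ^ m j else 0 := by
  rw [rainbowPart, map_sum, ← Finset.sum_filter]
  refine Finset.sum_congr rfl fun m _ => ?_
  rw [eval_monomial, Finsupp.prod_fintype _ _ (by simp)]

/-- Exchange the sums over `A` and over the monomials. Degree above `k` contributes a multiple of `p
^ (k + 1)`; for degree at most `k`, there are at most `k` colors, and `sum_color_weights` leaves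
only the rainbow monomials of degree exactly `k`, each with the factor `p ^ k * (t - k)!`.
Cancelling `p ^ k` leaves divisibility by `p`, for an arbitrary positive `p`. -/
theorem trialSum_mod_ne_zero_iff (C : Circuit n) {k t p : ℕ} (hp : 0 < p) (x : ℕ → ℕ)
    (ht : 0 < t) (hk : k ≤ t) : trialSum C k t p x % p ^ (k + 1) ≠ 0 ↔
      ¬ (p : ℤ) ∣ (t - k).factorial *
        eval (fun j : Fin n => (x j : ℤ)) (rainbowPart C.poly k fun j => x j % t) := by
  set Q := eval (fun j : Fin n => (x j : ℤ)) (rainbowPart C.poly k fun j => x j % t) with hQ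
  set Z := ∑ A ∈ Finset.range (2 ^ t), eval (fun j : Fin n => substValue t p A (x j)) C.poly *
        ((-1) ^ (t - popcount A t) * ((popcount A t).descFactorial (t - k) : ℤ)) with hZ
  have h1 : trialSum C k t p x % p ^ (k + 1) = 0 ↔ ((p ^ (k + 1) : ℕ) : ℤ) ∣ Z := by
    rw [← ZMod.intCast_zmod_eq_zero_iff_dvd, ← trialSum_cast C hp, ZMod.natCast_eq_zero_iff,
      Nat.dvd_iff_mod_eq_zero]
  have h2 : ((p ^ (k + 1) : ℕ) : ℤ) ∣ Z - p ^ k * ((t - k).factorial * Q) := by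
    have h3 : Z = ∑ m ∈ C.poly.support, C.poly.coeff m * (∏ j : Fin n, (x j : ℤ) ^ m j) *
        (p : ℤ) ^ m.degree * ∑ A ∈ Finset.range (2 ^ t),
        (∏ i ∈ Finset.range t, if i ∈ m.support.image (fun j : Fin n => x j % t) then
          ((A / 2 ^ i % 2 : ℕ) : ℤ) else 1) *
        ((-1) ^ (t - popcount A t) * ((popcount A t).descFactorial (t - k) : ℤ)) := by
      simp only [hZ, eval_substValue _ _ ht, Finset.sum_mul, Finset.mul_sum]
      rw [Finset.sum_comm]
      refine Finset.sum_congr rfl fun m _ => Finset.sum_congr rfl fun A _ => by ring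
    rw [h3, hQ, eval_rainbowPart, Finset.mul_sum, Finset.mul_sum, ← Finset.sum_sub_distrib]
    refine Finset.dvd_sum fun m _ => ?_
    have hsub : m.support.image (fun j : Fin n => x j % t) ⊆ Finset.range t := by
      intro i hi
      obtain ⟨j, -, rfl⟩ := Finset.mem_image.1 hi
      exact Finset.mem_range.2 (Nat.mod_lt _ ht)
    have hcard := card_image_support_le m (fun j : Fin n => x j % t)
    rcases le_or_gt m.degree k with hm | hm
    · rw [sum_color_weights hsub hk (hcard.trans hm)]
      by_cases hd : m.degree = k
      · by_cases hr : (m.support.image fun j : Fin n => x j % t).card = k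
        · rw [if_pos hr, if_pos ⟨hd, hr⟩, hd]
          convert dvd_zero _ using 1
          ring
        · rw [if_neg hr, if_neg (fun h => hr h.2)]
          simp
      · rw [if_neg (by omega), if_neg (fun h => hd h.1)]
        simp
    · rw [if_neg (by omega)]
      simp only [mul_zero, sub_zero]
      refine Dvd.dvd.mul_right (Dvd.dvd.mul_left ?_ _) _
      push_cast
      exact pow_dvd_pow _ hm
  rw [Ne, h1, (Int.dvd_iff_dvd_of_dvd_sub h2), Nat.cast_pow, pow_succ,
    mul_dvd_mul_iff_left (by positivity)]

end Value

/-! ### Bounding the values of the rainbow part -/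

section Height

open MvPolynomial

variable {n : ℕ} {x : Fin n → ℕ}

/-- The coefficients of `f` are bounded by those of a polynomial with value at most `N` at `x`. -/
def Dominated (x : Fin n → ℕ) (f : MvPolynomial (Fin n) ℤ) (N : ℕ) : Prop :=
  ∃ g : MvPolynomial (Fin n) ℕ, (∀ m, (f.coeff m).natAbs ≤ g.coeff m) ∧ eval x g ≤ N

theorem Dominated.mono {f : MvPolynomial (Fin n) ℤ} {N M : ℕ} (h : Dominated x f N) (hNM : N ≤ M) :
    Dominated x f M :=
  h.imp fun _ hg => ⟨hg.1, hg.2.trans hNM⟩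

theorem dominated_X (j : Fin n) : Dominated x (X j) (x j) := by
  refine ⟨X j, fun m => ?_, by simp⟩
  simp only [coeff_X]
  split <;> simp

theorem dominated_C (a : ℤ) : Dominated x (C a) a.natAbs := by
  refine ⟨C a.natAbs, fun m => ?_, by simp⟩
  simp only [coeff_C]
  split <;> simp

theorem Dominated.add {f g : MvPolynomial (Fin n) ℤ} {N M : ℕ} (hf : Dominated x f N)
    (hg : Dominated x g M) : Dominated x (f + g) (N + M) := by
  obtain ⟨a, ha, ha'⟩ := hf
  obtain ⟨b, hb, hb'⟩ := hg
  refine ⟨a + b, fun m => ?_, by rw [map_add]; exact add_le_add ha' hb'⟩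
  rw [coeff_add, coeff_add]
  exact (Int.natAbs_add_le _ _).trans (add_le_add (ha m) (hb m))

theorem Dominated.mul {f g : MvPolynomial (Fin n) ℤ} {N M : ℕ} (hf : Dominated x f N)
    (hg : Dominated x g M) : Dominated x (f * g) (N * M) := by
  obtain ⟨a, ha, ha'⟩ := hf
  obtain ⟨b, hb, hb'⟩ := hg
  refine ⟨a * b, fun m => ?_, by rw [map_mul]; exact Nat.mul_le_mul ha' hb'⟩
  rw [coeff_mul, coeff_mul]
  refine (Int.natAbs_sum_le _ _).trans (Finset.sum_le_sum fun q _ => ?_)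
  rw [Int.natAbs_mul]
  exact Nat.mul_le_mul (ha _) (hb _)

theorem dominated_list_sum {ι : Type*} (l : List ι) (f : ι → MvPolynomial (Fin n) ℤ) {N : ℕ}
    (h : ∀ i ∈ l, Dominated x (f i) N) : Dominated x (l.map f).sum (l.length * N) := by
  induction l with
  | nil => simpa using dominated_C (x := x) 0
  | cons i l ih =>
    rw [List.map_cons, List.sum_cons, List.length_cons, add_mul, one_mul, add_comm (_ * N)]
    exact (h i (by simp)).add (ih fun j hj => h j (by simp [hj]))

theorem dominated_list_prod {ι : Type*} (l : List ι) (f : ι → MvPolynomial (Fin n) ℤ) {N : ℕ}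
    (h : ∀ i ∈ l, Dominated x (f i) N) : Dominated x (l.map f).prod (N ^ l.length) := by
  induction l with
  | nil => simpa using dominated_C (x := x) 1
  | cons i l ih =>
    rw [List.map_cons, List.prod_cons, List.length_cons, pow_succ, mul_comm (_ ^ _)]
    exact (h i (by simp)).mul (ih fun j hj => h j (by simp [hj]))

theorem le_foldl_max (l : List ℕ) (a : ℕ) :
    a ≤ l.foldl max a ∧ ∀ v ∈ l, v ≤ l.foldl max a := by
  induction l generalizing a with
  | nil => simp
  | cons v l ih =>
    obtain ⟨h1, h2⟩ := ih (max a v)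
    refine ⟨(le_max_left _ _).trans h1, fun w hw => ?_⟩
    rcases List.mem_cons.1 hw with rfl | hw
    · exact (le_max_right _ _).trans h1
    · exact h2 w hw

/-- A sum of `l` terms raises the double exponent by at most the number of digits of `l`. The same
increment serves for products of `l` factors, so the height computation need not distinguish the two
kinds of gates. -/
theorem length_mul_two_pow_two_pow_le (l m : ℕ) : l * 2 ^ 2 ^ m ≤ 2 ^ 2 ^ (m + Nat.size l) := by
  rcases Nat.eq_zero_or_pos l with rfl | hl
  · simp
  have h1 : l < 2 ^ Nat.size l := Nat.lt_size_self l
  have h2 : 1 ≤ Nat.size l := Nat.size_pos.2 hl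
  calc l * 2 ^ 2 ^ m ≤ 2 ^ Nat.size l * 2 ^ 2 ^ m := by gcongr
    _ = 2 ^ (Nat.size l + 2 ^ m) := (pow_add _ _ _).symm
    _ ≤ _ := Nat.pow_le_pow_right (by norm_num) ?_
  rw [pow_add]
  have h3 : Nat.size l + 1 ≤ 2 ^ Nat.size l := Nat.lt_two_pow_self
  have h4 : 1 ≤ 2 ^ m := Nat.one_le_two_pow
  nlinarith

theorem two_pow_two_pow_pow_length_le (l m : ℕ) :
    (2 ^ 2 ^ m) ^ l ≤ 2 ^ 2 ^ (m + Nat.size l) := by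
  rw [← pow_mul, pow_add]
  exact Nat.pow_le_pow_right (by norm_num) (Nat.mul_le_mul_left _ (Nat.lt_size_self l).le)

/-- The majorant has nonnegative coefficients, so it can be bounded gate by gate without
cancellation. -/
theorem dominated_polyAt {e : ℕ} (hx : ∀ j, x j < 2 ^ e) (C : Circuit n) (i : ℕ)
    (hi : i < C.numGates) :
    Dominated x (C.polyAt i hi) (2 ^ 2 ^ C.value (heightInterp e) i hi) := by
  induction i using Nat.strong_induction_on with
  | _ i ih =>
    rw [Circuit.value, Circuit.polyAt]
    cases C.gate ⟨i, hi⟩ with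
    | var j =>
      refine (dominated_X j).mono ((hx j).le.trans (Nat.pow_le_pow_right (by norm_num) ?_))
      exact Nat.lt_two_pow_self.le
    | const c =>
      exact (dominated_C c).mono ((lt_two_pow_two_pow_iff _ _).2 le_rfl).le
    | add l =>
      refine (dominated_list_sum l _ fun (j : Fin i) hj => (ih j.1 j.2 _).mono ?_).mono
        (length_mul_two_pow_two_pow_le _ _)
      refine Nat.pow_le_pow_right (by norm_num) (Nat.pow_le_pow_right (by norm_num) ?_)
      exact (le_foldl_max _ 0).2 _ (List.mem_map_of_mem hj)
    | mul l =>
      refine (dominated_list_prod l _ fun (j : Fin i) hj => (ih j.1 j.2 _).mono ?_).mono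
        (two_pow_two_pow_pow_length_le _ _)
      refine Nat.pow_le_pow_right (by norm_num) (Nat.pow_le_pow_right (by norm_num) ?_)
      exact (le_foldl_max _ 1).2 _ (List.mem_map_of_mem hj)

/-- A bound on the value of `f` alone would say nothing about a selection of its terms, because of
cancellation. A coefficientwise majorant also bounds every such selection at a nonnegative point. -/
theorem natAbs_eval_rainbowPart_le {f : MvPolynomial (Fin n) ℤ} {N : ℕ} (h : Dominated x f N)
    (k : ℕ) (c : Fin n → ℕ) : (eval (fun j => (x j : ℤ)) (rainbowPart f k c)).natAbs ≤ N := by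
  obtain ⟨g, hg, hN⟩ := h
  refine le_trans ?_ hN
  rw [eval_rainbowPart, eval_eq']
  have hs : f.support ⊆ g.support := by
    intro m hm
    rw [mem_support_iff] at hm ⊢
    have := hg m
    omega
  refine ((Int.natAbs_sum_le _ _).trans (Finset.sum_le_sum (g := fun m => g.coeff m *
    ∏ j, x j ^ m j) fun m _ => ?_)).trans (Finset.sum_le_sum_of_subset hs)
  split_ifs
  · rw [Int.natAbs_mul]
    refine Nat.mul_le_mul (hg m) (le_of_eq ?_)
    rw [← Nat.cast_inj (R := ℤ), Int.natCast_natAbs, abs_of_nonneg (by positivity)]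
    push_cast
    rfl
  · simp

theorem factorial_le_two_pow_two_pow (t k : ℕ) : (t - k).factorial ≤ 2 ^ 2 ^ t := by
  refine (Nat.factorial_le (Nat.sub_le t k)).trans ?_
  induction t with
  | zero => simp
  | succ t ih =>
    rw [Nat.factorial_succ, pow_succ, pow_mul, pow_two (2 ^ 2 ^ t)]
    refine Nat.mul_le_mul ?_ ih
    exact (Nat.lt_two_pow_self (n := t)).trans_le ((Nat.lt_two_pow_self (n := 2 ^ t)).le)

theorem natAbs_factorial_mul_le {C : Circuit n} {k t e : ℕ} (hx : ∀ j, x j < 2 ^ e)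
    (c : Fin n → ℕ) :
    ((t - k).factorial * eval (fun j => (x j : ℤ)) (rainbowPart C.poly k c) : ℤ).natAbs ≤
      2 ^ 2 ^ (C.val (heightInterp e) C.out + t + 1) := by
  have h1 := natAbs_eval_rainbowPart_le (dominated_polyAt hx C C.out.1 C.out.2) k c
  have h2 := factorial_le_two_pow_two_pow t k
  have hv : C.val (heightInterp e) C.out = C.value (heightInterp e) C.out.1 C.out.2 :=
    dif_pos C.out.2
  rw [Int.natAbs_mul, Int.natAbs_natCast, hv]
  set u := C.value (heightInterp e) C.out.1 C.out.2
  refine (Nat.mul_le_mul h2 h1).trans ?_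
  rw [← pow_add]
  refine Nat.pow_le_pow_right (by norm_num) ?_
  rw [pow_succ, pow_add]
  have h3 : 1 ≤ 2 ^ u := Nat.one_le_two_pow
  have h4 : 1 ≤ 2 ^ t := Nat.one_le_two_pow
  nlinarith

end Height

/-! ### Soundness -/

section Soundness

open MvPolynomial

variable {n : ℕ}

/-- A monomial of degree `k` with `k` different colors involves at least `k` variables, so no
exponent can exceed one. -/
theorem rainbowPart_eq_zero {f : MvPolynomial (Fin n) ℤ} {k : ℕ} (h : ¬ HasMultilinearTerm k f)
    (c : Fin n → ℕ) : rainbowPart f k c = 0 := by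
  rw [rainbowPart, Finset.filter_eq_empty_iff.2, Finset.sum_empty]
  rintro m hm ⟨hd, hc⟩
  refine h ⟨m, ?_, by rw [← hd, Finsupp.degree_eq_sum], mem_support_iff.1 hm⟩
  by_contra! hi
  obtain ⟨i, hi⟩ := hi
  have h1 : m.support.card < m.degree := by
    rw [Finsupp.degree_apply, Finset.card_eq_sum_ones]
    refine Finset.sum_lt_sum (fun j hj => Nat.one_le_iff_ne_zero.2 (Finsupp.mem_support_iff.1 hj))
      ⟨i, Finsupp.mem_support_iff.2 (by omega), hi⟩
  have h2 : (m.support.image c).card ≤ m.support.card := Finset.card_image_le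
  omega

theorem not_trialSucceeds {C : Circuit n} {k t e B c : ℕ} {ω : ℕ → Bool} (ht : 0 < t) (hk : k ≤ t)
    (h : ¬ HasMultilinearTerm k C.poly) : ¬ TrialSucceeds ω C k t e B c := by
  rw [TrialSucceeds, trialSum_mod_ne_zero_iff C (by simp [trialBase]) _ ht hk,
    rainbowPart_eq_zero h]
  simp

theorem not_hasMultilinearTerm_of_lt {f : MvPolynomial (Fin n) ℤ} {k : ℕ} (hk : n < k) :
    ¬ HasMultilinearTerm k f := by
  rintro ⟨m, hm, hs, -⟩
  have : ∑ i, m i ≤ ∑ _i : Fin n, 1 := Finset.sum_le_sum fun i _ => hm i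
  simp at this
  omega

end Soundness

/-! ### Primes that do not divide a given number -/

section Primes

/-- A Chebyshev bound through the least common multiple of `1, …, N` with `N = 2 ^ B`: it is at
least `2 ^ N / (N + 1)`, and each prime `p ≤ N` contributes a power of `p` that is at most `N`,
hence it is at most `2 ^ (B * π(N))`. -/
theorem two_pow_le_mul_primeCounting_add_one {B : ℕ} (hB : 0 < B) :
    2 ^ B ≤ B * ((2 ^ B).primesLE.card + 1) := by
  have h1 := Chebyshev.two_pow_le_mul_lcmUpto (2 ^ B)
  rw [Nat.lcmUpto_eq_prod_pow_log] at h1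
  have h2 : ∏ p ∈ (2 ^ B).primesLE, p ^ p.log (2 ^ B) ≤ ∏ _p ∈ (2 ^ B).primesLE, 2 ^ B :=
    Finset.prod_le_prod' fun p _ => Nat.pow_log_le_self _ (by positivity)
  rw [Finset.prod_const, ← pow_mul] at h2
  have h3 : 2 ^ B + 1 < 2 ^ (B + 1) := by
    have : 1 < 2 ^ B := Nat.one_lt_two_pow hB.ne'
    rw [pow_succ]
    omega
  have h4 : 2 ^ 2 ^ B < 2 ^ (B + 1 + B * (2 ^ B).primesLE.card) := by
    rw [pow_add]
    exact (h1.trans (Nat.mul_le_mul_left _ h2)).trans_lt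
      (Nat.mul_lt_mul_of_pos_right h3 (by positivity))
  have h5 := (Nat.pow_lt_pow_iff_right (by norm_num)).1 h4
  rw [mul_add, mul_one]
  omega

theorem card_primeFactors_le {N W : ℕ} (hN : N ≠ 0) (h : N ≤ 2 ^ W) : N.primeFactors.card ≤ W := by
  have h1 : 2 ^ N.primeFactors.card ≤ N := by
    calc 2 ^ N.primeFactors.card = ∏ _p ∈ N.primeFactors, 2 := by simp
      _ ≤ ∏ p ∈ N.primeFactors, p :=
        Finset.prod_le_prod' fun p hp => (Nat.prime_of_mem_primeFactors hp).two_le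
      _ ≤ N := Nat.le_of_dvd (Nat.pos_of_ne_zero hN) (Nat.prod_primeFactors_dvd N)
  exact (Nat.pow_le_pow_iff_right (by norm_num)).1 (h1.trans h)

/-- With `B = 2 * W + 2` there are at least `2 ^ B / B - 1` primes up to `2 ^ B`, and at most `2 ^
W` of them divide `N`. As `2 ^ B = 4 * 4 ^ W`, the exceptions cost at most half of the lower bound;
this is what `B` is chosen for. -/
theorem two_pow_le_mul_card_not_dvd {N : ℤ} {W : ℕ} (hN : N ≠ 0) (h : N.natAbs ≤ 2 ^ 2 ^ W)
    (hW : 2 ≤ W) : 2 ^ (2 * W + 2) ≤ 2 * (2 * W + 2) *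
      (Finset.univ.filter fun r : Fin (2 ^ (2 * W + 2)) => ¬ ((r + 1 : ℕ) : ℤ) ∣ N).card := by
  set B := 2 * W + 2 with hB
  set G := Finset.univ.filter fun r : Fin (2 ^ B) => ¬ ((r + 1 : ℕ) : ℤ) ∣ N
  have h1 : ((2 ^ B).primesLE \ N.natAbs.primeFactors).card ≤ G.card := by
    refine Finset.card_le_card_of_injOn (fun p => Fin.ofNat (2 ^ B) (p - 1)) ?_ ?_
    · intro p hp
      simp only [Finset.coe_sdiff, Set.mem_sdiff, Finset.mem_coe, Nat.mem_primesLE,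
        Nat.mem_primeFactors] at hp
      have h2 := hp.1.2.pos
      have h3 : (p - 1) % 2 ^ B = p - 1 := Nat.mod_eq_of_lt (by omega)
      have h4 : p - 1 + 1 = p := by omega
      simp only [G, Finset.coe_filter, Finset.mem_univ, true_and, Set.mem_ofPred_eq,
        Fin.val_ofNat, h3, h4]
      rw [Int.natCast_dvd]
      exact fun hd => hp.2 ⟨hp.1.2, hd, by simpa using hN⟩
    · intro p hp r hr hpr
      simp only [Finset.coe_sdiff, Set.mem_sdiff, Finset.mem_coe, Nat.mem_primesLE] at hp hr
      have h2 := hp.1.2.pos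
      have h3 := hr.1.2.pos
      have h4 := congrArg Fin.val hpr
      simp only [Fin.val_ofNat] at h4
      rw [Nat.mod_eq_of_lt (by omega), Nat.mod_eq_of_lt (by omega)] at h4
      omega
  have h2 := Finset.le_card_sdiff N.natAbs.primeFactors (2 ^ B).primesLE
  have h3 := card_primeFactors_le (by simpa using hN) h
  have h4 := two_pow_le_mul_primeCounting_add_one (B := B) (by omega)
  have h5 : (2 ^ B).primesLE.card ≤ G.card + 2 ^ W := by omega
  have h6 : B * ((2 ^ B).primesLE.card + 1) ≤ B * (G.card + 2 ^ W + 1) := by gcongr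
  have h7 : 2 ^ B = 4 * (2 ^ W * 2 ^ W) := by rw [hB]; ring
  have h8 : W + 2 ≤ 2 ^ W := by
    clear * - hW
    induction W, hW using Nat.le_induction with
    | base => norm_num
    | succ W _ ih => rw [pow_succ]; omega
  -- By `h8`, the left side is at most `(2 ^ W - 1) * (2 ^ W + 1)`.
  have h9 : (W + 1) * (2 ^ W + 1) ≤ 2 ^ W * 2 ^ W := by nlinarith
  have h10 : 2 * B * (2 ^ W + 1) = 4 * ((W + 1) * (2 ^ W + 1)) := by rw [hB]; ring
  nlinarith

end Primes

/-! ### The number of colorings that are injective on a set of `k` elements -/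

section Colorings

theorem le_of_unimodal {f : ℕ → ℕ} {m : ℕ} (h1 : ∀ j < m, f j ≤ f (j + 1))
    (h2 : ∀ j, m ≤ j → f (j + 1) ≤ f j) (j : ℕ) : f j ≤ f m := by
  rcases le_total j m with h | h
  · induction h using Nat.decreasingInduction with
    | of_succ i hi ih => exact (h1 i hi).trans ih
    | self => rfl
  · induction j, h using Nat.le_induction with
    | base => rfl
    | succ j hj ih => exact (h2 j hj).trans ih

/-- In the binomial expansion of `(10 + 3) ^ (13 * q)` the term with index `10 * q` is the largest
of `13 * q + 1` terms. This replaces Stirling's formula for the binomial coefficient. -/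
theorem thirteen_pow_le (q : ℕ) : 13 ^ (13 * q) ≤
    (13 * q + 1) * ((13 * q).choose (10 * q) * 10 ^ (10 * q) * 3 ^ (3 * q)) := by
  set t := 13 * q with ht
  set f : ℕ → ℕ := fun j => if j ≤ t then t.choose j * 10 ^ j * 3 ^ (t - j) else 0 with hf
  have hstep : ∀ j < t, f (j + 1) * (3 * (j + 1)) = f j * (10 * (t - j)) := by
    intro j hj
    have h1 := Nat.choose_succ_right_eq t j
    obtain ⟨d, hd⟩ := Nat.exists_eq_add_of_lt hj
    have h2 : t - j = (t - (j + 1)) + 1 := by omega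
    simp only [hf, if_pos hj.le, if_pos (Nat.succ_le_of_lt hj)]
    calc _ = t.choose (j + 1) * (j + 1) * (10 ^ (j + 1) * 3 ^ (t - (j + 1)) * 3) := by ring
      _ = _ := by rw [h1, h2, pow_succ 10, pow_succ 3]; ring
  -- The ratio of consecutive terms is `10 * (t - j) / (3 * (j + 1))`; it is at least one for `j <
  -- 10 * q` and at most one from `10 * q` on.
  have hmode : ∀ j, f j ≤ f (10 * q) := by
    refine le_of_unimodal ?_ ?_
    · intro j hj
      have h1 := hstep j (by omega)
      have h2 : 3 * (j + 1) ≤ 10 * (t - j) := by omega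
      refine Nat.le_of_mul_le_mul_right ?_ (show 0 < 3 * (j + 1) by omega)
      rw [h1]
      exact Nat.mul_le_mul_left _ h2
    · intro j hj
      rcases lt_or_ge j t with h | h
      · have h1 := hstep j h
        have h2 : 10 * (t - j) ≤ 3 * (j + 1) := by omega
        refine Nat.le_of_mul_le_mul_right ?_ (show 0 < 3 * (j + 1) by omega)
        rw [h1]
        exact Nat.mul_le_mul_left _ h2
      · simp [hf, show ¬ j + 1 ≤ t by omega]
  have hsum : ∑ j ∈ Finset.range (t + 1), f j = 13 ^ t := by
    rw [show (13 : ℕ) = 10 + 3 by norm_num, add_pow]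
    refine Finset.sum_congr rfl fun j hj => ?_
    simp only [hf, if_pos (Nat.lt_succ_iff.1 (Finset.mem_range.1 hj))]
    simp only [Nat.cast_id]
    ring
  rw [← hsum]
  refine (Finset.sum_le_card_nsmul _ _ _ fun j _ => hmode j).trans (le_of_eq ?_)
  simp only [hf, if_pos (show 10 * q ≤ t by omega), Finset.card_range, smul_eq_mul,
    show t - 10 * q = 3 * q by omega]

/-- From `m ^ m / m! ≤ exp m` with `m = 10 * q`. The integer 271 is chosen such that `exp 10 ≤ 271 *
13 ^ 3 / 27`. -/
theorem pow_le_mul_factorial (q : ℕ) :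
    27 ^ q * (10 * q) ^ (10 * q) ≤ (271 * 13 ^ 3) ^ q * (10 * q).factorial := by
  have h1 := Real.pow_div_factorial_le_exp (10 * q : ℕ) (Nat.cast_nonneg _) (10 * q)
  rw [div_le_iff₀ (by positivity)] at h1
  have h2 : Real.exp (10 * q : ℕ) = (Real.exp 1 ^ 10) ^ q := by
    rw [← Real.exp_nat_mul, ← Real.exp_nat_mul]
    push_cast
    ring_nf
  have h3 : Real.exp 1 ^ 10 ≤ 271 * 13 ^ 3 / 27 := by
    calc Real.exp 1 ^ 10 ≤ 2.7182818286 ^ 10 := by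
          gcongr
          exact Real.exp_one_lt_d9.le
      _ ≤ _ := by norm_num
  have h4 : (27 ^ q * (10 * q : ℕ) ^ (10 * q) : ℝ) ≤
      (271 * 13 ^ 3) ^ q * (10 * q).factorial := by
    calc (27 ^ q * (10 * q : ℕ) ^ (10 * q) : ℝ)
        ≤ 27 ^ q * ((271 * 13 ^ 3 / 27) ^ q * (10 * q).factorial) := by
          rw [h2] at h1
          gcongr
          exact h1.trans (by gcongr)
      _ = _ := by rw [← mul_assoc, ← mul_pow]; norm_num
  exact_mod_cast h4

/-- The inverse probability that `k` random colors are distinct. For `k = 10 * q` write the falling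
factorial as factorial times binomial coefficient and combine the two preceding bounds. Smaller `k`
is only easier: the remaining `10 * q - k` factors of the falling factorial are at most `t` each and
cancel. -/
theorem colors_pow_le_mul_descFactorial {q k : ℕ} (hk : k ≤ 10 * q) :
    (13 * q) ^ k ≤ (13 * q + 1) * 271 ^ q * (13 * q).descFactorial k := by
  set t := 13 * q with ht
  rcases Nat.eq_zero_or_pos q with rfl | hq
  · simp_all
  have h1 := thirteen_pow_le q
  have h2 := pow_le_mul_factorial q
  have h3 : t ^ (10 * q) ≤ (t + 1) * 271 ^ q * t.descFactorial (10 * q) := by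
    rw [Nat.descFactorial_eq_factorial_mul_choose]
    have e1 : t ^ (10 * q) * (13 ^ (13 * q) * 27 ^ q * 10 ^ (10 * q)) =
        13 ^ (10 * q) * 13 ^ (13 * q) * (27 ^ q * (10 * q) ^ (10 * q)) := by
      rw [ht, mul_pow, mul_pow]
      ring
    have e2 : (t + 1) * 271 ^ q * ((10 * q).factorial * t.choose (10 * q)) *
        (13 ^ (13 * q) * 27 ^ q * 10 ^ (10 * q)) =
        13 ^ (10 * q) * ((t + 1) * (t.choose (10 * q) * 10 ^ (10 * q) * 3 ^ (3 * q))) *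
        ((271 * 13 ^ 3) ^ q * (10 * q).factorial) := by
      have : 13 ^ (13 * q) = 13 ^ (10 * q) * (13 ^ 3) ^ q := by rw [← pow_mul, ← pow_add]; ring_nf
      rw [this, mul_pow, show 3 ^ (3 * q) = 27 ^ q by rw [pow_mul]; norm_num]
      ring
    refine Nat.le_of_mul_le_mul_right ?_
      (show 0 < 13 ^ (13 * q) * 27 ^ q * 10 ^ (10 * q) by positivity)
    rw [e1, e2]
    gcongr
  have h4 : t.descFactorial (10 * q) ≤ t.descFactorial k * t ^ (10 * q - k) := by
    have : t.descFactorial (10 * q) =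
        t.descFactorial k * (t - k).descFactorial (10 * q - k) := by
      rw [← Nat.descFactorial_mul_descFactorial hk, mul_comm]
    rw [this]
    gcongr
    exact (Nat.descFactorial_le_pow _ _).trans (by gcongr; omega)
  refine Nat.le_of_mul_le_mul_right ?_ (show 0 < t ^ (10 * q - k) by positivity)
  rw [← pow_add, Nat.add_sub_cancel' hk, mul_assoc]
  exact h3.trans (by gcongr)

/-- Glue an embedding of `S` into the colors with an arbitrary coloring outside `S`. -/
theorem le_card_injOn {n t : ℕ} (S : Finset (Fin n)) :
    t.descFactorial S.card * t ^ (n - S.card) ≤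
      (Finset.univ.filter fun c : Fin n → Fin t => Set.InjOn c S).card := by
  have h1 : Fintype.card ((S ↪ Fin t) × ({i // i ∉ S} → Fin t)) =
      t.descFactorial S.card * t ^ (n - S.card) := by
    rw [Fintype.card_prod, Fintype.card_embedding_eq, Fintype.card_fun, Fintype.card_fin,
      Fintype.card_coe, Fintype.card_subtype_compl, Fintype.card_coe, Fintype.card_fin]
  rw [← h1, ← Finset.card_univ]
  refine Finset.card_le_card_of_injOn
    (fun g i => if h : i ∈ S then g.1 ⟨i, h⟩ else g.2 ⟨i, h⟩) ?_ ?_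
  · rintro g -
    simp only [Finset.coe_filter, Finset.mem_univ, true_and, Set.mem_ofPred_eq]
    intro i hi j hj hij
    have hi' : i ∈ S := hi
    have hj' : j ∈ S := hj
    simp only [hi', hj', dif_pos] at hij
    simpa using g.1.injective hij
  · rintro g - g' - h
    refine Prod.ext (DFunLike.ext _ _ fun i => ?_) (funext fun i => ?_)
    · simpa using congrFun h i
    · simpa [i.2] using congrFun h i

end Colorings

/-! ### The number of successful outcomes of the coin flips of a trial -/

section Outcomes

open MvPolynomial

variable {n : ℕ}

theorem coeff_rainbowPart (f : MvPolynomial (Fin n) ℤ) (k : ℕ) (c : Fin n → ℕ) (m : Fin n →₀ ℕ) :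
    (rainbowPart f k c).coeff m =
      if m.degree = k ∧ (m.support.image c).card = k then f.coeff m else 0 := by
  rw [rainbowPart, coeff_sum]
  simp only [coeff_monomial, Finset.sum_ite_eq', Finset.mem_filter, mem_support_iff]
  by_cases h : f.coeff m = 0 <;> simp [h]

theorem degree_of_mem_support_rainbowPart {f : MvPolynomial (Fin n) ℤ} {k : ℕ} {c : Fin n → ℕ}
    {m : Fin n →₀ ℕ} (h : m ∈ (rainbowPart f k c).support) : m.degree = k := by
  rw [mem_support_iff, coeff_rainbowPart] at h
  by_contra hd
  exact h (if_neg fun h => hd h.1)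

/-- The color of a variable with random number `x`. -/
def color {t e : ℕ} (ht : 0 < t) (x : Fin n → Fin (2 ^ e)) (j : Fin n) : Fin t :=
  ⟨x j % t, Nat.mod_lt _ ht⟩

/-- With the coloring fixed, the rainbow part is a fixed nonzero form of degree `k`, and `x j` may
range over the `m` numbers `c j + t * y` with `y < m`, all below `2 ^ e`. By Schwartz–Zippel the
fraction of zeros on this grid is at most `k / m ≤ 1 / 2`. -/
theorem pow_le_two_mul_card_eval_ne_zero {t e m : ℕ} (ht : 0 < t) (he : t * m ≤ 2 ^ e)
    {f : MvPolynomial (Fin n) ℤ} {k : ℕ} (hm : 2 * k ≤ m) (hm0 : 0 < m) (c : Fin n → Fin t)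
    (hf : rainbowPart f k (fun j => c j) ≠ 0) :
    m ^ n ≤ 2 * (Finset.univ.filter fun x : Fin n → Fin (2 ^ e) =>
      eval (fun j => ((x j : ℕ) : ℤ)) (rainbowPart f k fun j => x j % t) ≠ 0 ∧
        color ht x = c).card := by
  set S : Fin n → Finset ℤ := fun j => (Finset.range m).image fun y : ℕ => ((c j + t * y : ℕ) : ℤ)
    with hS
  have hcard : ∀ j, (S j).card = m := by
    intro j
    rw [hS, Finset.card_image_of_injective, Finset.card_range]
    intro y y' h
    have h : (c j : ℕ) + t * y = c j + t * y' := Int.ofNat.inj h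
    exact Nat.eq_of_mul_eq_mul_left ht (Nat.add_left_cancel h)
  have hSZ := schwartz_zippel_sup_sum hf S
  have hsup : ((rainbowPart f k fun j => (c j : ℕ)).support.sup fun s =>
      ∑ i, (s i / (S i).card : ℚ≥0)) ≤ k / m := by
    refine Finset.sup_le fun s hs => ?_
    simp only [hcard]
    rw [← Finset.sum_div, ← Nat.cast_sum, ← Finsupp.degree_eq_sum,
      degree_of_mem_support_rainbowPart hs]
  have h1 := hSZ.trans hsup
  simp only [hcard, Finset.prod_const, Finset.card_univ, Fintype.card_fin] at h1
  rw [div_le_div_iff₀ (by positivity) (by positivity)] at h1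
  have h2 : ((Fintype.piFinset S).filter fun x =>
      eval x (rainbowPart f k fun j => (c j : ℕ)) = 0).card * m ≤ k * m ^ n := by
    exact_mod_cast h1
  have h3 := Finset.card_filter_add_card_filter_not (s := Fintype.piFinset S) fun x =>
      eval x (rainbowPart f k fun j => (c j : ℕ)) = 0
  rw [Fintype.card_piFinset] at h3
  simp only [hcard, Finset.prod_const, Finset.card_univ, Fintype.card_fin] at h3
  have h4 : ((Fintype.piFinset S).filter fun x =>
      ¬ eval x (rainbowPart f k fun j => (c j : ℕ)) = 0).card ≤
      (Finset.univ.filter fun x : Fin n → Fin (2 ^ e) =>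
      eval (fun j => ((x j : ℕ) : ℤ)) (rainbowPart f k fun j => x j % t) ≠ 0 ∧
        color ht x = c).card := by
    have key : ∀ x ∈ Fintype.piFinset S, ∀ j, ((Fin.ofNat (2 ^ e) (x j).toNat : ℕ) : ℤ) = x j ∧
        (Fin.ofNat (2 ^ e) (x j).toNat : ℕ) % t = c j := by
      intro x hx j
      have := Fintype.mem_piFinset.1 hx j
      obtain ⟨y, hy, hxy⟩ := Finset.mem_image.1 this
      have hy := Finset.mem_range.1 hy
      have h5 : t * (y + 1) ≤ t * m := Nat.mul_le_mul_left _ hy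
      have h6 : (c j : ℕ) + t * y < 2 ^ e := by
        have := (c j).2
        rw [mul_add, mul_one] at h5
        omega
      rw [← hxy, Int.toNat_natCast, Fin.val_ofNat, Nat.mod_eq_of_lt h6]
      exact ⟨rfl, by rw [Nat.add_mul_mod_self_left, Nat.mod_eq_of_lt (c j).2]⟩
    refine Finset.card_le_card_of_injOn (fun x j => Fin.ofNat (2 ^ e) (x j).toNat) ?_ ?_
    · intro x hx
      rw [Finset.mem_coe, Finset.mem_filter] at hx
      have hk := key x hx.1
      rw [Finset.mem_coe, Finset.mem_filter]
      refine ⟨Finset.mem_univ _, ?_, funext fun j => Fin.ext (hk j).2⟩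
      simp only [(hk _).1, (hk _).2]
      exact hx.2
    · intro x hx y hy hxy
      rw [Finset.mem_coe, Finset.mem_filter] at hx hy
      funext j
      rw [← (key x hx.1 j).1, ← (key y hy.1 j).1]
      exact congrArg (fun z : Fin (2 ^ e) => ((z : ℕ) : ℤ)) (congrFun hxy j)
  have h5 : 2 * ((Fintype.piFinset S).filter fun x =>
      eval x (rainbowPart f k fun j => (c j : ℕ)) = 0).card ≤ m ^ n := by
    refine Nat.le_of_mul_le_mul_right ?_ hm0
    calc _ = 2 * (((Fintype.piFinset S).filter fun x =>
          eval x (rainbowPart f k fun j => (c j : ℕ)) = 0).card * m) := by ring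
      _ ≤ 2 * (k * m ^ n) := by gcongr
      _ = 2 * k * m ^ n := by ring
      _ ≤ m * m ^ n := by gcongr
      _ = _ := by ring
  omega

/-- Residues modulo `t` are not exactly uniform on `2 ^ e` numbers, so the incomplete last block is
discarded. By Bernoulli, the retained fraction is at least `(1 - t / 2 ^ e) ^ n ≥ 1 - n * t / 2 ^ e
≥ 1 / 2`; this dictates `e = 2 * t + n`. -/
theorem two_pow_le_two_mul_pow (t n : ℕ) (ht : 0 < t) :
    (2 ^ (2 * t + n)) ^ n ≤ 2 * (t * (2 ^ (2 * t + n) / t)) ^ n := by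
  set E := 2 ^ (2 * t + n) with hE
  set a := t * (E / t) with ha
  have h1 : E ≤ a + t := by
    have := Nat.div_add_mod E t
    have := Nat.mod_lt E ht
    omega
  have h2 : 2 * (n * t) ≤ E := by
    have h3 : t < 2 ^ t := Nat.lt_two_pow_self
    have h4 : n < 2 ^ n := Nat.lt_two_pow_self
    have h5 : 2 ≤ 2 ^ t := by
      calc 2 = 2 ^ 1 := rfl
        _ ≤ _ := Nat.pow_le_pow_right (by norm_num) ht
    calc 2 * (n * t) ≤ 2 ^ t * (2 ^ n * 2 ^ t) := by gcongr
      _ = E := by rw [hE]; ring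
  have hE0 : (0 : ℝ) < E := by rw [hE]; positivity
  have h3 : (1 : ℝ) + n * (-(t / E)) ≤ (1 + -(t / E)) ^ n := by
    refine one_add_mul_le_pow ?_ n
    have : (t : ℝ) / E ≤ 1 := by
      rw [div_le_one hE0]
      have h6 : t ≤ E := by
        rw [hE]
        exact Nat.lt_two_pow_self.le.trans (Nat.pow_le_pow_right (by norm_num) (by omega))
      exact_mod_cast h6
    linarith
  have h4 : (1 : ℝ) / 2 ≤ (1 + -(t / E)) ^ n := by
    refine le_trans ?_ h3
    have h5 : (n : ℝ) * (t / E) ≤ 1 / 2 := by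
      rw [← mul_div_assoc, div_le_div_iff₀ hE0 (by norm_num)]
      have : ((2 * (n * t) : ℕ) : ℝ) ≤ E := by exact_mod_cast h2
      push_cast at this
      linarith
    linarith
  have h5 : (E : ℝ) * (1 + -(t / E)) ≤ a := by
    have : (E : ℝ) ≤ a + t := by exact_mod_cast h1
    rw [mul_add, mul_neg, mul_div_cancel₀ _ hE0.ne']
    linarith
  have h6 : (0 : ℝ) ≤ 1 + -(t / E) := by
    have : (t : ℝ) ≤ E := by
      have h6 : t ≤ E := by
        rw [hE]
        exact Nat.lt_two_pow_self.le.trans (Nat.pow_le_pow_right (by norm_num) (by omega))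
      exact_mod_cast h6
    have := (div_le_one hE0).2 this
    linarith
  have h7 : (E : ℝ) ^ n ≤ 2 * (a : ℝ) ^ n := by
    calc (E : ℝ) ^ n = 2 * (E ^ n * (1 / 2)) := by ring
      _ ≤ 2 * (E ^ n * (1 + -(t / E)) ^ n) := by gcongr
      _ = 2 * (E * (1 + -(t / E))) ^ n := by rw [mul_pow]
      _ ≤ _ := by gcongr
  exact_mod_cast h7

theorem two_pow_le_mul_card_eval_ne_zero {q k : ℕ} (hq : 0 < q) (hk : k ≤ 10 * q)
    {f : MvPolynomial (Fin n) ℤ} (hf : HasMultilinearTerm k f) :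
    (2 ^ (2 * (13 * q) + n)) ^ n ≤ 4 * ((13 * q + 1) * 271 ^ q) *
      (Finset.univ.filter fun x : Fin n → Fin (2 ^ (2 * (13 * q) + n)) =>
        eval (fun j => ((x j : ℕ) : ℤ)) (rainbowPart f k fun j => x j % (13 * q)) ≠ 0).card := by
  have hcol := colors_pow_le_mul_descFactorial hk
  set t := 13 * q with htq
  set F := (t + 1) * 271 ^ q with hF
  set e := 2 * t + n with he
  have ht : 0 < t := by omega
  have hkt : k ≤ t := by omega
  obtain ⟨m₀, hm₁, hm₂, hm₃⟩ := hf
  set S := m₀.support with hS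
  have hdeg : m₀.degree = k := by rw [Finsupp.degree_eq_sum, hm₂]
  have hScard : S.card = k := by
    rw [← hdeg, Finsupp.degree_apply, Finset.card_eq_sum_ones]
    refine Finset.sum_congr rfl fun j hj => ?_
    have h1 := hm₁ j
    have h2 := Finsupp.mem_support_iff.1 hj
    omega
  have hkn : k ≤ n := by
    rw [← hScard]
    simpa using Finset.card_le_univ S
  set m := 2 ^ e / t with hm
  have htm : t * m ≤ 2 ^ e := Nat.mul_div_le _ _
  have hmk : 2 * t ≤ m := by
    rw [hm, Nat.le_div_iff_mul_le ht]
    have h3 : t < 2 ^ t := Nat.lt_two_pow_self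
    have h4 : 1 ≤ 2 ^ n := Nat.one_le_two_pow
    have h5 : t + 1 ≤ 2 ^ t := h3
    have h6 : 2 * t ≤ 2 ^ t := by
      have h6 : t - 1 < 2 ^ (t - 1) := Nat.lt_two_pow_self
      have h7 : 2 ^ t = 2 ^ (t - 1) * 2 := by rw [← pow_succ, Nat.sub_add_cancel ht]
      omega
    calc 2 * t * t ≤ 2 ^ t * 2 ^ t := by gcongr
      _ = 2 ^ (2 * t) := by rw [← pow_add, two_mul]
      _ ≤ 2 ^ e := Nat.pow_le_pow_right (by norm_num) (by omega)
  set G := Finset.univ.filter fun x : Fin n → Fin (2 ^ e) =>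
        eval (fun j => ((x j : ℕ) : ℤ)) (rainbowPart f k fun j => x j % t) ≠ 0 with hG
  set I := Finset.univ.filter fun c : Fin n → Fin t => Set.InjOn c S with hI
  -- If the coloring is injective on its support, the given multilinear monomial `m₀` survives with
  -- its coefficient unchanged.
  have hne : ∀ c ∈ I, rainbowPart f k (fun j => (c j : ℕ)) ≠ 0 := by
    intro c hc h0
    have h1 : (S.image fun j => (c j : ℕ)).card = k := by
      rw [Finset.card_image_of_injOn, hScard]
      intro i hi j hj hij
      exact (Finset.mem_filter.1 hc).2 hi hj (Fin.ext hij)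
    have h2 := coeff_rainbowPart f k (fun j => (c j : ℕ)) m₀
    rw [h0, if_pos ⟨hdeg, h1⟩, coeff_zero] at h2
    exact hm₃ h2.symm
  -- Good outcomes with different colorings are different, so the bounds for the single colorings
  -- add up.
  have hfib : I.card * m ^ n ≤ 2 * G.card := by
    have h1 : G.card = ∑ c, (G.filter fun x => color ht x = c).card :=
      Finset.card_eq_sum_card_fiberwise fun x _ => Finset.mem_coe.2 (Finset.mem_univ _)
    rw [h1, Finset.mul_sum]
    calc I.card * m ^ n = ∑ c ∈ I, m ^ n := by simp
      _ ≤ ∑ c ∈ I, 2 * (G.filter fun x => color ht x = c).card := by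
        refine Finset.sum_le_sum fun c hc => ?_
        rw [hG, Finset.filter_filter]
        exact pow_le_two_mul_card_eval_ne_zero ht htm (by omega) (by omega) c (hne c hc)
      _ ≤ _ := Finset.sum_le_sum_of_subset (Finset.subset_univ _)
  have hIcard : t ^ n ≤ F * I.card := by
    have h1 := le_card_injOn (t := t) S
    rw [hScard] at h1
    calc t ^ n = t ^ k * t ^ (n - k) := by rw [← pow_add, Nat.add_sub_cancel' hkn]
      _ ≤ F * t.descFactorial k * t ^ (n - k) := by gcongr
      _ = F * (t.descFactorial k * t ^ (n - k)) := by ring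
      _ ≤ F * I.card := by gcongr
  calc (2 ^ e) ^ n ≤ 2 * (t * m) ^ n := two_pow_le_two_mul_pow t n ht
    _ = 2 * (t ^ n * m ^ n) := by rw [mul_pow]
    _ ≤ 2 * (F * I.card * m ^ n) := by gcongr
    _ = 2 * F * (I.card * m ^ n) := by ring
    _ ≤ 2 * F * (2 * G.card) := by gcongr
    _ = 4 * F * G.card := by ring

/-- The outcomes of the coin flips of a trial that make it succeed. -/
noncomputable def successes (f : MvPolynomial (Fin n) ℤ) (k t e B : ℕ) :
    Finset ((Fin n → Fin (2 ^ e)) × Fin (2 ^ B)) :=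
  Finset.univ.filter fun d => ¬ ((d.2 + 1 : ℕ) : ℤ) ∣ (t - k).factorial *
    eval (fun j => ((d.1 j : ℕ) : ℤ)) (rainbowPart f k fun j => d.1 j % t)

/-- The factor 8 collects three losses of one half: the discarded block of random numbers,
Schwartz–Zippel, and the prime divisors. Given a good `x`, the choice of `p` is counted with `W` one
more than the computed height plus `t`, which also accommodates `(t - k)!`. -/
theorem two_pow_le_mul_card_successes {C : Circuit n} {k : ℕ} (hf : HasMultilinearTerm k C.poly) :
    (2 ^ varBits n k) ^ n * 2 ^ baseBits C k ≤
      8 * baseBits C k * (colors k + 1) * 271 ^ blocks k *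
        (successes C.poly k (colors k) (varBits n k) (baseBits C k)).card := by
  have h1 := two_pow_le_mul_card_eval_ne_zero (q := blocks k) (by unfold blocks; omega)
    (by unfold blocks; omega) hf
  change (2 ^ varBits n k) ^ n ≤ 4 * ((colors k + 1) * 271 ^ blocks k) *
      (Finset.univ.filter fun x : Fin n → Fin (2 ^ varBits n k) =>
        eval (fun j => ((x j : ℕ) : ℤ)) (rainbowPart C.poly k fun j => x j % colors k) ≠ 0).card
    at h1
  set t := colors k with ht
  set e := varBits n k with he
  set W := C.val (heightInterp e) C.out + t + 1 with hW
  have hB : baseBits C k = 2 * W + 2 := by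
    rw [baseBits, ← he, ← ht]
    omega
  rw [hB]
  set G := Finset.univ.filter fun x : Fin n → Fin (2 ^ e) =>
        eval (fun j => ((x j : ℕ) : ℤ)) (rainbowPart C.poly k fun j => x j % t) ≠ 0 with hG
  have ht0 : 0 < t := by
    rw [ht, colors, blocks]
    omega
  have h2 : (successes C.poly k t e (2 * W + 2)).card = ∑ x : Fin n → Fin (2 ^ e),
      (Finset.univ.filter fun r : Fin (2 ^ (2 * W + 2)) => ¬ ((r + 1 : ℕ) : ℤ) ∣
        (t - k).factorial * eval (fun j => ((x j : ℕ) : ℤ))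
          (rainbowPart C.poly k fun j => x j % t)).card := by
    rw [successes, ← Finset.univ_product_univ, Finset.card_filter, Finset.sum_product]
    simp only [Finset.card_filter]
  have h3 : G.card * 2 ^ (2 * W + 2) ≤
      2 * (2 * W + 2) * (successes C.poly k t e (2 * W + 2)).card := by
    rw [h2, Finset.mul_sum]
    calc G.card * 2 ^ (2 * W + 2) = ∑ x ∈ G, 2 ^ (2 * W + 2) := by simp
      _ ≤ ∑ x ∈ G, _ := Finset.sum_le_sum fun x hx => ?_
      _ ≤ _ := Finset.sum_le_sum_of_subset (Finset.subset_univ _)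
    refine two_pow_le_mul_card_not_dvd ?_ ?_ (by omega)
    · exact mul_ne_zero (by exact_mod_cast Nat.factorial_ne_zero _) (Finset.mem_filter.1 hx).2
    · exact natAbs_factorial_mul_le (x := fun j => (x j : ℕ)) (fun j => (x j).2) _
  calc (2 ^ e) ^ n * 2 ^ (2 * W + 2)
      ≤ 4 * ((t + 1) * 271 ^ blocks k) * G.card * 2 ^ (2 * W + 2) := by gcongr
    _ = 4 * ((t + 1) * 271 ^ blocks k) * (G.card * 2 ^ (2 * W + 2)) := by ring
    _ ≤ 4 * ((t + 1) * 271 ^ blocks k) *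
        (2 * (2 * W + 2) * (successes C.poly k t e (2 * W + 2)).card) := by gcongr
    _ = _ := by ring

end Outcomes

/-! ### The probability of success -/

section Coins

theorem num_eq_of_testBit {ω : ℕ → Bool} {c : ℕ} : ∀ {e v : ℕ}, v < 2 ^ e →
    (∀ s < e, ω (c + s) = v.testBit (e - 1 - s)) → num ω c e = v := by
  intro e
  induction e with
  | zero =>
    intro v hv _
    simp only [num]
    omega
  | succ e ih =>
    intro v hv h
    have h1 : num ω c e = v / 2 := by
      refine ih (by rw [pow_succ] at hv; omega) fun s hs => ?_
      rw [h s (by omega), Nat.testBit_div_two]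
      congr 1
      omega
    have h2 := h e (by omega)
    rw [num, h1, h2, show e + 1 - 1 - e = 0 by omega, Nat.testBit_zero]
    simp only [decide_eq_true_eq]
    split <;> omega

/-- A sequence of coin flips for which the random numbers of the trial number `i` are given by
`d i`. -/
def coinsOf {n e B R : ℕ} (d : Fin R → (Fin n → Fin (2 ^ e)) × Fin (2 ^ B)) (a : ℕ) : Bool :=
  if hi : a / (n * e + B) < R then
    if hj : a % (n * e + B) / e < n then
      ((d ⟨_, hi⟩).1 ⟨_, hj⟩ : ℕ).testBit (e - 1 - a % (n * e + B) % e)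
    else ((d ⟨_, hi⟩).2 : ℕ).testBit (B - 1 - (a % (n * e + B) - n * e))
  else false

variable {n e B R : ℕ} {ω : ℕ → Bool} {d : Fin R → (Fin n → Fin (2 ^ e)) × Fin (2 ^ B)}

theorem add_lt_mul_add (i : Fin R) {r K : ℕ} (hr : r < K) : i * K + r < R * K := by
  have : (i + 1) * K ≤ R * K := Nat.mul_le_mul_right _ i.2
  rw [add_mul, one_mul] at this
  omega

theorem trialVar_eq (h : ∀ a < R * (n * e + B), ω a = coinsOf d a) (i : Fin R) (j : Fin n) :
    trialVar ω (i * (n * e + B)) e j = (d i).1 j := by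
  refine num_eq_of_testBit ((d i).1 j).2 fun s hs => ?_
  have h1 : j * e + s < n * e := add_lt_mul_add j hs
  have h2 : j * e + s < n * e + B := by omega
  have he : 0 < e := by omega
  rw [add_assoc, h _ (add_lt_mul_add i h2), coinsOf]
  have h3 : (i * (n * e + B) + (j * e + s)) / (n * e + B) = i := by
    rw [mul_comm, Nat.mul_add_div (by omega), Nat.div_eq_of_lt h2, add_zero]
  have h4 : (i * (n * e + B) + (j * e + s)) % (n * e + B) = j * e + s := by
    rw [mul_comm, Nat.mul_add_mod, Nat.mod_eq_of_lt h2]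
  have h5 : (j * e + s) / e = j := by
    rw [mul_comm, Nat.mul_add_div he, Nat.div_eq_of_lt hs, add_zero]
  have h6 : (j * e + s) % e = s := by
    rw [mul_comm, Nat.mul_add_mod, Nat.mod_eq_of_lt hs]
  simp only [h3, h4, h5, h6, i.2, j.2, dif_pos, Fin.eta]

theorem trialBase_eq (he : 0 < e) (h : ∀ a < R * (n * e + B), ω a = coinsOf d a) (i : Fin R) :
    trialBase ω (i * (n * e + B)) n e B = (d i).2 + 1 := by
  rw [trialBase, num_eq_of_testBit (d i).2.2 fun s hs => ?_]
  have h2 : n * e + s < n * e + B := by omega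
  rw [add_assoc, h _ (add_lt_mul_add i h2), coinsOf]
  have h3 : (i * (n * e + B) + (n * e + s)) / (n * e + B) = i := by
    rw [mul_comm, Nat.mul_add_div (by omega), Nat.div_eq_of_lt h2, add_zero]
  have h4 : (i * (n * e + B) + (n * e + s)) % (n * e + B) = n * e + s := by
    rw [mul_comm, Nat.mul_add_mod, Nat.mod_eq_of_lt h2]
  have h6 : n * e + s - n * e = s := by omega
  have h5 : ¬ (n * e + s) / e < n := by
    rw [not_lt, Nat.le_div_iff_mul_le he]
    omega
  simp only [h3, h4, h6, h5, i.2, dif_pos, Fin.eta, dif_neg, not_false_eq_true]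

theorem coinMeasure_cylinder (τ : ℕ → Bool) (N : ℕ) :
    coinMeasure {ω | ∀ a < N, ω a = τ a} = (2⁻¹ : ℝ≥0∞) ^ N := by
  have h1 : {ω : ℕ → Bool | ∀ a < N, ω a = τ a} =
      Set.pi (Finset.range N : Set ℕ) fun a => {τ a} := by
    ext ω
    simp [Set.mem_pi]
  rw [h1, coinMeasure, Measure.infinitePi_pi _ (fun _ _ => MeasurableSet.singleton _)]
  simp

theorem measurableSet_cylinder (τ : ℕ → Bool) (N : ℕ) :
    MeasurableSet {ω : ℕ → Bool | ∀ a < N, ω a = τ a} := by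
  have h1 : {ω : ℕ → Bool | ∀ a < N, ω a = τ a} =
      Set.pi (Finset.range N : Set ℕ) fun a => {τ a} := by
    ext ω
    simp [Set.mem_pi]
  rw [h1]
  exact MeasurableSet.pi (Finset.countable_toSet _) fun _ _ => MeasurableSet.singleton _

/-- Each list of outcomes of all trials prescribes the first `R * (n * e + B)` coins, and different
lists give disjoint cylinders of equal measure. Only a lower bound is claimed, so measurability of
`E` is not required. -/
theorem card_mul_le_coinMeasure
    (G : Finset (Fin R → (Fin n → Fin (2 ^ e)) × Fin (2 ^ B))) {E : Set (ℕ → Bool)} (he : 0 < e)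
    (hE : ∀ d ∈ G, ∀ ω : ℕ → Bool, (∀ i : Fin R,
      (∀ j : Fin n, trialVar ω (i * (n * e + B)) e j = (d i).1 j) ∧
      trialBase ω (i * (n * e + B)) n e B = (d i).2 + 1) → ω ∈ E) :
    G.card * (2⁻¹ : ℝ≥0∞) ^ (R * (n * e + B)) ≤ coinMeasure E := by
  have h1 : coinMeasure (⋃ d ∈ G, {ω | ∀ a < R * (n * e + B), ω a = coinsOf d a}) =
      G.card * (2⁻¹ : ℝ≥0∞) ^ (R * (n * e + B)) := by
    rw [measure_biUnion_finset]
    · simp [coinMeasure_cylinder]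
    · intro d _ d' _ hne
      rw [Function.onFun, Set.disjoint_left]
      intro ω h h'
      refine hne (funext fun i => Prod.ext (funext fun j => Fin.ext ?_) (Fin.ext ?_))
      · rw [← trialVar_eq h i j, ← trialVar_eq h' i j]
      · have h2 := trialBase_eq he h i
        rw [trialBase_eq he h' i] at h2
        omega
    · exact fun d _ => measurableSet_cylinder _ _
  rw [← h1]
  refine measure_mono (Set.iUnion₂_subset fun d hd ω h => hE d hd ω fun i => ?_)
  exact ⟨fun j => trialVar_eq h i j, trialBase_eq he h i⟩

/-- If a trial succeeds with probability at least `1 / P`, then `5 * P` independent trials all fail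
with probability at most `(1 - 1 / P) ^ (5 * P) ≤ exp (-5) < 1 / 100`. -/
theorem hundred_mul_pow_le {b D P : ℕ} (hP : 0 < P) (h : D ≤ P * (D - b)) (hb : b ≤ D) :
    100 * b ^ (5 * P) ≤ D ^ (5 * P) := by
  have h1 : (b : ℝ) ≤ D * (1 - 1 / P) := by
    have h2 : (D : ℝ) ≤ P * (D - b) := by exact_mod_cast h
    have h3 : (0 : ℝ) < P := by exact_mod_cast hP
    have h4 : (D : ℝ) / P ≤ D - b := by rwa [div_le_iff₀' h3]
    rw [mul_sub, mul_one, mul_one_div]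
    linarith
  have h3 : (1 : ℝ) - 1 / P ≤ Real.exp (-(1 / P)) := by
    have := Real.add_one_le_exp (-(1 / (P : ℝ)))
    linarith
  have h5 : Real.exp (-(1 / P)) ^ (5 * P) ≤ 1 / 100 := by
    rw [← Real.exp_nat_mul]
    have h6 : ((5 * P : ℕ) : ℝ) * -(1 / P) = -5 := by
      have : (P : ℝ) ≠ 0 := by exact_mod_cast hP.ne'
      push_cast
      field_simp
    rw [h6, Real.exp_neg, one_div]
    refine inv_anti₀ (by norm_num) ?_
    calc (100 : ℝ) ≤ 2.7182818283 ^ 5 := by norm_num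
      _ ≤ Real.exp 1 ^ 5 := by
        gcongr
        exact Real.exp_one_gt_d9.le
      _ = Real.exp 5 := by rw [← Real.exp_nat_mul]; norm_num
  have h6 : (b : ℝ) ^ (5 * P) ≤ D ^ (5 * P) * (1 / 100) := by
    calc (b : ℝ) ^ (5 * P) ≤ (D * Real.exp (-(1 / P))) ^ (5 * P) := by
          gcongr
          exact h1.trans (by gcongr)
      _ = D ^ (5 * P) * Real.exp (-(1 / P)) ^ (5 * P) := mul_pow _ _ _
      _ ≤ _ := by gcongr
  have h7 : (100 : ℝ) * b ^ (5 * P) ≤ D ^ (5 * P) := by linarith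
  exact_mod_cast h7

theorem le_coinMeasure_exists_trialSucceeds {C : Circuit n} {k : ℕ}
    (hf : HasMultilinearTerm k C.poly) :
    (99 / 100 : ℝ≥0∞) ≤ coinMeasure {ω | ∃ i < trials C k, TrialSucceeds ω C k (colors k)
      (varBits n k) (baseBits C k) (i * trialCoins C k)} := by
  classical
  set t := colors k with ht
  set e := varBits n k with he
  set B := baseBits C k with hB
  set P := 8 * B * (t + 1) * 271 ^ blocks k with hP
  have ht0 : 0 < t := by
    rw [ht, colors, blocks]
    omega
  have hkt : k ≤ t := by
    rw [ht, colors, blocks]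
    omega
  have he0 : 0 < e := by
    rw [he, varBits, ← ht]
    omega
  have hB0 : 0 < B := by
    rw [hB, baseBits]
    omega
  have hP0 : 0 < P := by positivity
  -- This explains the constant in `trials`: `40 = 5 * 8`.
  have hR : trials C k = 5 * P := by
    rw [trials, hP]
    ring
  have hK : trialCoins C k = n * e + B := rfl
  set D := (2 ^ e) ^ n * 2 ^ B with hD
  have hDK : D = 2 ^ (n * e + B) := by
    rw [hD, ← pow_mul, ← pow_add, mul_comm e n]
  set S := successes C.poly k t e B with hS
  have hcardD : Fintype.card ((Fin n → Fin (2 ^ e)) × Fin (2 ^ B)) = D := by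
    simp [hD]
  have hcompl : Sᶜ.card = D - S.card := by rw [Finset.card_compl, hcardD]
  have hSD : S.card ≤ D := by
    rw [← hcardD]
    exact Finset.card_le_univ _
  have hDS : D ≤ P * (D - Sᶜ.card) := by
    rw [hcompl, Nat.sub_sub_self hSD]
    exact two_pow_le_mul_card_successes hf
  have hbad := hundred_mul_pow_le hP0 hDS (by omega)
  rw [hR, hK]
  set R := 5 * P with hRdef
  set bad : Finset (Fin R → (Fin n → Fin (2 ^ e)) × Fin (2 ^ B)) :=
    Fintype.piFinset fun _ => Sᶜ with hbaddef
  have hbadcard : bad.card = Sᶜ.card ^ R := by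
    rw [hbaddef, Fintype.card_piFinset]
    simp
  have hgood : 99 * D ^ R ≤ 100 * badᶜ.card := by
    rw [Finset.card_compl, hbadcard, Fintype.card_fun, hcardD, Fintype.card_fin]
    omega
  have hmeas := card_mul_le_coinMeasure (R := R) badᶜ (E := {ω | ∃ i < R,
      TrialSucceeds ω C k t e B (i * (n * e + B))}) he0 ?_
  · refine le_trans ?_ hmeas
    have h1 : (99 : ℝ≥0∞) * 2 ^ (R * (n * e + B)) ≤ 100 * badᶜ.card := by
      rw [hDK, ← pow_mul, mul_comm _ R] at hgood
      exact_mod_cast hgood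
    rw [← ENNReal.inv_pow, ← div_eq_mul_inv, ENNReal.div_le_iff (by norm_num) (by norm_num),
      ← ENNReal.mul_div_right_comm, ENNReal.le_div_iff_mul_le (by simp) (by simp), mul_comm _ 100]
    exact h1
  · intro d hd ω h
    rw [Finset.mem_compl, hbaddef, Fintype.mem_piFinset] at hd
    push Not at hd
    obtain ⟨i, hi⟩ := hd
    rw [Finset.mem_compl, not_not, hS, successes, Finset.mem_filter] at hi
    refine ⟨i, i.2, ?_⟩
    rw [TrialSucceeds, (h i).2, trialSum_mod_ne_zero_iff C (by omega) _ ht0 hkt]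
    simp only [(h i).1]
    exact hi.2

end Coins

/-! ### Running time -/

section Time

variable {n : ℕ}

theorem le_foldr_max (l : List ℕ) : ∀ v ∈ l, v ≤ l.foldr max 0 := by
  induction l with
  | nil => simp
  | cons w l ih =>
    intro v hv
    rw [List.foldr_cons]
    rcases List.mem_cons.1 hv with rfl | hv
    · exact le_max_left _ _
    · exact (ih v hv).trans (le_max_right _ _)

theorem foldr_max_le {l : List ℕ} {b : ℕ} (h : ∀ v ∈ l, v ≤ b) : l.foldr max 0 ≤ b := by
  induction l with
  | nil => simp
  | cons w l ih =>
    rw [List.foldr_cons]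
    exact max_le (h w (by simp)) (ih fun v hv => h v (by simp [hv]))

theorem foldl_max_le {l : List ℕ} {a b : ℕ} (ha : a ≤ b) (h : ∀ v ∈ l, v ≤ b) :
    l.foldl max a ≤ b := by
  induction l generalizing a with
  | nil => simpa
  | cons w l ih =>
    rw [List.foldl_cons]
    exact ih (max_le ha (h w (by simp))) fun v hv => h v (by simp [hv])

theorem Circuit.depthAt_le (C : Circuit n) (i : ℕ) (hi : i < C.numGates) : C.depthAt i hi ≤ i := by
  induction i using Nat.strong_induction_on with
  | _ i ih =>
    have key : ∀ l : List (Fin i),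
        (l.map fun j : Fin i => C.depthAt j.1 (j.2.trans hi) + 1).foldr max 0 ≤ i := by
      intro l
      refine foldr_max_le fun v hv => ?_
      obtain ⟨j, -, rfl⟩ := List.mem_map.1 hv
      exact (Nat.succ_le_succ (ih j.1 j.2 _)).trans j.2
    rw [Circuit.depthAt]
    cases C.gate ⟨i, hi⟩ with
    | var j => exact Nat.zero_le _
    | const c => exact Nat.zero_le _
    | add l => exact key l
    | mul l => exact key l

/-- Each level of the circuit adds at most the number of digits of its fan-in, hence of `C.size`;
leaves have height at most `e` or the double logarithm of a constant. The slack also absorbs the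
initial accumulator `1` of products. -/
theorem value_heightInterp_le (C : Circuit n) (e i : ℕ) (hi : i < C.numGates) :
    C.value (heightInterp e) i hi ≤ (C.depthAt i hi + 1) * (Nat.size C.size + e + 2) := by
  set W := Nat.size C.size + e + 2 with hW
  induction i using Nat.strong_induction_on with
  | _ i ih =>
    have hwt := C.weight_le ⟨i, hi⟩
    have key : ∀ (l : List (Fin i)) (op : ℕ), op ≤ 1 → l.length ≤ C.size →
        (heightInterp e).fin l.length
          ((l.map fun j : Fin i => C.value (heightInterp e) j.1 (j.2.trans hi)).foldl
            ((heightInterp e).step op) op) ≤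
        ((l.map fun j : Fin i => C.depthAt j.1 (j.2.trans hi) + 1).foldr max 0 + 1) * W := by
      intro l op hop hl
      set d := (l.map fun j : Fin i => C.depthAt j.1 (j.2.trans hi) + 1).foldr max 0 with hd
      have h1 : (l.map fun j : Fin i => C.value (heightInterp e) j.1 (j.2.trans hi)).foldl max op ≤
          d * W + 1 := by
        refine foldl_max_le (by omega) fun v hv => ?_
        obtain ⟨j, hj, rfl⟩ := List.mem_map.1 hv
        have h2 : C.depthAt j.1 (j.2.trans hi) + 1 ≤ d :=
          le_foldr_max _ _ (List.mem_map_of_mem hj)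
        exact ((ih j.1 j.2 _).trans (Nat.mul_le_mul_right _ h2)).trans (Nat.le_succ _)
      have h3 : Nat.size l.length ≤ Nat.size C.size := Nat.size_le_size hl
      change (l.map fun j : Fin i => C.value (heightInterp e) j.1 (j.2.trans hi)).foldl max op +
        Nat.size l.length ≤ _
      rw [add_mul, one_mul]
      omega
    rw [Circuit.value, Circuit.depthAt]
    cases hg : C.gate ⟨i, hi⟩ with
    | var j =>
      change e ≤ (0 + 1) * W
      omega
    | const c =>
      rw [hg, Gate.weight] at hwt
      have h1 := clog_two_le_size (Nat.size c.natAbs)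
      have h2 : Nat.size (Nat.size c.natAbs) ≤ Nat.size C.size := Nat.size_le_size (by omega)
      change Nat.clog 2 (Nat.size c.natAbs) ≤ (0 + 1) * W
      omega
    | add l =>
      rw [hg, Gate.weight] at hwt
      exact key l 0 (by omega) (by omega)
    | mul l =>
      rw [hg, Gate.weight] at hwt
      exact key l 1 (by omega) (by omega)

theorem colors_le {k : ℕ} (hk : k ≤ n) : colors k ≤ 2 * n + 13 := by
  unfold colors blocks
  omega

theorem baseBits_le (C : Circuit n) {k M : ℕ} (hk : k ≤ n)
    (hM : M = n + C.depth + Nat.size C.size + 1) : baseBits C k ≤ 86 * M ^ 2 := by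
  have h1 := value_heightInterp_le C (varBits n k) C.out.1 C.out.2
  have ht := colors_le hk
  rw [Circuit.value_eq_val] at h1
  -- `varBits n k ≤ 5 * n + 26`, hence `28 = 26 + 2`. The final constant is `86 = 2 * 28 + 30`.
  have h2 : Nat.size C.size + varBits n k + 2 ≤ 28 * M := by
    unfold varBits
    omega
  have h3 : C.depthAt C.out.1 C.out.2 + 1 ≤ M := by
    change C.depth + 1 ≤ M
    omega
  have h4 := h1.trans (Nat.mul_le_mul h3 h2)
  have h5 : M ≤ M ^ 2 := Nat.le_self_pow (by norm_num) M
  have h6 : M * (28 * M) = 28 * M ^ 2 := by ring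
  unfold baseBits
  omega

theorem sizeBound (C : Circuit n) {k M : ℕ} (hk : k ≤ n)
    (hM : M = n + C.depth + Nat.size C.size + 1) :
    SizeBound C k (colors k) (varBits n k) (baseBits C k) (200 * M ^ 3) := by
  have hM1 : 1 ≤ M := by omega
  have ht := colors_le hk
  have hB := baseBits_le C hk hM
  have h2 : M ≤ M ^ 2 := Nat.le_self_pow (by norm_num) M
  have h3 : M ^ 2 ≤ M ^ 3 := Nat.pow_le_pow_right hM1 (by norm_num)
  refine ⟨?_, ?_, by omega, ?_, ?_, by omega, ?_, ?_, ?_⟩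
  · unfold colors blocks; omega
  · unfold colors blocks; omega
  · calc (colors k + 1) ^ 2 ≤ (14 * M) ^ 2 := by gcongr; omega
      _ = 196 * M ^ 2 := by ring
      _ ≤ _ := by omega
  · unfold varBits
    omega
  · calc (k + 1) * (baseBits C k + 2) ≤ M * (88 * M ^ 2) := by gcongr <;> omega
      _ = 88 * M ^ 3 := by ring
      _ ≤ _ := by omega
  · have h4 := C.len_le
    have h5 := C.numGates_le
    have h6 := Nat.lt_size_self C.size
    have h7 : n < 2 ^ n := Nat.lt_two_pow_self
    have h8 := C.one_le_size
    have h9 : C.len + C.numGates + n < 2 ^ (Nat.size C.size + n + 4) := by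
      have e1 : 2 ^ (Nat.size C.size + n + 4) = 16 * (2 ^ Nat.size C.size * 2 ^ n) := by ring
      have e2 : 2 ^ Nat.size C.size ≤ 2 ^ Nat.size C.size * 2 ^ n :=
        Nat.le_mul_of_pos_right _ (by positivity)
      have e3 : 2 ^ n ≤ 2 ^ Nat.size C.size * 2 ^ n := Nat.le_mul_of_pos_left _ (by positivity)
      omega
    have := bitCost_le h9
    omega
  · unfold bitCost
    omega

/-- Gates that do not lead to the output may be much deeper than `C.depth`, so their heights are
bounded with depth at most `C.size`. Only the bit length of the height matters here, and it is
logarithmic in `C.size`. -/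
theorem bitCost_val_le (C : Circuit n) {k M : ℕ} (hk : k ≤ n)
    (hM : M = n + C.depth + Nat.size C.size + 1) (i : ℕ) (hi : i < C.numGates) :
    bitCost (C.val (heightInterp (varBits n k)) i) ≤ 200 * M ^ 3 := by
  have hM1 : 1 ≤ M := by omega
  have ht := colors_le hk
  have h2 : M ≤ M ^ 2 := Nat.le_self_pow (by norm_num) M
  have h3 : M ^ 2 ≤ M ^ 3 := Nat.pow_le_pow_right hM1 (by norm_num)
  have h4 := value_heightInterp_le C (varBits n k) i hi
  rw [Circuit.value_eq_val] at h4
  have h5 := C.depthAt_le i hi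
  have h6 := C.numGates_le
  have h7 : C.depthAt i hi + 1 ≤ C.size := by omega
  have h8 := bitCost_mono (h4.trans (Nat.mul_le_mul_right _ h7))
  have h9 := bitCost_mul_le C.size (Nat.size C.size + varBits n k + 2)
  have h10 := bitCost_le_self (Nat.size C.size + varBits n k + 2)
  have h11 : bitCost C.size = Nat.size C.size + 1 := rfl
  unfold varBits at *
  omega

/-- `2 ^ 13 * 271 = 2220032 ≤ 4.32 ^ 10`; the incomplete last block of ten is paid by the constant
factor. -/
theorem pow_blocks_le (k : ℕ) :
    (((2 ^ 13 * 271) ^ blocks k : ℕ) : ℝ) ≤ 2220032 * (4.32 : ℝ) ^ k := by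
  have h1 : k = 10 * (k / 10) + k % 10 := (Nat.div_add_mod k 10).symm
  have h2 : ((2220032 : ℝ)) ^ (k / 10) ≤ (4.32 : ℝ) ^ k := by
    calc ((2220032 : ℝ)) ^ (k / 10) ≤ (4.32 ^ 10) ^ (k / 10) := by gcongr; norm_num
      _ = (4.32 : ℝ) ^ (10 * (k / 10)) := by rw [pow_mul]
      _ ≤ _ := pow_le_pow_right₀ (by norm_num) (by omega)
  rw [blocks]
  push_cast
  rw [pow_succ, mul_comm]
  norm_num at h2 ⊢
  exact h2

/-- The constant factor in the bound on the running time. -/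
def timeConst : ℕ := 2220032 * (40 * 86 * 14) * (1200 * 200 ^ 3)

/-- The exponent 12 is the sum of 2 for the bits of the base, 1 for the colors and 9 for the cube of
the size bound `200 * M ^ 3`. -/
theorem time_le (C : Circuit n) {k M : ℕ} (hk : k ≤ n)
    (hM : M = n + C.depth + Nat.size C.size + 1) :
    ((trials C k * (2 ^ colors k * (C.size * (1200 * (200 * M ^ 3) ^ 3))) : ℕ) : ℝ) ≤
      4.32 ^ k * C.size * (timeConst * M ^ 12 : ℕ) := by
  have ht := colors_le hk
  have hB := baseBits_le C hk hM
  have h1 : trials C k * (2 ^ colors k * (C.size * (1200 * (200 * M ^ 3) ^ 3))) ≤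
      (2 ^ 13 * 271) ^ blocks k * C.size *
        ((40 * 86 * 14) * (1200 * 200 ^ 3) * M ^ 12) := by
    calc trials C k * (2 ^ colors k * (C.size * (1200 * (200 * M ^ 3) ^ 3)))
        = (2 ^ 13 * 271) ^ blocks k * C.size *
          (40 * baseBits C k * (colors k + 1) * (1200 * (200 * M ^ 3) ^ 3)) := by
          have h2 : (2 ^ 13 * 271) ^ blocks k = 2 ^ colors k * 271 ^ blocks k := by
            rw [mul_pow, colors, pow_mul]
          rw [h2, trials]
          ring
      _ ≤ (2 ^ 13 * 271) ^ blocks k * C.size *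
          (40 * (86 * M ^ 2) * (14 * M) * (1200 * (200 * M ^ 3) ^ 3)) := by
          gcongr
          omega
      _ = _ := by ring
  calc ((trials C k * (2 ^ colors k * (C.size * (1200 * (200 * M ^ 3) ^ 3))) : ℕ) : ℝ)
      ≤ (((2 ^ 13 * 271) ^ blocks k * C.size *
        ((40 * 86 * 14) * (1200 * 200 ^ 3) * M ^ 12) : ℕ) : ℝ) := by exact_mod_cast h1
    _ = ((2 ^ 13 * 271) ^ blocks k : ℕ) * C.size *
        (((40 * 86 * 14) * (1200 * 200 ^ 3) * M ^ 12 : ℕ) : ℝ) := by push_cast; ring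
    _ ≤ 2220032 * 4.32 ^ k * C.size *
        (((40 * 86 * 14) * (1200 * 200 ^ 3) * M ^ 12 : ℕ) : ℝ) := by
        gcongr
        exact pow_blocks_le k
    _ = _ := by
        unfold timeConst
        push_cast
        ring

theorem time_le_of_lt (C : Circuit n) {k M : ℕ} (hM : M = n + C.depth + Nat.size C.size + 1) :
    ((100 * (k + 1) * (Nat.size C.size + 1) : ℕ) : ℝ) ≤
      4.32 ^ k * C.size * (timeConst * M ^ 12 : ℕ) := by
  have h1 : ((k + 1 : ℕ) : ℝ) ≤ 4.32 ^ k := by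
    calc ((k + 1 : ℕ) : ℝ) ≤ ((2 ^ k : ℕ) : ℝ) := by exact_mod_cast Nat.lt_two_pow_self
      _ = 2 ^ k := by push_cast; rfl
      _ ≤ _ := by gcongr; norm_num
  have h2 : (1 : ℝ) ≤ C.size := by exact_mod_cast C.one_le_size
  have h3 : 100 * (Nat.size C.size + 1) ≤ timeConst * M ^ 12 := by
    have h4 : M ≤ M ^ 12 := Nat.le_self_pow (by norm_num) M
    exact Nat.mul_le_mul (by norm_num [timeConst]) (by omega)
  calc ((100 * (k + 1) * (Nat.size C.size + 1) : ℕ) : ℝ)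
      = ((k + 1 : ℕ) : ℝ) * 1 * ((100 * (Nat.size C.size + 1) : ℕ) : ℝ) := by push_cast; ring
    _ ≤ _ := by
      gcongr

theorem haltsWithin_detectProg (C : Circuit n) (k : ℕ) (ω : ℕ → Bool) :
    HaltsWithin detectProg C k ω (4.32 ^ k * C.size *
      (timeConst * (n + C.depth + Nat.size C.size + 1) ^ 12 : ℕ)) := by
  rcases le_or_gt k n with hk | hk
  · obtain ⟨T, s, h, hT, -⟩ := (detectProg_spec (ω := ω) hk (sizeBound C hk rfl)
      (bitCost_val_le C hk rfl)).exec
    exact ⟨T, s, h, (Nat.cast_le.2 hT).trans (time_le C hk rfl)⟩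
  · obtain ⟨T, s, h, hT, -⟩ := (detectProg_spec_of_lt (ω := ω) (C := C) hk).exec
    exact ⟨T, s, h, (Nat.cast_le.2 hT).trans (time_le_of_lt C rfl)⟩

end Time

/-! ### Acceptance -/

/-- Acceptance only asks for some halting run; since runs are deterministic once the coins are
fixed, it is the one described by `detectProg_spec`. -/
theorem accepts_detectProg_iff {n : ℕ} {C : Circuit n} {k : ℕ} (hk : k ≤ n) (ω : ℕ → Bool) :
    Accepts detectProg C k ω ↔ ∃ i < trials C k, TrialSucceeds ω C k (colors k) (varBits n k)
      (baseBits C k) (i * trialCoins C k) := by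
  obtain ⟨T, s, h, -, h0⟩ := (detectProg_spec (ω := ω) hk (sizeBound C hk rfl)
    (bitCost_val_le C hk rfl)).exec
  constructor
  · rintro ⟨T', s', h', h0'⟩
    rw [← (h.det h').2, h0] at h0'
    by_contra hc
    rw [if_neg hc] at h0'
    exact zero_ne_one h0'
  · intro hs
    exact ⟨T, s, h, by rw [h0, if_pos hs]⟩

theorem theorem3 :
    ∃ A : Prog,
      -- no false positives
      (∀ (n k : ℕ) (C : Circuit n), ¬ HasMultilinearTerm k C.poly →
        ∀ ω : ℕ → Bool, ¬ Accepts A C k ω) ∧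
      -- a degree-`k` multilinear term is found with high probability
      (∀ (n k : ℕ) (C : Circuit n), HasMultilinearTerm k C.poly →
        (99 / 100 : ℝ≥0∞) ≤ coinMeasure {ω | Accepts A C k ω}) ∧
      -- running time in general, for every outcome of the coin flips
      (∃ p : Polynomial ℕ, ∀ (n k : ℕ) (C : Circuit n) (ω : ℕ → Bool),
        HaltsWithin A C k ω
          ((4.32 : ℝ) ^ k * C.size * (p.eval (n + C.depth + Nat.size C.size) : ℕ))) ∧
      -- running time when the depth and the logarithm of the size are polynomially bounded in `n`
      (∀ q : Polynomial ℕ, ∃ p : Polynomial ℕ, ∀ (n k : ℕ) (C : Circuit n) (ω : ℕ → Bool),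
        C.depth ≤ q.eval n → Nat.size C.size ≤ q.eval n →
          HaltsWithin A C k ω ((4.32 : ℝ) ^ k * C.size * (p.eval n : ℕ))) := by
  -- The second polynomial arises from the first by replacing the depth and the logarithm of the
  -- size by their common bound `q`.
  refine ⟨detectProg, fun n k C hC ω hA => ?_, fun n k C hC => ?_,
    ⟨.C timeConst * (.X + 1) ^ 12, fun n k C ω => ?_⟩,
    fun q => ⟨.C timeConst * (.X + q + q + 1) ^ 12, fun n k C ω hd hs => ?_⟩⟩
  · rcases le_or_gt k n with hk | hk
    · obtain ⟨i, -, hi⟩ := (accepts_detectProg_iff hk ω).1 hA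
      exact not_trialSucceeds (by unfold colors blocks; omega) (by unfold colors blocks; omega)
        hC hi
    · obtain ⟨T, s, h, -, h0⟩ := (detectProg_spec_of_lt (ω := ω) (C := C) hk).exec
      obtain ⟨T', s', h', h1⟩ := hA
      rw [← (h.det h').2, h0] at h1
      exact zero_ne_one h1
  · have hk : k ≤ n := not_lt.1 fun hk => not_hasMultilinearTerm_of_lt hk hC
    simp only [accepts_detectProg_iff hk]
    exact le_coinMeasure_exists_trialSucceeds hC
  · simpa using haltsWithin_detectProg C k ω
  · obtain ⟨T, s, h, hT⟩ := haltsWithin_detectProg C k ω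
    refine ⟨T, s, h, hT.trans ?_⟩
    simp only [Polynomial.eval_mul, Polynomial.eval_C, Polynomial.eval_pow, Polynomial.eval_add,
      Polynomial.eval_X, Polynomial.eval_one]
    gcongr
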